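/- Let $R>0$, $T>0$, $I=(0,R)$, $Q_T=(0,T)\times I$, let $a,b,\lambda,\beta,\gamma$ be real constants, and let $p_0\in[1,4]$, $p_1\in[1,2]$. Let $u_0\in L_2(I)$, $\mu,\nu,h\in L_2(0,T)$ and $f\in L_1(Q_T)$ be complex-valued. Consider the initial-boundary value problem for $u=u(t,x)$ $$i u_t + a u_{xx} + i b u_x + i u_{xxx} + \lambda |u|^{p_0}u + i\beta\bigl(|u|^{p_1}u\bigr)_x + i\gamma\bigl(|u|^{p_1}\bigr)_x u = f(t,x)\quad\text{in } Q_T,$$ $$u(0,x)=u_0(x),\qquad u(t,0)=\mu(t),\quad u(t,R)=\nu(t),\quad u_x(t,R)=h(t).$$ Let $X(Q_T)=C([0,T];L_2(I))\cap L_2(0,T;H^1(I))$. A function $u\in X(Q_T)$ is called a weak solution of this problem if $u(t,0)=\mu(t)$ and $u(t,R)=\nu(t)$ for a.e. $t\in(0,T)$, the functions $|u|^{p_0}u$, $|u|^{p_1}u$, $|u|^{p_1}u_x$ belong to $L_1(Q_T)$, and for every test function $\phi\in C^1([0,T];L_2(I))\cap C([0,T];(H^3\cap H^1_0)(I))$ with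 $\phi|_{t=T}\equiv 0$ and $\phi_x|_{x=0}\equiv 0$ $$\iint_{Q_T}\Bigl[i u\phi_t + a u_x\phi_x + i b u\phi_x - i u_x\phi_{xx} - \lambda|u|^{p_0}u\phi + i\beta|u|^{p_1}u\phi_x + i\gamma|u|^{p_1}(u\phi)_x + f\phi\Bigr]\,dx\,dt + i\int_0^R u_0\,\phi|_{t=0}\,dx + i\int_0^T h\,\phi_x|_{x=R}\,dt = 0.$$ Then a weak solution of the problem is unique in the whole space $X(Q_T)$: if $u,\widetilde u\in X(Q_T)$ are two weak solutions with the same data $u_0,\mu,\nu,h,f$, then $u(t,\cdot)=\widetilde u(t,\cdot)$ in $L_2(I)$ for every $t\in[0,T]$. -/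

import Mathlib

open MeasureTheory Set Filter Topology
open scoped ContDiff

namespace HNLS

/-- Lebesgue measure on the interval `I = (0, R)` (also used for the time interval `(0, T)`). -/
noncomputable def muI (R : ℝ) : Measure ℝ := volume.restrict (Ioo 0 R)

/-- Lebesgue measure on the rectangle `Q_T = (0, T) × (0, R)`; points are `(t, x)`. -/
noncomputable def muQ (T R : ℝ) : Measure (ℝ × ℝ) := volume.restrict (Ioo 0 T ×ˢ Ioo 0 R)

/-- `y ∈ H¹(0, R)` with weak derivative `y' = z`:
both functions are in `L₂(0, R)` and `∫ y ψ' = - ∫ z ψ` for all `ψ ∈ C_c^∞((0, R))`. -/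
def IsH1 (R : ℝ) (y z : ℝ → ℂ) : Prop :=
  MemLp y 2 (muI R) ∧ MemLp z 2 (muI R) ∧
    ∀ ψ : ℝ → ℂ, ContDiff ℝ ∞ ψ → HasCompactSupport ψ → tsupport ψ ⊆ Ioo 0 R →
      ∫ x, y x * deriv ψ x ∂(muI R) = - ∫ x, z x * ψ x ∂(muI R)

/-- The value at the point `x₀ ∈ [0, R]` of (the continuous representative on `[0, R]` of) `y`
is `c`. For `y ∈ H¹(0, R)` such a representative exists; it is unique as soon as `0 < R`. -/
def HasTrace (R : ℝ) (y : ℝ → ℂ) (x₀ : ℝ) (c : ℂ) : Prop :=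
  ∃ g : ℝ → ℂ, ContinuousOn g (Icc 0 R) ∧ y =ᵐ[muI R] g ∧ g x₀ = c

/-- `v ∈ C([0, T]; L₂(0, R))`, where `v` is a function of `(t, x)` that is jointly measurable on
`Q_T` up to a null set (every continuous curve in `L₂(0, R)` has such a representative). -/
structure IsContCurve (T R : ℝ) (v : ℝ → ℝ → ℂ) : Prop where
  aestronglyMeasurable : AEStronglyMeasurable (fun p : ℝ × ℝ => v p.1 p.2) (muQ T R)
  memLp : ∀ t ∈ Icc 0 T, MemLp (v t) 2 (muI R)
  tendsto : ∀ s ∈ Icc 0 T,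
    Tendsto (fun t => eLpNorm (fun x => v t x - v s x) 2 (muI R)) (𝓝[Icc 0 T] s) (𝓝 0)

/-- `u ∈ X(Q_T) = C([0, T]; L₂(0, R)) ∩ L₂(0, T; H¹(0, R))`, with weak derivative `u_x = ux`. -/
structure IsX (T R : ℝ) (u ux : ℝ → ℝ → ℂ) : Prop where
  contCurve : IsContCurve T R u
  memLp : MemLp (fun p : ℝ × ℝ => ux p.1 p.2) 2 (muQ T R)
  isH1 : ∀ᵐ t ∂(muI T), IsH1 R (u t) (ux t)

/-- The test functions `φ ∈ C¹([0, T]; L₂(I)) ∩ C([0, T]; (H³ ∩ H¹₀)(I))`, `I = (0, R)`, with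
`φ|_{t = T} = 0` and `φ_x|_{x = 0} = 0`, together with their derivatives `φ_t` (in the norm of
`L₂(I)`) and `φ_x`, `φ_xx`, `φ_xxx` (weak), and the boundary values `φ_x|_{x = R}`. -/
structure TestFunction (T R : ℝ) where
  φ : ℝ → ℝ → ℂ
  φt : ℝ → ℝ → ℂ
  φx : ℝ → ℝ → ℂ
  φxx : ℝ → ℝ → ℂ
  φxxx : ℝ → ℝ → ℂ
  φxR : ℝ → ℂ
  cont : IsContCurve T R φ
  cont_t : IsContCurve T R φt
  cont_x : IsContCurve T R φx
  cont_xx : IsContCurve T R φxx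
  cont_xxx : IsContCurve T R φxxx
  hasDeriv_t : ∀ s ∈ Icc 0 T,
    Tendsto
      (fun t => eLpNorm
        (fun x => (((t - s)⁻¹ : ℝ) : ℂ) * (φ t x - φ s x) - φt s x) 2 (muI R))
      (𝓝[Icc 0 T \ {s}] s) (𝓝 0)
  isH1 : ∀ t ∈ Icc 0 T, IsH1 R (φ t) (φx t)
  isH1_x : ∀ t ∈ Icc 0 T, IsH1 R (φx t) (φxx t)
  isH1_xx : ∀ t ∈ Icc 0 T, IsH1 R (φxx t) (φxxx t)
  trace_left : ∀ t ∈ Icc 0 T, HasTrace R (φ t) 0 0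
  trace_right : ∀ t ∈ Icc 0 T, HasTrace R (φ t) R 0
  trace_x_left : ∀ t ∈ Icc 0 T, HasTrace R (φx t) 0 0
  trace_x_right : ∀ t ∈ Icc 0 T, HasTrace R (φx t) R (φxR t)
  final : φ T =ᵐ[muI R] 0

/-- `|z|^p` as a complex number. -/
noncomputable def absPow (p : ℝ) (z : ℂ) : ℂ := ((‖z‖ ^ p : ℝ) : ℂ)

/-- The real coefficients and exponents of the equation
`i u_t + a u_xx + i b u_x + i u_xxx + lam |u|^p₀ u + i β (|u|^p₁ u)_x + i γ (|u|^p₁)_x u = f`. -/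
structure Coeffs where
  a : ℝ
  b : ℝ
  lam : ℝ
  β : ℝ
  γ : ℝ
  p₀ : ℝ
  p₁ : ℝ

/-- The integrand over `Q_T` of the integral identity; the derivative `(u φ)_x` is written out
as `u_x φ + u φ_x`. -/
noncomputable def integrand (c : Coeffs) {T R : ℝ} (f u ux : ℝ → ℝ → ℂ) (Φ : TestFunction T R)
    (t x : ℝ) : ℂ :=
  Complex.I * u t x * Φ.φt t x + c.a * ux t x * Φ.φx t x + Complex.I * c.b * u t x * Φ.φx t x
    - Complex.I * ux t x * Φ.φxx t x
    - c.lam * (absPow c.p₀ (u t x) * u t x) * Φ.φ t x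
    + Complex.I * c.β * (absPow c.p₁ (u t x) * u t x) * Φ.φx t x
    + Complex.I * c.γ * absPow c.p₁ (u t x) * (ux t x * Φ.φ t x + u t x * Φ.φx t x)
    + f t x * Φ.φ t x

/-- `u ∈ X(Q_T)` is a weak solution of the initial-boundary value problem for the equation with
coefficients `c`, right-hand side `f`, initial condition `u(0, x) = u₀(x)` and boundary conditions
`u(t, 0) = μ(t)`, `u(t, R) = ν(t)`, `u_x(t, R) = h(t)`. -/
def IsWeakSolution (c : Coeffs) (T R : ℝ) (u₀ : ℝ → ℂ) (μ ν h : ℝ → ℂ) (f : ℝ → ℝ → ℂ)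
    (u : ℝ → ℝ → ℂ) : Prop :=
  ∃ ux : ℝ → ℝ → ℂ, IsX T R u ux ∧
    (∀ᵐ t ∂(muI T), HasTrace R (u t) 0 (μ t)) ∧
    (∀ᵐ t ∂(muI T), HasTrace R (u t) R (ν t)) ∧
    Integrable (fun p : ℝ × ℝ => absPow c.p₀ (u p.1 p.2) * u p.1 p.2) (muQ T R) ∧
    Integrable (fun p : ℝ × ℝ => absPow c.p₁ (u p.1 p.2) * u p.1 p.2) (muQ T R) ∧
    Integrable (fun p : ℝ × ℝ => absPow c.p₁ (u p.1 p.2) * ux p.1 p.2) (muQ T R) ∧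
    ∀ Φ : TestFunction T R,
      (∫ p, integrand c f u ux Φ p.1 p.2 ∂(muQ T R))
        + Complex.I * (∫ x, u₀ x * Φ.φ 0 x ∂(muI R))
        + Complex.I * (∫ t, h t * Φ.φxR t ∂(muI T)) = 0

end HNLS

/-! The difference `w = u - v` has zero initial and boundary data and satisfies `i w_t + a w_xx + i
b w_x + i w_xxx = ` nonlinear differences. Formally one multiplies by `(1 + x) w̄`, integrates over
the interval and takes a real part. The growing weight turns the third-order term into a negative
multiple of `‖w_x‖²` plus a boundary term of good sign, and the only dangerous contribution of `a
w_xx`, namely `a ∫ (1 + x)|w_x|²`, drops out because it is real where an imaginary part is needed.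
Hence, with norms in `L₂(0, R)`, `‖w(t)‖² + ∫₀ᵗ ‖w_x‖²` is bounded by a constant times `∫₀ᵗ (‖w‖² +
‖F₁‖² + ‖F₀‖ ‖w‖)`, where `F₁` (`fluxDiff`) is the difference of the terms paired with `φ_x` and
`F₀` (`sourceDiff`) that of the terms paired with `φ`.

The nonlinear differences are controlled by a weight `s(t)` comparable to `1 + ‖u_x‖ + ‖v_x‖`, which
is square integrable in time. In one dimension `|u|²` and `|v|²` are at most `s`, so `p₁ ≤ 2` gives
`|u|^p₁ ≤ s` and `p₀ ≤ 4` gives `|u|^p₀ ≤ s²`. Moreover `sup |w|² ≤ 2 ‖w‖ ‖w_x‖`, because `w`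
vanishes at the endpoint `0`. It follows that `‖F₁‖ ≤ C s ‖w‖` and `‖F₀‖ ‖w‖ ≤ C (s² ‖w‖² + s ‖w‖
‖w_x‖)` (`exists_slice_bounds`). The part with `w_x` is absorbed by the gained `∫ ‖w_x‖²`, and
Gronwall's lemma with the integrable coefficient `s²` gives `w = 0`.

The rigorous difficulty is that `w` is not an admissible multiplier: it has neither a time
derivative in `L₂` nor three space derivatives. Separated test functions `η(t) ψ(x)` first give the
equation integrated in time against each profile `ψ` (`weak_identity_sub`). Forward Steklov averages
of `w` then have a time derivative in `L₂`, and at each fixed time satisfy a stationary weak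
equation. That equation forces regularity: the averaged `w_x` is absolutely continuous and vanishes
at `x = R` (`exists_isPrimitive_of_weak_form`), so the weighted integrations by parts become
legitimate (`re_integral_weighted_le`, `exists_dissipation_bound`). Removing the average with
Fatou's lemma gives `energy_inequality`. -/

namespace HNLS

/-! ### Primitives on the interval and integration by parts -/

/-- `F` is, on `[0, R]`, a primitive of the integrable function `f`. -/
structure IsPrimitive (R : ℝ) (F f : ℝ → ℂ) : Prop where
  intervalIntegrable : IntervalIntegrable f volume 0 R
  eq : ∀ x ∈ Icc 0 R, F x = F 0 + ∫ y in (0 : ℝ)..x, f y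

theorem integral_muI {R : ℝ} (hR : 0 ≤ R) {E : Type*} [NormedAddCommGroup E] [NormedSpace ℝ E]
    (f : ℝ → E) : ∫ x, f x ∂(muI R) = ∫ x in (0 : ℝ)..R, f x := by
  rw [muI, intervalIntegral.integral_of_le hR, integral_Ioc_eq_integral_Ioo]

theorem integrable_muI_iff {R : ℝ} (hR : 0 ≤ R) {E : Type*} [NormedAddCommGroup E]
    {f : ℝ → E} : Integrable f (muI R) ↔ IntervalIntegrable f volume 0 R := by
  rw [intervalIntegrable_iff_integrableOn_Ioo_of_le hR]; rfl

instance isFiniteMeasure_muI (R : ℝ) : IsFiniteMeasure (muI R) := by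
  unfold muI; infer_instance

theorem intervalIntegrable_of_memLp {R : ℝ} (hR : 0 ≤ R) {f : ℝ → ℂ} (hf : MemLp f 2 (muI R)) :
    IntervalIntegrable f volume 0 R :=
  (integrable_muI_iff hR).1 (hf.integrable (by norm_num))

/-- Increments of the complex primitive are dominated by those of the real primitive of `‖f‖`, so
the same `δ` serves for both. -/
theorem absolutelyContinuousOnInterval_primitive {f : ℝ → ℂ} {a b : ℝ}
    (h : IntervalIntegrable f volume a b) :
    AbsolutelyContinuousOnInterval (fun x => ∫ v in a..x, f v) a b := by
  have hn : AbsolutelyContinuousOnInterval (fun x => ∫ v in a..x, ‖f v‖) a b :=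
    h.norm.absolutelyContinuousOnInterval_intervalIntegral (by simp)
  rw [absolutelyContinuousOnInterval_iff] at hn ⊢
  intro ε hε
  obtain ⟨δ, hδ, H⟩ := hn ε hε
  refine ⟨δ, hδ, fun E hE hs => lt_of_le_of_lt (Finset.sum_le_sum fun i hi => ?_) (H E hE hs)⟩
  have hm := hE.1 i hi
  have h1 : IntervalIntegrable f volume a (E.2 i).1 :=
    h.mono_set (uIcc_subset_uIcc (by simp) hm.1)
  have h2 : IntervalIntegrable f volume a (E.2 i).2 :=
    h.mono_set (uIcc_subset_uIcc (by simp) hm.2)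
  rw [dist_eq_norm, Real.dist_eq, intervalIntegral.integral_interval_sub_left h1 h2,
    intervalIntegral.integral_interval_sub_left h1.norm h2.norm]
  exact intervalIntegral.norm_integral_le_abs_integral_norm

namespace IsPrimitive

variable {R : ℝ} {F f G g : ℝ → ℂ}

theorem absolutelyContinuousOnInterval (hR : 0 ≤ R) (h : IsPrimitive R F f) :
    AbsolutelyContinuousOnInterval F 0 R := by
  have h1 := absolutelyContinuousOnInterval_primitive h.intervalIntegrable
  rw [absolutelyContinuousOnInterval_iff] at h1 ⊢
  intro ε hε
  obtain ⟨δ, hδ, H⟩ := h1 ε hε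
  refine ⟨δ, hδ, fun E hE hs => lt_of_le_of_lt (Finset.sum_le_sum fun i hi => ?_) (H E hE hs)⟩
  have hm := hE.1 i hi
  rw [uIcc_of_le hR] at hm
  rw [h.eq _ hm.1, h.eq _ hm.2, dist_add_left]

theorem continuousOn (hR : 0 ≤ R) (h : IsPrimitive R F f) : ContinuousOn F (Icc 0 R) := by
  simpa [uIcc_of_le hR] using (h.absolutelyContinuousOnInterval hR).continuousOn

theorem ae_hasDerivAt (hR : 0 ≤ R) (h : IsPrimitive R F f) :
    ∀ᵐ x, x ∈ uIcc 0 R → HasDerivAt F (f x) x := by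
  have h0 : ∀ᵐ x : ℝ, x ≠ 0 := by simp [ae_iff, measure_singleton]
  have h1 : ∀ᵐ x : ℝ, x ≠ R := by simp [ae_iff, measure_singleton]
  filter_upwards [h.intervalIntegrable.ae_hasDerivAt_integral, h0, h1] with x hx hx0 hx1 hm
  have := (hx hm 0 (by simp)).const_add (F 0)
  refine this.congr_of_eventuallyEq ?_
  rw [uIcc_of_le hR] at hm
  filter_upwards [Icc_mem_nhds (lt_of_le_of_ne hm.1 hx0.symm) (lt_of_le_of_ne hm.2 hx1)] with y hy
  exact h.eq y hy

/-- Subtracting the primitive of `f` leaves an absolutely continuous function with zero derivative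
almost everywhere, hence a constant. This reduces product rules to an almost everywhere computation.
-/
theorem of_absolutelyContinuousOnInterval (hR : 0 ≤ R)
    (hF : AbsolutelyContinuousOnInterval F 0 R) (hf : IntervalIntegrable f volume 0 R)
    (hd : ∀ᵐ x, x ∈ uIcc 0 R → HasDerivAt F (f x) x) : IsPrimitive R F f := by
  refine ⟨hf, ?_⟩
  have hac := hF.fun_sub (absolutelyContinuousOnInterval_primitive hf)
  obtain ⟨C, hC⟩ := hac.const_of_ae_hasDerivAt_zero (by
    filter_upwards [hd, hf.ae_hasDerivAt_integral] with x hx1 hx2 hm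
    have := (hx1 hm).sub (hx2 hm 0 (by simp))
    rw [sub_self] at this
    exact this)
  intro x hx
  rw [uIcc_of_le hR] at hC
  have e1 := hC x hx
  have e0 := hC 0 ⟨le_rfl, hR⟩
  simp only [intervalIntegral.integral_same, sub_zero] at e0
  rw [e0, ← e1]; ring

theorem mul (hR : 0 ≤ R) (h : IsPrimitive R F f) (k : IsPrimitive R G g) :
    IsPrimitive R (fun x => F x * G x) (fun x => f x * G x + F x * g x) := by
  refine of_absolutelyContinuousOnInterval hR ?_ ?_ ?_
  · exact (h.absolutelyContinuousOnInterval hR).smul (k.absolutelyContinuousOnInterval hR)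
  · exact (h.intervalIntegrable.mul_continuousOn (by rw [uIcc_of_le hR]; exact k.continuousOn hR)).add
      (k.intervalIntegrable.continuousOn_mul (by rw [uIcc_of_le hR]; exact h.continuousOn hR))
  · filter_upwards [h.ae_hasDerivAt hR, k.ae_hasDerivAt hR] with x hx1 hx2 hm
    exact (hx1 hm).mul (hx2 hm)

theorem conj (h : IsPrimitive R F f) :
    IsPrimitive R (fun x => starRingEnd ℂ (F x)) (fun x => starRingEnd ℂ (f x)) := by
  refine ⟨?_, fun x hx => ?_⟩
  · have := h.intervalIntegrable
    rw [intervalIntegrable_iff] at this ⊢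
    exact (Complex.conjCLE.toContinuousLinearMap.integrable_comp this)
  · rw [h.eq x hx, map_add]
    congr 1
    have := Complex.conjCLE.toContinuousLinearMap.intervalIntegral_comp_comm
      (h.intervalIntegrable.mono_set (uIcc_subset_uIcc left_mem_uIcc (Icc_subset_uIcc hx)))
    simpa using this.symm

theorem of_contDiff (hF : ContDiff ℝ 1 F) : IsPrimitive R F (deriv F) := by
  refine ⟨(hF.continuous_deriv le_rfl).intervalIntegrable _ _, fun x _ => ?_⟩
  rw [intervalIntegral.integral_deriv_eq_sub (fun y _ => hF.differentiable (by norm_num) y)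
    ((hF.continuous_deriv le_rfl).intervalIntegrable _ _)]
  ring

theorem of_intervalIntegrable (hf : IntervalIntegrable f volume 0 R) :
    IsPrimitive R (fun x => ∫ y in (0 : ℝ)..x, f y) f :=
  ⟨hf, fun x _ => by simp⟩

theorem congr_deriv (h : IsPrimitive R F f) (hR : 0 ≤ R) (hfg : f =ᵐ[muI R] g) :
    IsPrimitive R F g := by
  have hg : IntervalIntegrable g volume 0 R :=
    (integrable_muI_iff hR).1 (((integrable_muI_iff hR).2 h.intervalIntegrable).congr hfg)
  refine ⟨hg, fun x hx => ?_⟩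
  rw [h.eq x hx]
  congr 1
  rw [← integral_muI hx.1, ← integral_muI hx.1]
  refine integral_congr_ae (ae_mono (Measure.restrict_mono (Ioo_subset_Ioo_right hx.2) le_rfl) hfg)

theorem sub (h : IsPrimitive R F f) (k : IsPrimitive R G g) :
    IsPrimitive R (fun x => F x - G x) (fun x => f x - g x) := by
  refine ⟨h.intervalIntegrable.sub k.intervalIntegrable, fun x hx => ?_⟩
  have hs : uIcc 0 x ⊆ uIcc 0 R := uIcc_subset_uIcc left_mem_uIcc (Icc_subset_uIcc hx)
  rw [intervalIntegral.integral_sub (h.intervalIntegrable.mono_set hs)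
    (k.intervalIntegrable.mono_set hs), h.eq x hx, k.eq x hx]
  ring

theorem integral_sub (h : IsPrimitive R F f) (x y : ℝ) (hx : x ∈ Icc 0 R) (hy : y ∈ Icc 0 R) :
    F y - F x = ∫ z in x..y, f z := by
  rw [h.eq x hx, h.eq y hy, add_sub_add_left_eq_sub,
    intervalIntegral.integral_interval_sub_left]
  · exact h.intervalIntegrable.mono_set (uIcc_subset_uIcc left_mem_uIcc (Icc_subset_uIcc hy))
  · exact h.intervalIntegrable.mono_set (uIcc_subset_uIcc left_mem_uIcc (Icc_subset_uIcc hx))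

theorem integral_mul (hR : 0 ≤ R) (h : IsPrimitive R F f) (k : IsPrimitive R G g) :
    ∫ x, (f x * G x + F x * g x) ∂(muI R) = F R * G R - F 0 * G 0 := by
  have := (h.mul hR k).eq R ⟨hR, le_rfl⟩
  rw [integral_muI hR, this]; ring

end IsPrimitive

/-! ### Traces, the du Bois-Reymond lemma and one-dimensional Sobolev estimates -/

/-- Continuous functions on `[0, R]` that agree almost everywhere agree everywhere. -/
theorem eqOn_of_ae_eq {R : ℝ} (hR : 0 < R) {F G : ℝ → ℂ} (hF : ContinuousOn F (Icc 0 R))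
    (hG : ContinuousOn G (Icc 0 R)) (h : F =ᵐ[muI R] G) : EqOn F G (Icc 0 R) := by
  have h' : F =ᵐ[volume.restrict (Icc 0 R)] G := by
    rw [← restrict_Ioo_eq_restrict_Icc]; exact h
  exact Measure.eqOn_Icc_of_ae_eq volume hR.ne h' hF hG

theorem HasTrace.eq {R : ℝ} (hR : 0 < R) {y Y : ℝ → ℂ} {x₀ : ℝ} {c : ℂ} (h : HasTrace R y x₀ c)
    (hY : ContinuousOn Y (Icc 0 R)) (hy : y =ᵐ[muI R] Y) (hx : x₀ ∈ Icc 0 R) : Y x₀ = c := by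
  obtain ⟨g, hg, hyg, rfl⟩ := h
  exact eqOn_of_ae_eq hR hY hg (hy.symm.trans hyg) hx

theorem integral_muI_mul_contDiff {R : ℝ} (hR : 0 ≤ R) {F f θ : ℝ → ℂ} (h : IsPrimitive R F f)
    (hθ : ContDiff ℝ 1 θ) :
    ∫ x, F x * deriv θ x ∂(muI R) = F R * θ R - F 0 * θ 0 - ∫ x, f x * θ x ∂(muI R) := by
  have k := IsPrimitive.of_contDiff (R := R) hθ
  rw [← h.integral_mul hR k, integral_add]
  · ring
  · exact (integrable_muI_iff hR).2 (h.intervalIntegrable.mul_continuousOn hθ.continuous.continuousOn)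
  · refine (integrable_muI_iff hR).2 (k.intervalIntegrable.continuousOn_mul ?_)
    rw [uIcc_of_le hR]; exact h.continuousOn hR

theorem integrable_mul_continuous {R : ℝ} (hR : 0 ≤ R) {f θ : ℝ → ℂ} (hf : Integrable f (muI R))
    (hθ : ContinuousOn θ (Icc 0 R)) : Integrable (fun x => f x * θ x) (muI R) := by
  rw [integrable_muI_iff hR] at hf ⊢
  exact hf.mul_continuousOn (by rwa [uIcc_of_le hR])

/-- A smooth function supported in `(0, R)` whose integral vanishes is the derivative of a smooth
function supported in `(0, R)`. -/
theorem exists_primitive_of_integral_eq_zero {R : ℝ} {χ : ℝ → ℂ} (hχ : ContDiff ℝ ∞ χ)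
    {K : Set ℝ} (hK : IsCompact K) (hne : K.Nonempty) (hKR : K ⊆ Ioo 0 R)
    (hs : ∀ x, x ∉ K → χ x = 0) (h0 : ∫ x in (0 : ℝ)..R, χ x = 0) :
    ∃ ψ : ℝ → ℂ, ContDiff ℝ ∞ ψ ∧ HasCompactSupport ψ ∧ tsupport ψ ⊆ Ioo 0 R ∧ deriv ψ = χ := by
  have hd : ∀ x, HasDerivAt (fun x => ∫ y in (0 : ℝ)..x, χ y) (χ x) x := fun x =>
    intervalIntegral.integral_hasDerivAt_right (hχ.continuous.intervalIntegrable _ _)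
      hχ.continuous.aestronglyMeasurable.stronglyMeasurableAtFilter hχ.continuous.continuousAt
  have hda : deriv (fun x => ∫ y in (0 : ℝ)..x, χ y) = χ := funext fun x => (hd x).deriv
  have ha := hKR (hK.sInf_mem hne)
  have hb := hKR (hK.sSup_mem hne)
  -- To the left of `K` the integrand is zero up to `x`; to the right the remaining integral is
  -- zero, so the value is the total integral, which vanishes.
  have hz : ∀ x, x ∉ Icc (sInf K) (sSup K) → ∫ y in (0 : ℝ)..x, χ y = 0 := by
    intro x hx
    have hout : ∀ y, y ∉ Icc (sInf K) (sSup K) → χ y = 0 := fun y hy =>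
      hs y fun hyK => hy ⟨csInf_le hK.bddBelow hyK, le_csSup hK.bddAbove hyK⟩
    rcases lt_or_ge x (sInf K) with h | h
    · refine intervalIntegral.integral_zero_ae (ae_of_all _ fun y hy => hout y fun hy' => ?_)
      have := hy.2
      rcases le_total 0 x with h' | h'
      · rw [max_eq_right h'] at this; linarith [hy'.1]
      · rw [max_eq_left h'] at this; linarith [hy'.1, ha.1]
    · have h2 : sSup K < x := by
        by_contra hc
        exact hx ⟨h, not_lt.1 hc⟩
      have : ∫ y in x..R, χ y = 0 := by
        refine intervalIntegral.integral_zero_ae (ae_of_all _ fun y hy => hout y fun hy' => ?_)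
        have := hy.1
        rcases le_total x R with h' | h'
        · rw [min_eq_left h'] at this; linarith [hy'.2]
        · rw [min_eq_right h'] at this; linarith [hy'.2, hb.2]
      rw [← intervalIntegral.integral_add_adjacent_intervals (b := x)
        (hχ.continuous.intervalIntegrable _ _) (hχ.continuous.intervalIntegrable _ _), this,
        add_zero] at h0
      exact h0
  refine ⟨fun x => ∫ y in (0 : ℝ)..x, χ y, ?_, ?_, ?_, hda⟩
  · rw [contDiff_infty_iff_deriv, hda]
    exact ⟨fun x => (hd x).differentiableAt, hχ⟩
  · exact HasCompactSupport.intro isCompact_Icc hz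
  · refine (closure_minimal (fun x hx => ?_) isClosed_Icc).trans
      (Icc_subset_Ioo ha.1 hb.2 : Icc (sInf K) (sSup K) ⊆ Ioo 0 R)
    by_contra hc
    exact hx (hz x hc)

theorem ae_eq_zero_of_integral_smul {R : ℝ} {y : ℝ → ℂ} (hy : Integrable y (muI R))
    (h : ∀ θ : ℝ → ℝ, ContDiff ℝ ∞ θ → HasCompactSupport θ → tsupport θ ⊆ Ioo 0 R →
      ∫ x, y x * (θ x : ℂ) ∂(muI R) = 0) : y =ᵐ[muI R] 0 := by
  have hy' : IntegrableOn y (Ioo 0 R) volume := hy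
  have := isOpen_Ioo.ae_eq_zero_of_integral_contDiff_smul_eq_zero hy'.locallyIntegrableOn
    (fun g hg hc hs => by
      rw [← h g hg hc hs, muI, ← setIntegral_eq_integral_of_forall_compl_eq_zero (s := Ioo 0 R)]
      · simp [mul_comm]
      · intro x hx
        rw [image_eq_zero_of_notMem_tsupport (fun hx' => hx (hs hx')), zero_smul])
  exact (ae_restrict_iff' measurableSet_Ioo).2 this

/-- The lemma of du Bois-Reymond. -/
theorem ae_eq_const_of_integral_mul_deriv_eq_zero {R : ℝ} (hR : 0 < R) {y : ℝ → ℂ}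
    (hy : Integrable y (muI R))
    (h : ∀ ψ : ℝ → ℂ, ContDiff ℝ ∞ ψ → HasCompactSupport ψ → tsupport ψ ⊆ Ioo 0 R →
      ∫ x, y x * deriv ψ x ∂(muI R) = 0) : ∃ c : ℂ, y =ᵐ[muI R] fun _ => c := by
  -- A bump with outer radius `R / 4` about the midpoint stays inside `(0, R)`. The constant sought
  -- is the mean of `y` against its normalization.
  let B : ContDiffBump (R / 2) := ⟨R / 8, R / 4, by positivity, by linarith⟩
  have hBs : tsupport (B.normed volume) ⊆ Ioo 0 R := by
    rw [B.tsupport_normed_eq, Real.closedBall_eq_Icc]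
    refine Icc_subset_Ioo ?_ ?_ <;> simp only [B] <;> linarith
  have hB1 : ∫ x in (0 : ℝ)..R, (B.normed volume x : ℂ) = 1 := by
    rw [intervalIntegral.integral_of_le hR.le, integral_Ioc_eq_integral_Ioo,
      setIntegral_eq_integral_of_forall_compl_eq_zero, integral_complex_ofReal, B.integral_normed]
    · simp
    · intro x hx
      rw [image_eq_zero_of_notMem_tsupport (fun hx' => hx (hBs hx')), Complex.ofReal_zero]
  have hBc : ContDiff ℝ ∞ fun x => (B.normed volume x : ℂ) :=
    Complex.ofRealCLM.contDiff.comp (B.contDiff_normed (n := (⊤ : ℕ∞)))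
  refine ⟨∫ x, y x * (B.normed volume x : ℂ) ∂(muI R), ?_⟩
  set c := ∫ x, y x * (B.normed volume x : ℂ) ∂(muI R) with hc
  have hint : Integrable (fun x => y x - c) (muI R) := hy.sub (integrable_const c)
  have key := ae_eq_zero_of_integral_smul hint (fun θ hθ hθc hθs => by
    have hθC : ContDiff ℝ ∞ fun x => (θ x : ℂ) := Complex.ofRealCLM.contDiff.comp hθ
    -- An arbitrary `θ` minus `m` times the unit-mass bump has mean zero, so it is the derivative of
    -- an admissible `ψ`.
    set m : ℂ := ∫ x in (0 : ℝ)..R, (θ x : ℂ) with hm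
    obtain ⟨ψ, hψ, hψc, hψs, hψd⟩ := exists_primitive_of_integral_eq_zero
      (R := R) (χ := fun x => (θ x : ℂ) - m * (B.normed volume x : ℂ))
      (hθC.sub (contDiff_const.mul hBc))
      (K := tsupport θ ∪ tsupport (B.normed volume)) (hθc.isCompact.union B.hasCompactSupport_normed)
      ⟨R / 2, Or.inr (by
        rw [B.tsupport_normed_eq]; exact Metric.mem_closedBall_self B.rOut_pos.le)⟩
      (union_subset hθs hBs)
      (fun x hx => by
        rw [image_eq_zero_of_notMem_tsupport (fun hx' => hx (Or.inl hx')),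
          image_eq_zero_of_notMem_tsupport (fun hx' => hx (Or.inr hx'))]
        simp)
      (by
        rw [intervalIntegral.integral_sub (hθC.continuous.intervalIntegrable _ _)
          ((hBc.continuous.intervalIntegrable _ _).const_mul m),
          intervalIntegral.integral_const_mul, hB1, ← hm]
        ring)
    have h1 := h ψ hψ hψc hψs
    have i1 := integrable_mul_continuous hR.le hy hθC.continuous.continuousOn
    have i2 := integrable_mul_continuous hR.le hy hBc.continuous.continuousOn
    have i3 := integrable_mul_continuous hR.le (integrable_const c) hθC.continuous.continuousOn
    rw [hψd] at h1
    simp only [mul_sub] at h1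
    have e2 : (fun x => y x * (m * (B.normed volume x : ℂ)))
      = fun x => m * (y x * (B.normed volume x : ℂ)) := by ext x; ring
    rw [integral_sub i1 (by rw [e2]; exact i2.const_mul m), e2, integral_const_mul, ← hc] at h1
    simp only [sub_mul]
    rw [integral_sub i1 i3, integral_const_mul, integral_muI hR.le (fun x => (θ x : ℂ)), ← hm, ← h1]
    ring)
  filter_upwards [key] with x hx
  exact sub_eq_zero.1 hx

/-- The difference between `y` and a primitive of `z` annihilates every `ψ'`, so it is constant by
du Bois-Reymond. This provides the absolutely continuous representative used for traces and sup
bounds. -/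
theorem IsH1.exists_isPrimitive {R : ℝ} (hR : 0 < R) {y z : ℝ → ℂ} (h : IsH1 R y z) :
    ∃ Y : ℝ → ℂ, IsPrimitive R Y z ∧ y =ᵐ[muI R] Y := by
  obtain ⟨hy, hz, hyz⟩ := h
  have hV := IsPrimitive.of_intervalIntegrable (intervalIntegrable_of_memLp hR.le hz)
  have hVi : Integrable (fun x => ∫ y in (0 : ℝ)..x, z y) (muI R) :=
    (integrable_muI_iff hR.le).2 (by
      refine ContinuousOn.intervalIntegrable ?_
      rw [uIcc_of_le hR.le]; exact hV.continuousOn hR.le)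
  have hyi := hy.integrable (by norm_num : (1 : ENNReal) ≤ 2)
  obtain ⟨c, hc⟩ := ae_eq_const_of_integral_mul_deriv_eq_zero hR (hyi.sub hVi)
    (fun ψ hψ hψc hψs => by
      have hd : Continuous (deriv ψ) := hψ.continuous_deriv (by simp)
      have e0 : ψ 0 = 0 := image_eq_zero_of_notMem_tsupport fun hx => (hψs hx).1.false
      have eR : ψ R = 0 := image_eq_zero_of_notMem_tsupport fun hx => (hψs hx).2.false
      have := integral_muI_mul_contDiff hR.le hV (hψ.of_le (by simp))
      simp only [Pi.sub_apply, sub_mul]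
      rw [integral_sub (integrable_mul_continuous hR.le hyi hd.continuousOn)
        (integrable_mul_continuous hR.le hVi hd.continuousOn), hyz ψ hψ hψc hψs, this, e0, eR]
      simp)
  refine ⟨fun x => c + ∫ y in (0 : ℝ)..x, z y, ⟨hV.intervalIntegrable, fun x _ => by simp⟩, ?_⟩
  filter_upwards [hc] with x hx
  rw [← hx]; simp

/-- The derivative of `|Y|²` is bounded by `2 |Y| |z|`. Keeping the second point free lets one
either average over it or choose it to be a zero of `Y`. -/
theorem IsPrimitive.sq_norm_le {R : ℝ} (hR : 0 ≤ R) {Y z : ℝ → ℂ} (h : IsPrimitive R Y z)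
    {x x' : ℝ} (hx : x ∈ Icc 0 R) (hx' : x' ∈ Icc 0 R) :
    ‖Y x‖ ^ 2 ≤ ‖Y x'‖ ^ 2 + 2 * ∫ y, ‖Y y‖ * ‖z y‖ ∂(muI R) := by
  have hm := h.mul hR h.conj
  have e := hm.integral_sub x' x hx' hx
  have hi : IntervalIntegrable (fun y => 2 * (‖Y y‖ * ‖z y‖)) volume 0 R :=
    (h.intervalIntegrable.norm.continuousOn_mul (by
      rw [uIcc_of_le hR]; exact (h.continuousOn hR).norm)).const_mul 2
  have hb : ‖∫ y in x'..x, (z y * (starRingEnd ℂ) (Y y) + Y y * (starRingEnd ℂ) (z y))‖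
      ≤ 2 * ∫ y, ‖Y y‖ * ‖z y‖ ∂(muI R) := by
    rw [← integral_const_mul]
    refine (intervalIntegral.norm_integral_le_integral_norm_uIoc).trans ?_
    have hsub : uIoc x' x ⊆ Ioc 0 R := by
      rw [← uIoc_of_le hR]
      rw [uIoc_of_le hR]
      exact Ioc_subset_Ioc (le_min hx'.1 hx.1) (max_le hx'.2 hx.2)
    rw [integral_muI hR, intervalIntegral.integral_of_le hR]
    have hiO : IntegrableOn (fun y => 2 * (‖Y y‖ * ‖z y‖)) (Ioc 0 R) :=
      (intervalIntegrable_iff_integrableOn_Ioc_of_le hR).1 hi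
    have hmO := ((intervalIntegrable_iff_integrableOn_Ioc_of_le hR).1 hm.intervalIntegrable)
    refine (setIntegral_mono_on (hmO.mono_set hsub).norm (hiO.mono_set hsub)
      measurableSet_uIoc fun y _ => ?_).trans
      (setIntegral_mono_set hiO (ae_of_all _ fun y => by positivity) hsub.eventuallyLE)
    refine (norm_add_le _ _).trans (le_of_eq ?_)
    rw [norm_mul, norm_mul, RCLike.norm_conj, RCLike.norm_conj]; ring
  rw [← e, Complex.mul_conj, Complex.mul_conj, Complex.normSq_eq_norm_sq, Complex.normSq_eq_norm_sq,
    ← Complex.ofReal_sub, Complex.norm_real, Real.norm_eq_abs] at hb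
  linarith [le_abs_self (‖Y x‖ ^ 2 - ‖Y x'‖ ^ 2)]

/-- A function with vanishing boundary values satisfies the integration by parts formula
against every smooth function. -/
theorem integral_mul_deriv_of_trace_zero {R : ℝ} (hR : 0 < R) {Y z : ℝ → ℂ}
    (h : IsPrimitive R Y z) (h0 : Y 0 = 0) (h1 : Y R = 0) {θ : ℝ → ℂ} (hθ : ContDiff ℝ ∞ θ) :
    ∫ x, Y x * deriv θ x ∂(muI R) = -∫ x, z x * θ x ∂(muI R) := by
  rw [integral_muI_mul_contDiff hR.le h (hθ.of_le (by simp)), h0, h1]; ring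

/-- Conversely, the integration by parts formula against all smooth functions forces zero
boundary values. -/
theorem exists_isPrimitive_of_integral_mul_deriv {R : ℝ} (hR : 0 < R) {W P : ℝ → ℂ}
    (hW : MemLp W 2 (muI R)) (hP : MemLp P 2 (muI R))
    (h : ∀ θ : ℝ → ℂ, ContDiff ℝ ∞ θ →
      ∫ x, W x * deriv θ x ∂(muI R) = -∫ x, P x * θ x ∂(muI R)) :
    ∃ Y : ℝ → ℂ, IsPrimitive R Y P ∧ W =ᵐ[muI R] Y ∧ Y 0 = 0 ∧ Y R = 0 := by
  obtain ⟨Y, hY, hWY⟩ := IsH1.exists_isPrimitive hR ⟨hW, hP, fun ψ hψ _ _ => h ψ hψ⟩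
  have key : ∀ θ : ℝ → ℂ, ContDiff ℝ ∞ θ → Y R * θ R - Y 0 * θ 0 = 0 := fun θ hθ => by
    have e1 := h θ hθ
    have e2 := integral_muI_mul_contDiff hR.le hY (hθ.of_le (by simp))
    have e3 : ∫ x, W x * deriv θ x ∂(muI R) = ∫ x, Y x * deriv θ x ∂(muI R) :=
      integral_congr_ae (by filter_upwards [hWY] with x hx; rw [hx])
    rw [← e3, e1] at e2
    linear_combination -e2
  -- The two endpoint values are separated by `θ = 1` and `θ = x`: the second gives `R · Y(R) = 0`,
  -- then the first gives `Y(0) = Y(R)`.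
  have k1 := key (fun _ => 1) contDiff_const
  have k2 := key (fun x => (x : ℂ)) Complex.ofRealCLM.contDiff
  have hRC : (R : ℂ) ≠ 0 := by exact_mod_cast hR.ne'
  simp only [Complex.ofReal_zero, mul_zero, sub_zero, mul_eq_zero, hRC, or_false] at k2
  refine ⟨Y, hY, hWY, ?_, k2⟩
  rw [k2] at k1; simpa using k1

theorem exists_contDiff_primitive {χ : ℝ → ℂ} (hχ : ContDiff ℝ ∞ χ) :
    ∃ ψ : ℝ → ℂ, ContDiff ℝ ∞ ψ ∧ deriv ψ = χ ∧ ψ 0 = 0 := by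
  have hd : ∀ x, HasDerivAt (fun x => ∫ y in (0 : ℝ)..x, χ y) (χ x) x := fun x =>
    intervalIntegral.integral_hasDerivAt_right (hχ.continuous.intervalIntegrable _ _)
      hχ.continuous.aestronglyMeasurable.stronglyMeasurableAtFilter hχ.continuous.continuousAt
  have hda : deriv (fun x => ∫ y in (0 : ℝ)..x, χ y) = χ := funext fun x => (hd x).deriv
  refine ⟨fun x => ∫ y in (0 : ℝ)..x, χ y, ?_, hda, by simp⟩
  rw [contDiff_infty_iff_deriv, hda]
  exact ⟨fun x => (hd x).differentiableAt, hχ⟩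

/-! ### The stationary weak form: hidden regularity and the weighted energy estimate -/

/-- A function orthogonal to all smooth functions that are orthogonal to `R - x` is a multiple of
`R - x`. -/
theorem exists_ae_eq_mul_of_orthogonal {R : ℝ} (hR : 0 < R) {X : ℝ → ℂ} (hX : Integrable X (muI R))
    (h : ∀ θ : ℝ → ℂ, ContDiff ℝ ∞ θ → ∫ x, (R - x : ℂ) * θ x ∂(muI R) = 0 →
      ∫ x, X x * θ x ∂(muI R) = 0) :
    ∃ c : ℂ, X =ᵐ[muI R] fun x => c * (R - x : ℂ) := by
  have hl : ContDiff ℝ ∞ fun x : ℝ => (R - x : ℂ) := contDiff_const.sub Complex.ofRealCLM.contDiff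
  -- This is the squared norm `R³ / 3` of `R - x`; it must be nonzero in order to project a test
  -- function onto the orthogonal complement.
  set N : ℂ := ∫ x, (R - x : ℂ) * (R - x : ℂ) ∂(muI R) with hN
  have hN0 : N ≠ 0 := by
    have : N = ((R ^ 3 / 3 : ℝ) : ℂ) := by
      rw [hN, integral_muI hR.le]
      have : (fun x : ℝ => (R - x : ℂ) * (R - x : ℂ)) = fun x : ℝ => (((R - x) ^ 2 : ℝ) : ℂ) := by
        ext x; push_cast; ring
      rw [this, intervalIntegral.integral_ofReal,
        intervalIntegral.integral_comp_sub_left (fun x => x ^ 2) R]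
      simp [integral_pow]; norm_num
    rw [this]
    exact_mod_cast (by positivity : R ^ 3 / 3 ≠ 0)
  have hXl := integrable_mul_continuous hR.le hX hl.continuous.continuousOn
  refine ⟨(∫ x, X x * (R - x : ℂ) ∂(muI R)) / N, ?_⟩
  set A := ∫ x, X x * (R - x : ℂ) ∂(muI R) with hA
  have hli : Integrable (fun x : ℝ => (R - x : ℂ)) (muI R) :=
    (integrable_muI_iff hR.le).2 (hl.continuous.intervalIntegrable _ _)
  have hci : Integrable (fun x : ℝ => A / N * (R - x : ℂ)) (muI R) := hli.const_mul _
  have key := ae_eq_zero_of_integral_smul (hX.sub hci) (fun θ hθ _ _ => by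
    have hθC : ContDiff ℝ ∞ fun x => (θ x : ℂ) := Complex.ofRealCLM.contDiff.comp hθ
    set m : ℂ := ∫ x, (R - x : ℂ) * (θ x : ℂ) ∂(muI R) with hm
    have i1 := integrable_mul_continuous hR.le hX hθC.continuous.continuousOn
    have i2 := integrable_mul_continuous hR.le hli hθC.continuous.continuousOn
    have i3 := integrable_mul_continuous hR.le hli hl.continuous.continuousOn
    have h1 := h (fun x => (θ x : ℂ) - m / N * (R - x : ℂ)) (hθC.sub (contDiff_const.mul hl)) (by
      have : (fun x : ℝ => (R - x : ℂ) * ((θ x : ℂ) - m / N * (R - x : ℂ)))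
          = fun x : ℝ => (R - x : ℂ) * (θ x : ℂ) - m / N * ((R - x : ℂ) * (R - x : ℂ)) := by
        ext x; ring
      rw [this, integral_sub i2 (i3.const_mul _), integral_const_mul, ← hm, ← hN]
      field_simp; ring)
    have e1 : (fun x : ℝ => X x * ((θ x : ℂ) - m / N * (R - x : ℂ)))
        = fun x : ℝ => X x * (θ x : ℂ) - m / N * (X x * (R - x : ℂ)) := by
      ext x; ring
    rw [e1, integral_sub i1 (hXl.const_mul _), integral_const_mul, ← hA] at h1
    have e2 : (fun x : ℝ => (X - fun x : ℝ => A / N * (R - x : ℂ)) x * (θ x : ℂ))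
        = fun x : ℝ => X x * (θ x : ℂ) - A / N * ((R - x : ℂ) * (θ x : ℂ)) := by
      ext x; simp only [Pi.sub_apply]; ring
    rw [e2, integral_sub i1 (i2.const_mul _), integral_const_mul, ← hm]
    linear_combination h1)
  filter_upwards [key] with x hx
  exact sub_eq_zero.1 hx

/-- The smooth test profiles in the domain of the adjoint operator. -/
def IsProfile (R : ℝ) (ψ : ℝ → ℂ) : Prop :=
  ContDiff ℝ ∞ ψ ∧ ψ 0 = 0 ∧ ψ R = 0 ∧ deriv ψ 0 = 0

/-- The second-order regularity and the boundary condition `P(R) = 0` hidden in the stationary weak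
form of the equation. -/
theorem exists_isPrimitive_of_weak_form {R : ℝ} (hR : 0 < R) {P D K F : ℝ → ℂ}
    (hP : Integrable P (muI R)) (hD : Integrable D (muI R)) (hK : Integrable K (muI R))
    (hF : Integrable F (muI R))
    (h : ∀ ψ : ℝ → ℂ, IsProfile R ψ →
      Complex.I * ∫ x, D x * ψ x ∂(muI R) = (∫ x, K x * deriv ψ x ∂(muI R))
        - Complex.I * (∫ x, P x * deriv (deriv ψ) x ∂(muI R)) + ∫ x, F x * ψ x ∂(muI R)) :
    ∃ Q Z : ℝ → ℂ, ∃ c : ℂ, IsPrimitive R Q (fun x => Complex.I * D x - F x) ∧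
      IsPrimitive R Z (fun x => Complex.I * (c + Q x + K x)) ∧ P =ᵐ[muI R] Z ∧ Z R = 0 := by
  have hE : Integrable (fun x => Complex.I * D x - F x) (muI R) := (hD.const_mul _).sub hF
  have hQ := IsPrimitive.of_intervalIntegrable ((integrable_muI_iff hR.le).1 hE)
  set Q : ℝ → ℂ := fun x => ∫ y in (0 : ℝ)..x, (Complex.I * D y - F y) with hQdef
  have hQi : Integrable Q (muI R) := (integrable_muI_iff hR.le).2 (by
    refine ContinuousOn.intervalIntegrable ?_
    rw [uIcc_of_le hR.le]; exact hQ.continuousOn hR.le)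
  have hQK : Integrable (fun x => Q x + K x) (muI R) := hQi.add hK
  have hQ2 := IsPrimitive.of_intervalIntegrable ((integrable_muI_iff hR.le).1 hQK)
  set Q2 : ℝ → ℂ := fun x => ∫ y in (0 : ℝ)..x, (Q y + K y) with hQ2def
  have hQ2i : Integrable Q2 (muI R) := (integrable_muI_iff hR.le).2 (by
    refine ContinuousOn.intervalIntegrable ?_
    rw [uIcc_of_le hR.le]; exact hQ2.continuousOn hR.le)
  have hXi : Integrable (fun x => Complex.I * P x + Q2 x - Q2 R) (muI R) :=
    ((hP.const_mul _).add hQ2i).sub (integrable_const _)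
  -- The profile conditions `ψ(0) = ψ'(0) = 0` determine `ψ` from `θ = ψ''`, and `ψ(R) = ∫ (R - x)
  -- θ`. Second derivatives of profiles are thus exactly the smooth functions orthogonal to `R - x`.
  -- Moving derivatives off `ψ` tests `i P + Q2 - Q2(R)` against such `θ`; the constant `Q2(R)` is
  -- the boundary term at `R`, where `ψ'` is unrestricted.
  obtain ⟨c, hc⟩ := exists_ae_eq_mul_of_orthogonal hR hXi (fun θ hθ hθ0 => by
    obtain ⟨χ, hχ, hχd, hχ0⟩ := exists_contDiff_primitive hθ
    obtain ⟨ψ, hψ, hψd, hψ0⟩ := exists_contDiff_primitive hχ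
    have hl1 : IsPrimitive R (fun x : ℝ => (R - x : ℂ)) (fun _ => -1) := by
      refine ⟨by simp, fun x _ => ?_⟩
      simp; ring
    have hχR : ∫ x, θ x ∂(muI R) = χ R := by
      have := (IsPrimitive.of_contDiff (R := R) (hχ.of_le (by simp) : ContDiff ℝ 1 χ)).eq R
        ⟨hR.le, le_rfl⟩
      rw [integral_muI hR.le, this, hχd, hχ0, zero_add]
    have hψR : ψ R = 0 := by
      have e1 := (IsPrimitive.of_contDiff (R := R) (hψ.of_le (by simp) : ContDiff ℝ 1 ψ)).eq R
        ⟨hR.le, le_rfl⟩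
      rw [hψ0, zero_add, hψd, ← integral_muI hR.le] at e1
      have e2 := integral_muI_mul_contDiff hR.le hl1 (hχ.of_le (by simp) : ContDiff ℝ 1 χ)
      rw [hχd, hθ0, hχ0] at e2
      simp only [neg_mul, one_mul, integral_neg, ← e1] at e2
      simpa using e2.symm
    have h1 := h ψ ⟨hψ, hψ0, hψR, by rw [hψd, hχ0]⟩
    rw [hψd, hχd] at h1
    have e3 := integral_muI_mul_contDiff hR.le hQ (hψ.of_le (by simp) : ContDiff ℝ 1 ψ)
    have e4 := integral_muI_mul_contDiff hR.le hQ2 (hχ.of_le (by simp) : ContDiff ℝ 1 χ)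
    rw [hψd, hψR, hψ0] at e3
    rw [hχd, hχ0] at e4
    have cψ := hψ.continuous.continuousOn (s := Icc 0 R)
    have cχ := hχ.continuous.continuousOn (s := Icc 0 R)
    have cθ := hθ.continuous.continuousOn (s := Icc 0 R)
    have iDψ := integrable_mul_continuous hR.le hD cψ
    have iFψ := integrable_mul_continuous hR.le hF cψ
    have iQχ := integrable_mul_continuous hR.le hQi cχ
    have iKχ := integrable_mul_continuous hR.le hK cχ
    have iPθ := integrable_mul_continuous hR.le hP cθ
    have iQ2θ := integrable_mul_continuous hR.le hQ2i cθ
    have iθ : Integrable θ (muI R) := (integrable_muI_iff hR.le).2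
      (hθ.continuous.intervalIntegrable _ _)
    have e5 : ∫ x, (Complex.I * D x - F x) * ψ x ∂(muI R)
        = Complex.I * (∫ x, D x * ψ x ∂(muI R)) - ∫ x, F x * ψ x ∂(muI R) := by
      rw [← integral_const_mul, ← integral_sub (iDψ.const_mul _) iFψ]
      congr 1; ext x; ring
    have e6 : ∫ x, (Q x + K x) * χ x ∂(muI R)
        = (∫ x, Q x * χ x ∂(muI R)) + ∫ x, K x * χ x ∂(muI R) := by
      rw [← integral_add iQχ iKχ]
      congr 1; ext x; ring
    have e7 : ∫ x, (Complex.I * P x + Q2 x - Q2 R) * θ x ∂(muI R)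
        = Complex.I * (∫ x, P x * θ x ∂(muI R)) + (∫ x, Q2 x * θ x ∂(muI R)) - Q2 R * χ R := by
      have i4 : Integrable (fun x => Complex.I * (P x * θ x) + Q2 x * θ x) (muI R) :=
        (iPθ.const_mul _).add iQ2θ
      rw [← hχR, ← integral_const_mul, ← integral_const_mul,
        ← integral_add (iPθ.const_mul _) iQ2θ, ← integral_sub i4 (iθ.const_mul _)]
      congr 1; ext x; ring
    rw [e7]
    rw [e5] at e3
    rw [e6] at e4
    linear_combination e4 - e3 + h1)
  -- This is `i P + Q2 - Q2(R) = c (R - x)` solved for `P`. The right-hand side vanishes at `x = R`,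
  -- which is the natural boundary condition.
  refine ⟨Q, fun x => -Complex.I * (c * (R - x : ℂ) + Q2 R - Q2 x), c, hQ, ⟨?_, fun x hx => ?_⟩,
    ?_, by simp⟩
  · refine (integrable_muI_iff hR.le).1 ?_
    exact (((integrable_const c).add hQi).add hK).const_mul _
  · have hs : uIcc 0 x ⊆ uIcc 0 R := uIcc_subset_uIcc left_mem_uIcc (Icc_subset_uIcc hx)
    have e : ∀ y, Complex.I * (c + Q y + K y) = Complex.I * c + Complex.I * (Q y + K y) :=
      fun y => by ring
    simp only [e]
    rw [intervalIntegral.integral_add (by simp)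
      ((hQ2.intervalIntegrable.mono_set hs).const_mul _), intervalIntegral.integral_const_mul,
      intervalIntegral.integral_const]
    simp [hQ2def]
    ring
  · filter_upwards [hc] with x hx
    have h2 : Complex.I * P x = c * (R - x : ℂ) + Q2 R - Q2 x := by linear_combination hx
    rw [← h2]
    linear_combination (P x) * Complex.I_sq

/-- The weighted energy inequality for the stationary weak form. -/
theorem re_integral_weighted_le {R : ℝ} (hR : 0 < R) {Y P D K F : ℝ → ℂ}
    (hY : IsPrimitive R Y P) (hY0 : Y 0 = 0) (hYR : Y R = 0)
    (hD : Integrable D (muI R)) (hK : Integrable K (muI R)) (hF : Integrable F (muI R))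
    (h : ∀ ψ : ℝ → ℂ, IsProfile R ψ →
      Complex.I * ∫ x, D x * ψ x ∂(muI R) = (∫ x, K x * deriv ψ x ∂(muI R))
        - Complex.I * (∫ x, P x * deriv (deriv ψ) x ∂(muI R)) + ∫ x, F x * ψ x ∂(muI R)) :
    (∫ x, D x * ((1 + x : ℂ) * starRingEnd ℂ (Y x)) ∂(muI R)).re ≤
      (-Complex.I * ((∫ x, F x * ((1 + x : ℂ) * starRingEnd ℂ (Y x)) ∂(muI R))
        + ∫ x, K x * (starRingEnd ℂ (Y x) + (1 + x : ℂ) * starRingEnd ℂ (P x)) ∂(muI R))).re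
        - ∫ x, ‖P x‖ ^ 2 ∂(muI R) := by
  have hPi : Integrable P (muI R) := (integrable_muI_iff hR.le).2 hY.intervalIntegrable
  -- From here on `P` is replaced by its absolutely continuous representative `Z`, so that pointwise
  -- boundary values make sense.
  obtain ⟨Q, Z, c, hQ, hZ, hPZ, hZR⟩ := exists_isPrimitive_of_weak_form hR hPi hD hK hF h
  have hYZ : IsPrimitive R Y Z := hY.congr_deriv hR.le hPZ
  have eK : ∫ x, K x * (starRingEnd ℂ (Y x) + (1 + x : ℂ) * starRingEnd ℂ (P x)) ∂(muI R)
      = ∫ x, K x * (starRingEnd ℂ (Y x) + (1 + x : ℂ) * starRingEnd ℂ (Z x)) ∂(muI R) :=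
    integral_congr_ae (by filter_upwards [hPZ] with x hx; rw [hx])
  have eP : ∫ x, ‖P x‖ ^ 2 ∂(muI R) = ∫ x, ‖Z x‖ ^ 2 ∂(muI R) :=
    integral_congr_ae (by filter_upwards [hPZ] with x hx; rw [hx])
  rw [eK, eP]
  have hρ : IsPrimitive R (fun x : ℝ => (1 + x : ℂ)) (fun _ => 1) := by
    refine ⟨by simp, fun x _ => ?_⟩
    simp
  have hρY := hρ.mul hR.le hYZ.conj
  have cY := hYZ.conj.continuousOn hR.le
  have cZ := hZ.conj.continuousOn hR.le
  have cZ' := hZ.continuousOn hR.le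
  have cρ := hρ.continuousOn hR.le
  have cQ := hQ.continuousOn hR.le
  have cY' : ContinuousOn (fun x : ℝ => (1 + x : ℂ) * starRingEnd ℂ (Y x)) (Icc 0 R) := cρ.mul cY
  have cZ'' : ContinuousOn (fun x : ℝ => (1 + x : ℂ) * starRingEnd ℂ (Z x)) (Icc 0 R) := cρ.mul cZ
  have cYZ : ContinuousOn
      (fun x : ℝ => starRingEnd ℂ (Y x) + (1 + x : ℂ) * starRingEnd ℂ (Z x)) (Icc 0 R) :=
    cY.add cZ''
  have int_of_cont : ∀ {g : ℝ → ℂ}, ContinuousOn g (Icc 0 R) → Integrable g (muI R) := by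
    intro g hg
    refine (integrable_muI_iff hR.le).2 (ContinuousOn.intervalIntegrable ?_)
    rwa [uIcc_of_le hR.le]
  set S : ℝ → ℂ := fun x => Complex.I * (c + Q x + K x) with hS
  have hSi : Integrable S (muI R) := (integrable_muI_iff hR.le).2 hZ.intervalIntegrable
  have iD := integrable_mul_continuous hR.le hD cY'
  have iF := integrable_mul_continuous hR.le hF cY'
  have iK := integrable_mul_continuous hR.le hK cYZ
  have iSY := integrable_mul_continuous hR.le hSi cY
  have iSZ := integrable_mul_continuous hR.le hSi cZ''
  have iQ : Integrable (fun x : ℝ => Q x *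
      (starRingEnd ℂ (Y x) + (1 + x : ℂ) * starRingEnd ℂ (Z x))) (muI R) := int_of_cont (cQ.mul cYZ)
  have iZZ : Integrable (fun x : ℝ => Z x * starRingEnd ℂ (Z x)) (muI R) := int_of_cont (cZ'.mul cZ)
  -- the four integrations by parts
  have b1 := hQ.integral_mul hR.le hρY
  have b2 := hρY.eq R ⟨hR.le, le_rfl⟩
  have b3 := hZ.integral_mul hR.le hYZ.conj
  have b4 := hρ.integral_mul hR.le (hZ.mul hR.le hZ.conj)
  simp only [hY0, hYR, map_zero, mul_zero, sub_zero, zero_add, one_mul, hZR, zero_sub,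
    Complex.ofReal_zero, add_zero] at b1 b2 b3 b4
  rw [← integral_muI hR.le] at b2
  have e1 : ∫ x, ((Complex.I * D x - F x) * ((1 + x : ℂ) * starRingEnd ℂ (Y x)) +
      Q x * (starRingEnd ℂ (Y x) + (1 + x : ℂ) * starRingEnd ℂ (Z x))) ∂(muI R)
      = Complex.I * (∫ x, D x * ((1 + x : ℂ) * starRingEnd ℂ (Y x)) ∂(muI R))
        - (∫ x, F x * ((1 + x : ℂ) * starRingEnd ℂ (Y x)) ∂(muI R))
        + ∫ x, Q x * (starRingEnd ℂ (Y x) + (1 + x : ℂ) * starRingEnd ℂ (Z x)) ∂(muI R) := by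
    have i1 : Integrable (fun x : ℝ => Complex.I * (D x * ((1 + x : ℂ) * starRingEnd ℂ (Y x)))
      - F x * ((1 + x : ℂ) * starRingEnd ℂ (Y x))) (muI R) := (iD.const_mul _).sub iF
    rw [← integral_const_mul, ← integral_sub (iD.const_mul _) iF, ← integral_add i1 iQ]
    congr 1; ext x; ring
  have e2 : (∫ x, S x * starRingEnd ℂ (Y x) ∂(muI R))
      + (∫ x, S x * ((1 + x : ℂ) * starRingEnd ℂ (Z x)) ∂(muI R))
      = Complex.I * (c * (∫ x, (starRingEnd ℂ (Y x) + (1 + x : ℂ) * starRingEnd ℂ (Z x)) ∂(muI R))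
        + (∫ x, Q x * (starRingEnd ℂ (Y x) + (1 + x : ℂ) * starRingEnd ℂ (Z x)) ∂(muI R))
        + ∫ x, K x * (starRingEnd ℂ (Y x) + (1 + x : ℂ) * starRingEnd ℂ (Z x)) ∂(muI R)) := by
    have i0 := int_of_cont cYZ
    have i1 : Integrable (fun x : ℝ => c * (starRingEnd ℂ (Y x) + (1 + x : ℂ) * starRingEnd ℂ (Z x))
      + Q x * (starRingEnd ℂ (Y x) + (1 + x : ℂ) * starRingEnd ℂ (Z x))) (muI R) :=
      (i0.const_mul _).add iQ
    rw [← integral_add iSY iSZ, ← integral_const_mul, ← integral_add (i0.const_mul _) iQ,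
      ← integral_add i1 iK, ← integral_const_mul]
    congr 1; ext x; simp only [hS]; ring
  have e3 : (∫ x, (S x * starRingEnd ℂ (Y x) + Z x * starRingEnd ℂ (Z x)) ∂(muI R))
      = (∫ x, S x * starRingEnd ℂ (Y x) ∂(muI R)) + ∫ x, Z x * starRingEnd ℂ (Z x) ∂(muI R) :=
    integral_add iSY iZZ
  have e4 : ∫ x, Z x * starRingEnd ℂ (Z x) ∂(muI R) = ((∫ x, ‖Z x‖ ^ 2 ∂(muI R) : ℝ) : ℂ) := by
    rw [← integral_complex_ofReal]
    congr 1; ext x; rw [Complex.mul_conj, Complex.normSq_eq_norm_sq]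
  have e5 : (∫ x, (Z x * starRingEnd ℂ (Z x) + (1 + x : ℂ) *
      (S x * starRingEnd ℂ (Z x) + Z x * starRingEnd ℂ (S x))) ∂(muI R))
      = (∫ x, Z x * starRingEnd ℂ (Z x) ∂(muI R))
        + ((∫ x, S x * ((1 + x : ℂ) * starRingEnd ℂ (Z x)) ∂(muI R))
          + starRingEnd ℂ (∫ x, S x * ((1 + x : ℂ) * starRingEnd ℂ (Z x)) ∂(muI R))) := by
    have iSZc : Integrable (fun x : ℝ => starRingEnd ℂ (S x * ((1 + x : ℂ) * starRingEnd ℂ (Z x))))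
        (muI R) := Complex.conjCLE.toContinuousLinearMap.integrable_comp iSZ
    have i1 : Integrable (fun x : ℝ => S x * ((1 + x : ℂ) * starRingEnd ℂ (Z x)) +
      starRingEnd ℂ (S x * ((1 + x : ℂ) * starRingEnd ℂ (Z x)))) (muI R) := iSZ.add iSZc
    rw [← integral_conj, ← integral_add iSZ iSZc, ← integral_add iZZ i1]
    congr 1; ext x; simp; ring
  have e6 : -(Z 0 * starRingEnd ℂ (Z 0)) = ((-‖Z 0‖ ^ 2 : ℝ) : ℂ) := by
    rw [Complex.mul_conj, Complex.normSq_eq_norm_sq]; push_cast; ring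
  rw [e1] at b1
  rw [e3, e4] at b3
  rw [e5, e4, e6, Complex.add_conj] at b4
  -- The unknown constant `c` multiplies the integral of the derivative of `(1 + x) Ȳ`, which is
  -- zero since `Y` vanishes at both ends.
  rw [← b2] at e2
  set A := ∫ x, D x * ((1 + x : ℂ) * starRingEnd ℂ (Y x)) ∂(muI R)
  set B := ∫ x, F x * ((1 + x : ℂ) * starRingEnd ℂ (Y x)) ∂(muI R)
  set C := ∫ x, K x * (starRingEnd ℂ (Y x) + (1 + x : ℂ) * starRingEnd ℂ (Z x)) ∂(muI R)
  set U := ∫ x, S x * starRingEnd ℂ (Y x) ∂(muI R)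
  set V := ∫ x, S x * ((1 + x : ℂ) * starRingEnd ℂ (Z x)) ∂(muI R)
  set N := ∫ x, ‖Z x‖ ^ 2 ∂(muI R) with hN
  have hA : A = -Complex.I * (B + C) + (U + V) := by
    rw [e2]
    linear_combination (-Complex.I) * b1 + A * Complex.I_sq
  have hU : U.re = -N := by
    have := congrArg Complex.re b3
    simp at this
    linarith
  have hV : N + 2 * V.re = -‖Z 0‖ ^ 2 := by exact_mod_cast b4
  have hN0 : 0 ≤ N := integral_nonneg fun x => by positivity
  rw [hA, Complex.add_re, Complex.add_re]
  -- Here `Re U = -N` and, thanks to `Z(R) = 0`, `Re V = -(N + |Z(0)|²) / 2`. The total `-3N/2 -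
  -- |Z(0)|²/2` is weakened to `-N`.
  nlinarith [sq_nonneg ‖Z 0‖]

/-! ### The Hilbert space `L₂(0, R)`: pairings, the weight and the dissipation bound -/

theorem ae_muI_mem (R : ℝ) : ∀ᵐ x ∂(muI R), x ∈ Ioo 0 R := ae_restrict_mem measurableSet_Ioo

theorem memLp_of_continuousOn {R : ℝ} {ψ : ℝ → ℂ} (hψ : ContinuousOn ψ (Icc 0 R)) :
    MemLp ψ 2 (muI R) := by
  obtain ⟨C, hC⟩ := isCompact_Icc.exists_bound_of_continuousOn hψ
  refine MemLp.of_bound ((hψ.mono Ioo_subset_Icc_self).aestronglyMeasurable measurableSet_Ioo) C ?_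
  filter_upwards [ae_muI_mem R] with x hx using hC x (Ioo_subset_Icc_self hx)

theorem inner_L2_eq {R : ℝ} (f g : Lp ℂ 2 (muI R)) :
    inner ℂ f g = ∫ x, g x * starRingEnd ℂ (f x) ∂(muI R) := by
  rw [L2.inner_def]
  simp only [RCLike.inner_apply]

/-- The bilinear pairing `f ↦ ∫ f ψ` as a continuous linear functional on `L₂(0, R)`. -/
noncomputable def pairing (R : ℝ) (ψ : ℝ → ℂ) (hψ : Continuous ψ) : Lp ℂ 2 (muI R) →L[ℂ] ℂ :=
  innerSL ℂ ((memLp_of_continuousOn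
    (Complex.continuous_conj.comp hψ).continuousOn : MemLp _ 2 (muI R)).toLp _)

theorem pairing_apply {R : ℝ} {ψ : ℝ → ℂ} (hψ : Continuous ψ) (f : Lp ℂ 2 (muI R)) :
    pairing R ψ hψ f = ∫ x, f x * ψ x ∂(muI R) := by
  rw [pairing, innerSL_apply_apply, inner_L2_eq]
  refine integral_congr_ae ?_
  filter_upwards [(memLp_of_continuousOn
    (Complex.continuous_conj.comp hψ).continuousOn : MemLp _ 2 (muI R)).coeFn_toLp] with x hx
  rw [hx]; simp

theorem memLp_weight_mul {R : ℝ} {f : ℝ → ℂ} (hf : MemLp f 2 (muI R)) :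
    MemLp (fun x : ℝ => (1 + x : ℂ) * f x) 2 (muI R) := by
  refine hf.of_le_mul (c := 1 + R) ?_ ?_
  · exact (by fun_prop : Continuous fun x : ℝ => (1 + x : ℂ)).aestronglyMeasurable.mul hf.1
  · filter_upwards [ae_muI_mem R] with x hx
    rw [norm_mul]
    gcongr
    rw [← Complex.ofReal_one, ← Complex.ofReal_add, Complex.norm_real, Real.norm_eq_abs,
      abs_of_pos (by linarith [hx.1])]
    linarith [hx.2]

/-- Multiplication by the weight `1 + x` on `L₂(0, R)`. -/
noncomputable def weightMul (R : ℝ) : Lp ℂ 2 (muI R) →L[ℂ] Lp ℂ 2 (muI R) :=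
  LinearMap.mkContinuous
    { toFun := fun f => (memLp_weight_mul (Lp.memLp f)).toLp _
      map_add' := fun f g => by
        ext1
        filter_upwards [(memLp_weight_mul (Lp.memLp (f + g))).coeFn_toLp,
          (memLp_weight_mul (Lp.memLp f)).coeFn_toLp, (memLp_weight_mul (Lp.memLp g)).coeFn_toLp,
          Lp.coeFn_add f g, Lp.coeFn_add ((memLp_weight_mul (Lp.memLp f)).toLp _)
            ((memLp_weight_mul (Lp.memLp g)).toLp _)] with x h1 h2 h3 h4 h5
        rw [h1, h5, Pi.add_apply, h2, h3, h4, Pi.add_apply, mul_add]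
      map_smul' := fun c f => by
        ext1
        filter_upwards [(memLp_weight_mul (Lp.memLp (c • f))).coeFn_toLp,
          (memLp_weight_mul (Lp.memLp f)).coeFn_toLp,
          Lp.coeFn_smul c f, Lp.coeFn_smul c ((memLp_weight_mul (Lp.memLp f)).toLp _)]
          with x h1 h2 h4 h5
        rw [h1, RingHom.id_apply, h5, Pi.smul_apply, h2, h4, Pi.smul_apply, smul_eq_mul,
          smul_eq_mul]
        ring }
    (1 + R) (fun f => by
      refine Lp.norm_le_mul_norm_of_ae_le_mul ?_
      filter_upwards [ae_muI_mem R, (memLp_weight_mul (Lp.memLp f)).coeFn_toLp] with x hx h1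
      simp only [LinearMap.coe_mk, AddHom.coe_mk]
      rw [h1, norm_mul]
      gcongr
      rw [← Complex.ofReal_one, ← Complex.ofReal_add, Complex.norm_real, Real.norm_eq_abs,
        abs_of_pos (by linarith [hx.1])]
      linarith [hx.2])

theorem weightMul_ae {R : ℝ} (f : Lp ℂ 2 (muI R)) :
    weightMul R f =ᵐ[muI R] fun x => (1 + x : ℂ) * f x :=
  (memLp_weight_mul (Lp.memLp f)).coeFn_toLp

theorem norm_weightMul_le {R : ℝ} (hR : 0 ≤ R) (f : Lp ℂ 2 (muI R)) :
    ‖weightMul R f‖ ≤ (1 + R) * ‖f‖ :=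
  ((weightMul R).le_opNorm f).trans (by
    gcongr
    exact LinearMap.mkContinuous_norm_le _ (by positivity) _)

theorem inner_weightMul_left {R : ℝ} (f g : Lp ℂ 2 (muI R)) :
    inner ℂ (weightMul R f) g
      = ∫ x, g x * ((1 + x : ℂ) * starRingEnd ℂ (f x)) ∂(muI R) := by
  rw [inner_L2_eq]
  refine integral_congr_ae ?_
  filter_upwards [weightMul_ae f] with x hx
  rw [hx]; simp

theorem inner_weightMul_comm {R : ℝ} (f g : Lp ℂ 2 (muI R)) :
    inner ℂ (weightMul R f) g = inner ℂ f (weightMul R g) := by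
  rw [inner_L2_eq, inner_L2_eq]
  refine integral_congr_ae ?_
  filter_upwards [weightMul_ae f, weightMul_ae g] with x hx hx'
  rw [hx, hx']; simp; ring

theorem norm_sq_eq_integral {R : ℝ} (f : Lp ℂ 2 (muI R)) :
    ‖f‖ ^ 2 = ∫ x, ‖f x‖ ^ 2 ∂(muI R) := by
  have h := inner_L2_eq f f
  rw [inner_self_eq_norm_sq_to_K] at h
  have h2 : ∫ x, f x * starRingEnd ℂ (f x) ∂(muI R) = ((∫ x, ‖f x‖ ^ 2 ∂(muI R) : ℝ) : ℂ) := by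
    rw [← integral_complex_ofReal]
    congr 1; ext x; rw [Complex.mul_conj, Complex.normSq_eq_norm_sq]
  rw [h2] at h
  apply Complex.ofReal_injective
  rw [← h]
  push_cast
  rfl

/-- The weight is at least `1` on the interval, so the weighted energy controls the plain norm. -/
theorem norm_sq_le_re_inner_weightMul {R : ℝ} (f : Lp ℂ 2 (muI R)) :
    ‖f‖ ^ 2 ≤ (inner ℂ (weightMul R f) f).re := by
  have hi : Integrable (fun x => ‖f x‖ ^ 2) (muI R) := (Lp.memLp f).integrable_norm_pow (by norm_num)
  have h : inner ℂ (weightMul R f) f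
      = ((∫ x, (1 + x) * ‖f x‖ ^ 2 ∂(muI R) : ℝ) : ℂ) := by
    rw [inner_weightMul_left, ← integral_complex_ofReal]
    congr 1; ext x
    have : f x * starRingEnd ℂ (f x) = ((‖f x‖ ^ 2 : ℝ) : ℂ) := by
      rw [Complex.mul_conj, Complex.normSq_eq_norm_sq]
    push_cast at this ⊢
    rw [← this]; ring
  rw [h, Complex.ofReal_re, norm_sq_eq_integral]
  have hi2 : Integrable (fun x => (1 + x) * ‖f x‖ ^ 2) (muI R) := by
    refine (hi.const_mul (1 + R)).mono'
      ((by fun_prop : Continuous fun x : ℝ => 1 + x).aestronglyMeasurable.mul hi.1) ?_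
    filter_upwards [ae_muI_mem R] with x hx
    rw [Real.norm_eq_abs, abs_of_nonneg (mul_nonneg (by linarith [hx.1]) (by positivity))]
    gcongr
    exact hx.2.le
  refine integral_mono_ae hi hi2 ?_
  filter_upwards [ae_muI_mem R] with x hx
  nlinarith [hx.1, sq_nonneg ‖f x‖]

/-- Dissipation inequality for the stationary weak form with zero boundary values. -/
theorem exists_dissipation_bound {R : ℝ} (hR : 0 < R) (a b : ℝ) :
    ∃ C : ℝ, 0 ≤ C ∧ ∀ W P D F₁ F₀ : Lp ℂ 2 (muI R),
      (∀ θ : ℝ → ℂ, ContDiff ℝ ∞ θ →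
        ∫ x, W x * deriv θ x ∂(muI R) = -∫ x, P x * θ x ∂(muI R)) →
      (∀ ψ : ℝ → ℂ, IsProfile R ψ →
        Complex.I * ∫ x, D x * ψ x ∂(muI R)
          = (∫ x, ((a : ℂ) • P + (Complex.I * b) • W + F₁ : Lp ℂ 2 (muI R)) x * deriv ψ x ∂(muI R))
            - Complex.I * (∫ x, P x * deriv (deriv ψ) x ∂(muI R)) + ∫ x, F₀ x * ψ x ∂(muI R)) →
      (inner ℂ (weightMul R W) D).re ≤ -(1 / 2 * ‖P‖ ^ 2)
        + C * (‖W‖ ^ 2 + ‖F₁‖ ^ 2 + ‖F₀‖ * ‖W‖) := by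
  -- A generous sum of the coefficients produced by Young's inequality below; the last `1 + R`
  -- bounds the weight in the `F₀` term.
  refine ⟨(|a| ^ 2 + 1 + |b| + (1 + R) ^ 2 * (|b| ^ 2 + 1) * 4) + (1 + R), by positivity, ?_⟩
  intro W P D F₁ F₀ hWP hE
  obtain ⟨Y, hY, hWY, hY0, hYR⟩ :=
    exists_isPrimitive_of_integral_mul_deriv hR (Lp.memLp W) (Lp.memLp P) hWP
  have hint : ∀ f : Lp ℂ 2 (muI R), Integrable f (muI R) := fun f =>
    (Lp.memLp f).integrable (by norm_num)
  have key := re_integral_weighted_le hR hY hY0 hYR (hint D)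
    (hint ((a : ℂ) • P + (Complex.I * b) • W + F₁)) (hint F₀) hE
  set K : Lp ℂ 2 (muI R) := (a : ℂ) • P + (Complex.I * b) • W + F₁ with hK
  have e1 : ∀ f : Lp ℂ 2 (muI R), ∫ x, f x * ((1 + x : ℂ) * starRingEnd ℂ (Y x)) ∂(muI R)
      = inner ℂ (weightMul R W) f := fun f => by
    rw [inner_weightMul_left]
    exact integral_congr_ae (by filter_upwards [hWY] with x hx; rw [hx])
  have e2 : ∫ x, K x * (starRingEnd ℂ (Y x) + (1 + x : ℂ) * starRingEnd ℂ (P x)) ∂(muI R)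
      = inner ℂ (W + weightMul R P) K := by
    rw [inner_L2_eq]
    refine integral_congr_ae ?_
    filter_upwards [hWY, weightMul_ae P, Lp.coeFn_add W (weightMul R P)] with x hx h2 h3
    rw [h3, Pi.add_apply, hx, h2]
    simp
  rw [e1, e1, e2, ← norm_sq_eq_integral] at key
  -- Multiplication by a real weight is symmetric. The term `a ∫ (1 + x)|P|²`, too large to be
  -- absorbed for general `a`, therefore contributes nothing after multiplication by `-i` and taking
  -- real parts.
  have hreal : (inner ℂ (weightMul R P) P).im = 0 := by
    have h1 : starRingEnd ℂ (inner ℂ (weightMul R P) P) = inner ℂ (weightMul R P) P := by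
      rw [inner_conj_symm, inner_weightMul_comm]
    exact Complex.conj_eq_iff_im.1 h1
  have e3 : inner ℂ (W + weightMul R P) K = (a : ℂ) * inner ℂ W P
      + (a : ℂ) * inner ℂ (weightMul R P) P
      + inner ℂ (W + weightMul R P) ((Complex.I * b) • W + F₁) := by
    rw [hK, add_assoc, inner_add_right, inner_smul_right, inner_add_left]; ring
  have n1 : ‖inner ℂ (weightMul R W) F₀‖ ≤ (1 + R) * ‖W‖ * ‖F₀‖ :=
    (norm_inner_le_norm _ _).trans (by gcongr; exact norm_weightMul_le hR.le W)
  have n2 : ‖(a : ℂ) * inner ℂ W P‖ ≤ |a| * (‖W‖ * ‖P‖) := by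
    rw [norm_mul, Complex.norm_real, Real.norm_eq_abs]
    gcongr
    exact norm_inner_le_norm _ _
  have n3 : ‖inner ℂ (W + weightMul R P) ((Complex.I * b) • W + F₁)‖
      ≤ (‖W‖ + (1 + R) * ‖P‖) * (|b| * ‖W‖ + ‖F₁‖) := by
    refine (norm_inner_le_norm _ _).trans ?_
    gcongr
    · exact (norm_add_le _ _).trans (by gcongr; exact norm_weightMul_le hR.le P)
    · refine (norm_add_le _ _).trans ?_
      rw [norm_smul, norm_mul, Complex.norm_I, one_mul, Complex.norm_real, Real.norm_eq_abs]
  rw [e3] at key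
  have n1' := (Complex.abs_im_le_norm _).trans n1
  have n2' := (Complex.abs_im_le_norm _).trans n2
  have n3' := (Complex.abs_im_le_norm _).trans n3
  have e4 : (-Complex.I * (inner ℂ (weightMul R W) F₀ + ((a : ℂ) * inner ℂ W P
      + (a : ℂ) * inner ℂ (weightMul R P) P
      + inner ℂ (W + weightMul R P) ((Complex.I * b) • W + F₁)))).re
      = (inner ℂ (weightMul R W) F₀).im + ((a : ℂ) * inner ℂ W P).im
        + (inner ℂ (W + weightMul R P) ((Complex.I * b) • W + F₁)).im := by
    have : ((a : ℂ) * inner ℂ (weightMul R P) P).im = 0 := by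
      rw [Complex.im_ofReal_mul, hreal, mul_zero]
    simp only [Complex.add_im, Complex.neg_re, Complex.mul_re, Complex.I_re, Complex.I_im, neg_mul,
      zero_mul, one_mul, zero_sub, neg_neg]
    rw [this]; ring
  rw [e4] at key
  have m1 := (le_abs_self _).trans n1'
  have m2 := (le_abs_self _).trans n2'
  have m3 := (le_abs_self _).trans n3'
  have hn := norm_nonneg W
  have hp := norm_nonneg P
  have hf := norm_nonneg F₁
  have hg := norm_nonneg F₀
  have ha := abs_nonneg a
  have hb := abs_nonneg b
  generalize ‖W‖ = n at *
  generalize ‖P‖ = p at *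
  generalize ‖F₁‖ = f at *
  generalize ‖F₀‖ = g at *
  generalize |a| = a' at *
  generalize |b| = b' at *
  -- Young's inequality for each product
  have y1 : a' * (n * p) ≤ a' ^ 2 * n ^ 2 + 1 / 4 * p ^ 2 := by
    nlinarith [sq_nonneg (a' * n - 1 / 2 * p)]
  have y2 : n * (b' * n + f) ≤ b' * n ^ 2 + n ^ 2 + f ^ 2 := by
    nlinarith [sq_nonneg (n - f), mul_nonneg hn hf]
  have y3 : (1 + R) * p * (b' * n) ≤ 1 / 8 * p ^ 2 + (1 + R) ^ 2 * b' ^ 2 * n ^ 2 * 2 := by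
    nlinarith [sq_nonneg (p - 4 * ((1 + R) * b' * n))]
  have y4 : (1 + R) * p * f ≤ 1 / 8 * p ^ 2 + (1 + R) ^ 2 * f ^ 2 * 2 := by
    nlinarith [sq_nonneg (p - 4 * ((1 + R) * f))]
  have z1 : 0 ≤ (1 + R) ^ 2 * b' ^ 2 * n ^ 2 := by positivity
  have z2 : 0 ≤ (1 + R) ^ 2 * b' ^ 2 * f ^ 2 := by positivity
  have z3 : 0 ≤ (1 + R) ^ 2 * n ^ 2 := by positivity
  have z4 : 0 ≤ (1 + R) ^ 2 * f ^ 2 := by positivity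
  have z5 : 0 ≤ a' ^ 2 * f ^ 2 := by positivity
  have z6 : 0 ≤ b' * f ^ 2 := by positivity
  have z7 : 0 ≤ (1 + R) * n ^ 2 := by positivity
  have z8 : 0 ≤ (1 + R) * f ^ 2 := by positivity
  have z9 : 0 ≤ (a' ^ 2 + 1 + b' + (1 + R) ^ 2 * (b' ^ 2 + 1) * 4) * (g * n) := by positivity
  linarith

/-! ### Steklov averages in time and the abstract energy inequality -/

/-- The forward Steklov average of `f` at `s` with step `h`. -/
noncomputable def steklov {E : Type*} [NormedAddCommGroup E] [NormedSpace ℝ E] (h : ℝ) (f : ℝ → E)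
    (s : ℝ) : E := h⁻¹ • ∫ r in s..(s + h), f r

section Steklov

variable {E : Type*} [NormedAddCommGroup E] [NormedSpace ℝ E]

theorem steklov_eq_sub {h : ℝ} {f : ℝ → E} (hf : Integrable f) (s : ℝ) :
    steklov h f s = h⁻¹ • ((∫ r in (0 : ℝ)..(s + h), f r) - ∫ r in (0 : ℝ)..s, f r) := by
  rw [steklov, intervalIntegral.integral_interval_sub_left] <;> exact hf.intervalIntegrable

theorem continuous_steklov {h : ℝ} {f : ℝ → E} (hf : Integrable f) : Continuous (steklov h f) := by
  have hc := intervalIntegral.continuous_primitive (fun _ _ => hf.intervalIntegrable) (0 : ℝ)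
  have : steklov h f
      = fun s => h⁻¹ • ((∫ r in (0 : ℝ)..(s + h), f r) - ∫ r in (0 : ℝ)..s, f r) :=
    funext fun s => steklov_eq_sub hf s
  rw [this]
  exact ((hc.comp (continuous_id.add continuous_const)).sub hc).const_smul _

theorem hasDerivAt_steklov [CompleteSpace E] {h : ℝ} {f : ℝ → E} (hf : Continuous f) (s : ℝ) :
    HasDerivAt (steklov h f) (h⁻¹ • (f (s + h) - f s)) s := by
  have hd : ∀ x, HasDerivAt (fun x => ∫ y in (0 : ℝ)..x, f y) (f x) x := fun x =>
    intervalIntegral.integral_hasDerivAt_right (hf.intervalIntegrable _ _)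
      hf.aestronglyMeasurable.stronglyMeasurableAtFilter hf.continuousAt
  have h1 : HasDerivAt (fun x => ∫ y in (0 : ℝ)..(x + h), f y) (f (s + h)) s :=
    (hd (s + h)).comp_add_const s h
  have : steklov h f = fun s => h⁻¹ • ((∫ r in (0 : ℝ)..(s + h), f r) - ∫ r in (0 : ℝ)..s, f r) := by
    funext s
    rw [steklov, intervalIntegral.integral_interval_sub_left] <;> exact hf.intervalIntegrable _ _
  rw [this]
  exact (h1.sub (hd s)).const_smul h⁻¹

theorem norm_steklov_le {h : ℝ} (hh : 0 < h) (f : ℝ → E) (s : ℝ) :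
    ‖steklov h f s‖ ≤ steklov h (fun r => ‖f r‖) s := by
  rw [steklov, steklov, norm_smul, smul_eq_mul, norm_inv, Real.norm_eq_abs, abs_of_pos hh]
  gcongr
  exact intervalIntegral.norm_integral_le_integral_norm (by linarith)

theorem steklov_mono {h : ℝ} (hh : 0 < h) {s : ℝ} {f g : ℝ → ℝ}
    (hf : IntervalIntegrable f volume s (s + h)) (hg : IntervalIntegrable g volume s (s + h))
    (hfg : ∀ r ∈ Icc s (s + h), f r ≤ g r) : steklov h f s ≤ steklov h g s := by
  rw [steklov, steklov, smul_eq_mul, smul_eq_mul]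
  gcongr
  exact intervalIntegral.integral_mono_on (by linarith) hf hg hfg

theorem steklov_add {h s : ℝ} {f g : ℝ → ℝ} (hf : IntervalIntegrable f volume s (s + h))
    (hg : IntervalIntegrable g volume s (s + h)) :
    steklov h (fun r => f r + g r) s = steklov h f s + steklov h g s := by
  rw [steklov, steklov, steklov, intervalIntegral.integral_add hf hg, smul_add]

theorem steklov_const [CompleteSpace E] {h : ℝ} (hh : 0 < h) (c : E) (s : ℝ) :
    steklov h (fun _ => c) s = c := by
  rw [steklov, intervalIntegral.integral_const, add_sub_cancel_left, smul_smul,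
    inv_mul_cancel₀ hh.ne', one_smul]

theorem steklov_mul_const {h s : ℝ} (f : ℝ → ℝ) (c : ℝ) :
    steklov h (fun r => f r * c) s = steklov h f s * c := by
  rw [steklov, steklov, intervalIntegral.integral_mul_const]; simp [mul_assoc]

/-- Jensen's inequality, from averaging the tangent line bound `y² ≥ 2 m y - m²` at the mean `m` of
the norms. -/
theorem sq_norm_steklov_le {h : ℝ} (hh : 0 < h) {f : ℝ → E}
    {s : ℝ} (hi : IntervalIntegrable (fun r => ‖f r‖) volume s (s + h))
    (hf2 : IntervalIntegrable (fun r => ‖f r‖ ^ 2) volume s (s + h)) :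
    ‖steklov h f s‖ ^ 2 ≤ steklov h (fun r => ‖f r‖ ^ 2) s := by
  set m := steklov h (fun r => ‖f r‖) s with hm
  have h0 : ‖steklov h f s‖ ≤ m := norm_steklov_le hh f s
  have h1 : steklov h (fun r => ‖f r‖ * (2 * m) + -m ^ 2) s ≤ steklov h (fun r => ‖f r‖ ^ 2) s :=
    steklov_mono hh ((hi.mul_const _).add (by simp)) hf2
      (fun r _ => by nlinarith [sq_nonneg (‖f r‖ - m)])
  rw [steklov_add (hi.mul_const _) (by simp), steklov_mul_const, steklov_const hh, ← hm] at h1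
  nlinarith [norm_nonneg (steklov h f s)]

/-- With `Γ` the primitive of `g`, the left side is the mean of `Γ` over `[t, t + h]` minus its mean
over `[0, h]`; `Γ` is nondecreasing and nonnegative for positive times. -/
theorem integral_steklov_le {h : ℝ} (hh : 0 < h) (t : ℝ) {g : ℝ → ℝ} (hg : Integrable g)
    (hg0 : ∀ r, 0 ≤ g r) : ∫ s in (0 : ℝ)..t, steklov h g s ≤ ∫ r in (0 : ℝ)..(t + h), g r := by
  set Γ : ℝ → ℝ := fun x => ∫ r in (0 : ℝ)..x, g r with hΓ
  have hc : Continuous Γ :=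
    intervalIntegral.continuous_primitive (fun _ _ => hg.intervalIntegrable) (0 : ℝ)
  have hmono : ∀ x y, x ≤ y → Γ x ≤ Γ y := fun x y hxy => by
    have : Γ y - Γ x = ∫ r in x..y, g r :=
      intervalIntegral.integral_interval_sub_left hg.intervalIntegrable hg.intervalIntegrable
    have h2 : 0 ≤ ∫ r in x..y, g r := intervalIntegral.integral_nonneg hxy fun r _ => hg0 r
    linarith
  have e1 : ∫ s in (0 : ℝ)..t, steklov h g s
      = h⁻¹ * ((∫ s in t..(t + h), Γ s) - ∫ s in (0 : ℝ)..h, Γ s) := by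
    have : ∀ s, steklov h g s = h⁻¹ * (Γ (s + h) - Γ s) := fun s => steklov_eq_sub hg s
    simp only [this]
    have hi : ∀ x y, IntervalIntegrable Γ volume x y := fun x y => hc.intervalIntegrable x y
    rw [intervalIntegral.integral_const_mul, intervalIntegral.integral_sub
      ((by fun_prop : Continuous fun s => Γ (s + h)).intervalIntegrable _ _) (hi _ _)]
    have e2 : ∫ x in (0 : ℝ)..t, Γ (x + h) = ∫ x in h..(t + h), Γ x := by
      rw [intervalIntegral.integral_comp_add_right, zero_add]
    rw [e2, ← intervalIntegral.integral_add_adjacent_intervals (hi h t) (hi t (t + h)),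
      ← intervalIntegral.integral_add_adjacent_intervals (hi 0 h) (hi h t)]
    ring
  have e3 : ∫ s in t..(t + h), Γ s ≤ h * Γ (t + h) := by
    have := intervalIntegral.integral_mono_on (f := Γ) (g := fun _ => Γ (t + h)) (a := t)
      (b := t + h) (μ := volume)
      (by linarith) (hc.intervalIntegrable _ _) (by simp) (fun x hx => hmono x _ hx.2)
    simpa using this
  have e4 : 0 ≤ ∫ s in (0 : ℝ)..h, Γ s :=
    intervalIntegral.integral_nonneg hh.le fun s hs =>
      intervalIntegral.integral_nonneg hs.1 fun r _ => hg0 r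
  rw [e1]
  calc h⁻¹ * ((∫ s in t..(t + h), Γ s) - ∫ s in (0 : ℝ)..h, Γ s)
      ≤ h⁻¹ * (h * Γ (t + h)) := by gcongr; linarith
    _ = Γ (t + h) := by field_simp

/-- The Lebesgue differentiation theorem, restricted to positive increments. -/
theorem ae_tendsto_steklov [CompleteSpace E] {f : ℝ → E} (hf : Integrable f) :
    ∀ᵐ s, Tendsto (fun h => steklov h f s) (𝓝[>] 0) (𝓝 (f s)) := by
  filter_upwards [_root_.LocallyIntegrable.ae_hasDerivAt_integral hf.locallyIntegrable] with s hs
  have h1 := (hasDerivAt_iff_tendsto_slope_zero.1 (hs 0))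
  have h2 := h1.mono_left (nhdsWithin_mono (0 : ℝ) (fun x hx => ne_of_gt hx : Ioi (0 : ℝ) ⊆ {0}ᶜ))
  refine h2.congr fun h => ?_
  rw [steklov_eq_sub hf]

/-- Fatou's lemma along `h = 1 / (n + 1)`: almost everywhere convergence of the averages suffices
for the dissipated term, and their strong `L₂` convergence in time is not needed. -/
theorem integral_sq_norm_le_of_steklov [CompleteSpace E] {f : ℝ → E} (hf : Integrable f)
    (hf2 : Integrable fun r => ‖f r‖ ^ 2) {t β : ℝ} (ht : 0 ≤ t) {B : ℝ → ℝ}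
    (hB : Tendsto B (𝓝[>] 0) (𝓝 β))
    (hle : ∀ᶠ h in 𝓝[>] (0 : ℝ), ∫ s in (0 : ℝ)..t, ‖steklov h f s‖ ^ 2 ≤ B h) :
    ∫ s in (0 : ℝ)..t, ‖f s‖ ^ 2 ≤ β := by
  have hseq : Tendsto (fun n : ℕ => (1 : ℝ) / ((n : ℝ) + 1)) atTop (𝓝[>] 0) :=
    tendsto_nhdsWithin_iff.2 ⟨tendsto_one_div_add_atTop_nhds_zero_nat,
      Eventually.of_forall fun n => by simp only [mem_Ioi]; positivity⟩
  set η : ℕ → ℝ := fun n => 1 / ((n : ℝ) + 1) with hη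
  have hint : ∀ g : ℝ → ℝ, Integrable g (volume.restrict (Ioc 0 t)) → (∀ s, 0 ≤ g s) →
      ENNReal.ofReal (∫ s in (0 : ℝ)..t, g s)
        = ∫⁻ s in Ioc 0 t, ENNReal.ofReal (g s) := fun g hg hg0 => by
    rw [intervalIntegral.integral_of_le ht, ofReal_integral_eq_lintegral_ofReal hg
      (ae_of_all _ hg0)]
  have hβ : 0 ≤ β := by
    refine ge_of_tendsto hB (hle.mono fun h hh => le_trans ?_ hh)
    exact intervalIntegral.integral_nonneg ht fun s _ => by positivity
  have hst : ∀ n, Continuous fun s => ‖steklov (η n) f s‖ ^ 2 := fun n =>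
    (continuous_steklov hf).norm.pow 2
  have hfatou : ENNReal.ofReal (∫ s in (0 : ℝ)..t, ‖f s‖ ^ 2) ≤ ENNReal.ofReal β := by
    rw [hint _ hf2.restrict fun s => by positivity]
    calc ∫⁻ s in Ioc 0 t, ENNReal.ofReal (‖f s‖ ^ 2)
        = ∫⁻ s in Ioc 0 t, liminf (fun n => ENNReal.ofReal (‖steklov (η n) f s‖ ^ 2)) atTop := by
          refine lintegral_congr_ae (ae_restrict_of_ae ?_)
          filter_upwards [ae_tendsto_steklov hf] with s hs
          refine (Tendsto.liminf_eq ?_).symm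
          exact (ENNReal.continuous_ofReal.tendsto _).comp (((hs.comp hseq).norm).pow 2)
      _ ≤ liminf (fun n => ∫⁻ s in Ioc 0 t, ENNReal.ofReal (‖steklov (η n) f s‖ ^ 2)) atTop :=
          lintegral_liminf_le fun n => (hst n).measurable.ennreal_ofReal
      _ ≤ liminf (fun n => ENNReal.ofReal (B (η n))) atTop := by
          refine liminf_le_liminf ?_
          filter_upwards [hseq.eventually hle] with n hn
          rw [← hint _ ((intervalIntegrable_iff_integrableOn_Ioc_of_le ht).1
            ((hst n).intervalIntegrable _ _)) fun s => by positivity]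
          exact ENNReal.ofReal_le_ofReal hn
      _ = ENNReal.ofReal β :=
          Tendsto.liminf_eq ((ENNReal.continuous_ofReal.tendsto _).comp (hB.comp hseq))
  exact (ENNReal.ofReal_le_ofReal_iff hβ).1 hfatou

end Steklov

theorem norm_steklov_sub_le {E : Type*} [NormedAddCommGroup E] [NormedSpace ℝ E] [CompleteSpace E]
    {h s : ℝ} (hh : 0 < h) {w : ℝ → E} (hw : Continuous w) {c : E} {σ : ℝ}
    (hσ : ∀ r ∈ Icc s (s + h), ‖w r - c‖ ≤ σ) : ‖steklov h w s - c‖ ≤ σ := by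
  have e : steklov h w s - c = steklov h (fun r => w r - c) s := by
    conv_lhs => rw [← steklov_const hh c s]
    rw [steklov, steklov, steklov, ← smul_sub, intervalIntegral.integral_sub
      (hw.intervalIntegrable _ _) (by simp)]
  rw [e]
  refine (norm_steklov_le hh _ _).trans ?_
  refine (steklov_mono hh (g := fun _ => σ)
    ((hw.sub continuous_const).norm.intervalIntegrable _ _) (by simp) hσ).trans
    (steklov_const hh σ s).le

theorem tendsto_steklov {E : Type*} [NormedAddCommGroup E] [NormedSpace ℝ E] [CompleteSpace E]
    {w : ℝ → E} (hw : Continuous w) (s : ℝ) :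
    Tendsto (fun h => steklov h w s) (𝓝[>] 0) (𝓝 (w s)) := by
  rw [Metric.tendsto_nhds]
  intro ε hε
  obtain ⟨δ, hδ, H⟩ := Metric.continuous_iff.1 hw s (ε / 2) (by positivity)
  filter_upwards [Ioo_mem_nhdsGT hδ] with h hh
  rw [dist_eq_norm]
  refine (norm_steklov_sub_le hh.1 hw (σ := ε / 2) fun r hr => ?_).trans_lt (by linarith)
  rw [← dist_eq_norm]
  refine (H r ?_).le
  rw [Real.dist_eq, abs_of_nonneg (by linarith [hr.1])]
  linarith [hr.2, hh.2]

/-- Energy inequality for a curve in a Hilbert space whose Steklov averages satisfy a dissipation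
inequality. -/
theorem energy_inequality {H : Type*} [NormedAddCommGroup H] [InnerProductSpace ℂ H]
    [CompleteSpace H] {L : H →L[ℂ] H} (hL : ∀ f g, inner ℂ (L f) g = inner ℂ f (L g))
    {w p F₁ F₀ : ℝ → H} (hw : Continuous w) (hw0 : w 0 = 0)
    (hp : Integrable p) (hp2 : Integrable fun r => ‖p r‖ ^ 2)
    (hF₁ : Integrable F₁) (hF₁2 : Integrable fun r => ‖F₁ r‖ ^ 2) (hF₀ : Integrable F₀)
    {C T : ℝ} (hC : 0 ≤ C)
    (hdiss : ∀ s h, 0 ≤ s → 0 < h → s + h ≤ T →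
      (inner ℂ (L (steklov h w s)) (h⁻¹ • (w (s + h) - w s))).re
        ≤ -(1 / 2 * ‖steklov h p s‖ ^ 2) + C * (‖steklov h w s‖ ^ 2 + ‖steklov h F₁ s‖ ^ 2
          + ‖steklov h F₀ s‖ * ‖steklov h w s‖))
    {t : ℝ} (ht : t ∈ Ico 0 T) :
    (inner ℂ (L (w t)) (w t)).re + ∫ s in (0 : ℝ)..t, ‖p s‖ ^ 2
      ≤ 2 * C * ∫ s in (0 : ℝ)..t, (‖w s‖ ^ 2 + ‖F₁ s‖ ^ 2 + ‖F₀ s‖ * ‖w s‖) := by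
  obtain ⟨M, hM⟩ := (isCompact_Icc (a := (0 : ℝ)) (b := T)).exists_bound_of_continuousOn
    hw.continuousOn
  -- all integrands are cut off outside the time interval
  set J : Set ℝ := Icc 0 T with hJ
  have hwi : Integrable (J.indicator fun r => ‖w r‖ ^ 2) :=
    (integrable_indicator_iff measurableSet_Icc).2
      ((hw.norm.pow 2).continuousOn.integrableOn_compact isCompact_Icc)
  have hF₀w : Integrable (J.indicator fun r => ‖F₀ r‖ * ‖w r‖) := by
    rw [integrable_indicator_iff measurableSet_Icc]
    refine (hF₀.norm.integrableOn (s := J)).mul_bdd (c := M) hw.norm.aestronglyMeasurable ?_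
    filter_upwards [ae_restrict_mem measurableSet_Icc] with r hr
    simpa using hM r hr
  have htT : t < T := ht.2
  set g₀ : ℝ → ℝ := fun r => (J.indicator (fun r => ‖w r‖ ^ 2) r) + ‖F₁ r‖ ^ 2
    + (J.indicator (fun r => ‖F₀ r‖ * ‖w r‖) r) with hg₀
  have hg₀i : Integrable g₀ := (hwi.add hF₁2).add hF₀w
  have hg₀n : ∀ r, 0 ≤ g₀ r := fun r => by
    have h1 : 0 ≤ J.indicator (fun r => ‖w r‖ ^ 2) r := indicator_nonneg (fun _ _ => by positivity) r
    have h2 : 0 ≤ J.indicator (fun r => ‖F₀ r‖ * ‖w r‖) r :=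
      indicator_nonneg (fun _ _ => by positivity) r
    simp only [hg₀]; positivity
  have hg₀J : ∀ r ∈ J, g₀ r = ‖w r‖ ^ 2 + ‖F₁ r‖ ^ 2 + ‖F₀ r‖ * ‖w r‖ := fun r hr => by
    simp only [hg₀, indicator_of_mem hr]
  have hFn : Integrable fun r => ‖F₀ r‖ := hF₀.norm
  -- the inequality up to a small error
  have main : ∀ σ : ℝ, 0 < σ → (∫ s in (0 : ℝ)..t, ‖p s‖ ^ 2)
      ≤ 2 * (C * (∫ s in (0 : ℝ)..t, (g₀ s + ‖F₀ s‖ * σ)) - 1 / 2 * (inner ℂ (L (w t)) (w t)).re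
        + 1 / 2 * (inner ℂ (L (w 0)) (w 0)).re) := by
    intro σ hσ
    set g : ℝ → ℝ := fun r => g₀ r + ‖F₀ r‖ * σ with hg
    have hgi : Integrable g := hg₀i.add (hFn.mul_const σ)
    have hgn : ∀ r, 0 ≤ g r := fun r =>
      add_nonneg (hg₀n r) (mul_nonneg (norm_nonneg _) hσ.le)
    have hgc : Continuous fun x => ∫ r in (0 : ℝ)..x, g r :=
      intervalIntegral.continuous_primitive (fun _ _ => hgi.intervalIntegrable) (0 : ℝ)
    have hQ : Continuous fun f : H => (inner ℂ (L f) f).re :=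
      Complex.continuous_re.comp (L.continuous.inner continuous_id)
    refine integral_sq_norm_le_of_steklov hp hp2 ht.1 (B := fun h =>
      2 * (C * (∫ s in (0 : ℝ)..(t + h), g s)
        - 1 / 2 * (inner ℂ (L (steklov h w t)) (steklov h w t)).re
        + 1 / 2 * (inner ℂ (L (steklov h w 0)) (steklov h w 0)).re)) ?_ ?_
    · have h1 : Tendsto (fun h : ℝ => ∫ s in (0 : ℝ)..(t + h), g s) (𝓝[>] 0)
          (𝓝 (∫ s in (0 : ℝ)..t, g s)) := by
        have : Tendsto (fun h : ℝ => ∫ s in (0 : ℝ)..(t + h), g s) (𝓝 0)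
            (𝓝 (∫ s in (0 : ℝ)..(t + 0), g s)) :=
          (hgc.comp (continuous_const.add continuous_id)).tendsto 0
        rw [add_zero] at this
        exact this.mono_left nhdsWithin_le_nhds
      have h2 := (hQ.tendsto _).comp (tendsto_steklov hw t)
      have h3 := (hQ.tendsto _).comp (tendsto_steklov hw 0)
      exact (((h1.const_mul C).sub (h2.const_mul (1 / 2))).add (h3.const_mul (1 / 2))).const_mul 2
    -- The step `h` is kept below both the modulus of uniform continuity of `w` for `σ` and the
    -- distance from `t` to `T`, so that every forward average stays in `[0, T]`.
    · obtain ⟨δ, hδ, huc⟩ := Metric.uniformContinuousOn_iff.1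
        (isCompact_Icc.uniformContinuousOn_of_continuous (s := Icc (0 : ℝ) T) hw.continuousOn) σ hσ
      filter_upwards [Ioo_mem_nhdsGT (lt_min hδ (sub_pos.2 htT))] with h hh
      have hh0 : 0 < h := hh.1
      have hhδ : h < δ := hh.2.trans_le (min_le_left _ _)
      have hhT : t + h < T := by linarith [hh.2.trans_le (min_le_right _ _)]
      -- The averaged curve is differentiable with derivative the difference quotient, so by
      -- symmetry of `L` the integrand is the derivative of half the quadratic form.
      have hFTC : ∫ s in (0 : ℝ)..t,
            (inner ℂ (L (steklov h w s)) (h⁻¹ • (w (s + h) - w s))).re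
          = 1 / 2 * (inner ℂ (L (steklov h w t)) (steklov h w t)).re
            - 1 / 2 * (inner ℂ (L (steklov h w 0)) (steklov h w 0)).re := by
        have hcont : Continuous (steklov h w) :=
          continuous_iff_continuousAt.2 fun s => (hasDerivAt_steklov hw s).continuousAt
        have hd : Continuous fun s => h⁻¹ • (w (s + h) - w s) := by fun_prop
        refine intervalIntegral.integral_eq_sub_of_hasDerivAt
          (f := fun s => 1 / 2 * (inner ℂ (L (steklov h w s)) (steklov h w s)).re) (fun s _ => ?_) ?_
        · have h1 := hasDerivAt_steklov (h := h) hw s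
          have h2 : HasDerivAt (fun s => L (steklov h w s)) (L (h⁻¹ • (w (s + h) - w s))) s :=
            (L.restrictScalars ℝ).hasFDerivAt.comp_hasDerivAt s h1
          have h3 := (h2.inner ℂ h1)
          have h4 : HasDerivAt (fun s => (inner ℂ (L (steklov h w s)) (steklov h w s)).re) _ s :=
            Complex.reCLM.hasFDerivAt.comp_hasDerivAt s h3
          have h5 := h4.const_mul (1 / 2)
          refine h5.congr_deriv ?_
          have e : (inner ℂ (L (h⁻¹ • (w (s + h) - w s))) (steklov h w s)).re
              = (inner ℂ (L (steklov h w s)) (h⁻¹ • (w (s + h) - w s))).re := by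
            rw [hL, ← inner_conj_symm, Complex.conj_re]
          rw [Complex.reCLM_apply, Complex.add_re, e]
          ring
        · exact (Complex.continuous_re.comp ((L.continuous.comp hcont).inner hd)).intervalIntegrable
            _ _
      have hstp : Continuous fun s => ‖steklov h p s‖ ^ 2 := (continuous_steklov hp).norm.pow 2
      have hstg : Continuous (steklov h g) := continuous_steklov hgi
      have hpt : ∀ s ∈ Icc 0 t, (inner ℂ (L (steklov h w s)) (h⁻¹ • (w (s + h) - w s))).re
          ≤ -(1 / 2 * ‖steklov h p s‖ ^ 2) + C * steklov h g s := by
        intro s hs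
        have hsT : s + h ≤ T := by linarith [hs.2]
        refine (hdiss s h hs.1 hh0 hsT).trans ?_
        gcongr
        have hsub : ∀ r ∈ Icc s (s + h), r ∈ J := fun r hr =>
          ⟨hs.1.trans hr.1, hr.2.trans hsT⟩
        have hi1 : IntervalIntegrable (fun r => ‖w r‖ ^ 2) volume s (s + h) :=
          (hw.norm.pow 2).intervalIntegrable _ _
        have hi2 : IntervalIntegrable (fun r => ‖F₁ r‖ ^ 2) volume s (s + h) :=
          hF₁2.intervalIntegrable
        have hi3 : IntervalIntegrable (fun r => ‖F₀ r‖) volume s (s + h) :=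
          hFn.intervalIntegrable
        have hi4 : IntervalIntegrable (fun r => ‖F₀ r‖ * ‖w r‖) volume s (s + h) :=
          hi3.mul_continuousOn hw.norm.continuousOn
        have hi5 : IntervalIntegrable (fun r => ‖F₀ r‖ * σ) volume s (s + h) := hi3.mul_const σ
        have k1 := sq_norm_steklov_le hh0 (f := w) (hw.norm.intervalIntegrable _ _) hi1
        have k2 := sq_norm_steklov_le hh0 hF₁.norm.intervalIntegrable hi2
        -- Since `F₀` is only integrable in time, Jensen's inequality for squares is unavailable.
        -- Instead `‖steklov h w s‖` is replaced under the average by `‖w r‖ + σ`, using uniform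
        -- continuity of `w`.
        have k3 : ‖steklov h F₀ s‖ * ‖steklov h w s‖
            ≤ steklov h (fun r => ‖F₀ r‖ * ‖w r‖) s + steklov h (fun r => ‖F₀ r‖ * σ) s := by
          calc ‖steklov h F₀ s‖ * ‖steklov h w s‖
              ≤ steklov h (fun r => ‖F₀ r‖) s * ‖steklov h w s‖ := by
                gcongr; exact norm_steklov_le hh0 F₀ s
            _ = steklov h (fun r => ‖F₀ r‖ * ‖steklov h w s‖) s := (steklov_mul_const _ _).symm
            _ ≤ steklov h (fun r => ‖F₀ r‖ * ‖w r‖ + ‖F₀ r‖ * σ) s := by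
                refine steklov_mono hh0 (hi3.mul_const _) (hi4.add hi5) fun r hr => ?_
                rw [← mul_add]
                gcongr
                have : ‖steklov h w s - w r‖ ≤ σ := by
                  refine norm_steklov_sub_le hh0 hw fun r' hr' => ?_
                  rw [← dist_eq_norm]
                  refine (huc r' (hsub r' hr') r (hsub r hr) ?_).le
                  rw [Real.dist_eq]
                  exact (abs_sub_le_iff.2 ⟨by linarith [hr'.2, hr.1], by linarith [hr.2, hr'.1]⟩
                    : |r' - r| ≤ h).trans_lt hhδ
                linarith [norm_le_norm_add_norm_sub' (steklov h w s) (w r)]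
            _ = _ := steklov_add hi4 hi5
        calc ‖steklov h w s‖ ^ 2 + ‖steklov h F₁ s‖ ^ 2 + ‖steklov h F₀ s‖ * ‖steklov h w s‖
            ≤ steklov h (fun r => ‖w r‖ ^ 2) s + steklov h (fun r => ‖F₁ r‖ ^ 2) s
              + (steklov h (fun r => ‖F₀ r‖ * ‖w r‖) s + steklov h (fun r => ‖F₀ r‖ * σ) s) := by
              gcongr
          _ = steklov h (fun r => (‖w r‖ ^ 2 + ‖F₁ r‖ ^ 2) + (‖F₀ r‖ * ‖w r‖ + ‖F₀ r‖ * σ)) s := by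
              rw [steklov_add (hi1.add hi2) (hi4.add hi5), steklov_add hi1 hi2,
                steklov_add hi4 hi5]
          _ ≤ steklov h g s := by
              refine steklov_mono hh0 ((hi1.add hi2).add (hi4.add hi5)) hgi.intervalIntegrable
                fun r hr => ?_
              simp only [hg, hg₀J r (hsub r hr)]
              linarith
      have hc1 : Continuous fun s => -(1 / 2 * ‖steklov h p s‖ ^ 2) := (hstp.const_mul (1 / 2)).neg
      have hc2 : Continuous fun s => C * steklov h g s := hstg.const_mul C
      have hc3 : Continuous fun s => -(1 / 2 * ‖steklov h p s‖ ^ 2) + C * steklov h g s :=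
        hc1.add hc2
      have hmono := intervalIntegral.integral_mono_on (μ := volume) ht.1
        (by
          have hcont : Continuous (steklov h w) :=
            continuous_iff_continuousAt.2 fun s => (hasDerivAt_steklov hw s).continuousAt
          have hd : Continuous fun s => h⁻¹ • (w (s + h) - w s) := by fun_prop
          exact (Complex.continuous_re.comp
            ((L.continuous.comp hcont).inner hd)).intervalIntegrable _ _)
        (hc3.intervalIntegrable _ _) hpt
      rw [hFTC, intervalIntegral.integral_add (hc1.intervalIntegrable _ _)
        (hc2.intervalIntegrable _ _), intervalIntegral.integral_neg,
        intervalIntegral.integral_const_mul, intervalIntegral.integral_const_mul] at hmono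
      have hle := mul_le_mul_of_nonneg_left (integral_steklov_le hh0 t hgi hgn) hC
      linarith
  have e0 : ∫ s in (0 : ℝ)..t, g₀ s
      = ∫ s in (0 : ℝ)..t, (‖w s‖ ^ 2 + ‖F₁ s‖ ^ 2 + ‖F₀ s‖ * ‖w s‖) := by
    refine intervalIntegral.integral_congr fun s hs => hg₀J s ?_
    rw [uIcc_of_le ht.1] at hs
    exact ⟨hs.1, hs.2.trans htT.le⟩
  rw [← e0]
  refine le_of_forall_pos_le_add fun ε hε => ?_
  set Z := ∫ s in (0 : ℝ)..t, ‖F₀ s‖ with hZ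
  have hZ0 : 0 ≤ Z := intervalIntegral.integral_nonneg ht.1 fun s _ => norm_nonneg _
  -- This `σ` makes the error `2 C Z σ` at most `ε`; the added `1` avoids division by zero.
  have hσ : 0 < ε / (2 * C * Z + 1) := by positivity
  have h1 := main _ hσ
  rw [intervalIntegral.integral_add hg₀i.intervalIntegrable (hFn.mul_const _).intervalIntegrable,
    intervalIntegral.integral_mul_const, ← hZ, hw0] at h1
  simp only [map_zero, inner_zero_left, Complex.zero_re, mul_zero, add_zero] at h1
  have h2 : 2 * C * (Z * (ε / (2 * C * Z + 1))) ≤ ε := by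
    have : 2 * C * (Z * (ε / (2 * C * Z + 1))) = ε * (2 * C * Z / (2 * C * Z + 1)) := by ring
    rw [this]
    refine mul_le_of_le_one_right hε.le ?_
    rw [div_le_one (by positivity)]
    linarith
  linarith

/-! ### From functions of two variables to curves in `L₂(0, R)` -/

instance secondCountableTopology_Lp_two (R : ℝ) : SecondCountableTopology (Lp ℂ 2 (muI R)) :=
  haveI : Fact ((2 : ENNReal) ≠ ⊤) := ⟨by norm_num⟩
  Lp.SecondCountableTopology

theorem muQ_eq_prod (T R : ℝ) : muQ T R = (muI T).prod (muI R) := by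
  rw [muQ, muI, muI, Measure.prod_restrict]; rfl

open Classical in
/-- The curve in `L₂(0, R)` given by the slices `g t`; it takes the value `0` where the slice is
not square integrable. -/
noncomputable def sliceCurve (R : ℝ) (g : ℝ → ℝ → ℂ) (t : ℝ) : Lp ℂ 2 (muI R) :=
  if h : MemLp (g t) 2 (muI R) then h.toLp (g t) else 0

theorem sliceCurve_eq {R : ℝ} {g : ℝ → ℝ → ℂ} {t : ℝ} (h : MemLp (g t) 2 (muI R)) :
    sliceCurve R g t = h.toLp (g t) := by
  rw [sliceCurve, dif_pos h]

theorem sliceCurve_ae {R : ℝ} {g : ℝ → ℝ → ℂ} {t : ℝ} (h : MemLp (g t) 2 (muI R)) :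
    sliceCurve R g t =ᵐ[muI R] g t := by
  rw [sliceCurve_eq h]; exact h.coeFn_toLp

theorem sliceCurve_congr {R : ℝ} {g g' : ℝ → ℝ → ℂ} {t : ℝ} (h : g t =ᵐ[muI R] g' t) :
    sliceCurve R g t = sliceCurve R g' t := by
  by_cases hg : MemLp (g t) 2 (muI R)
  · rw [sliceCurve_eq hg, sliceCurve_eq ((memLp_congr_ae h).1 hg)]
    exact MemLp.toLp_congr _ _ h
  · rw [sliceCurve, sliceCurve, dif_neg hg, dif_neg fun h' => hg ((memLp_congr_ae h).2 h')]

/-- By second countability every open set is a countable union of balls, and preimages of balls are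
sublevel sets of the distances. -/
theorem measurable_of_measurable_edist {α E : Type*} [MeasurableSpace α] [PseudoEMetricSpace E]
    [SecondCountableTopology E] [MeasurableSpace E] [BorelSpace E] {F : α → E}
    (h : ∀ c, Measurable fun t => edist (F t) c) : Measurable F := by
  refine measurable_of_isOpen fun s hs => ?_
  choose! ε hε hεs using fun x (hx : x ∈ s) => EMetric.isOpen_iff.1 hs x hx
  obtain ⟨S, hS, hSU⟩ := TopologicalSpace.isOpen_iUnion_countable
    (fun x : s => Metric.eball (x : E) (ε x)) (fun x => Metric.isOpen_eball)
  have hsU : s = ⋃ x ∈ S, Metric.eball (x : E) (ε x) := by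
    rw [hSU]
    refine Subset.antisymm (fun x hx => mem_iUnion.2 ⟨⟨x, hx⟩, Metric.mem_eball_self (hε x hx)⟩)
      (iUnion_subset fun x => hεs x x.2)
  rw [hsU, preimage_iUnion₂]
  exact MeasurableSet.biUnion hS fun x _ => h x measurableSet_Iio

/-- The distance from a slice to a fixed element of `L₂` is a parametric integral, measurable in `t`
by Tonelli. The set of times with a square integrable slice is itself measurable, so the default
value `0` elsewhere does no harm. -/
theorem measurable_sliceCurve {R : ℝ} {g : ℝ → ℝ → ℂ}
    (hg : StronglyMeasurable fun p : ℝ × ℝ => g p.1 p.2) :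
    Measurable[_, borel _] (sliceCurve R g) := by
  borelize ↥(Lp ℂ 2 (muI R))
  have hslice : ∀ t, AEStronglyMeasurable (g t) (muI R) := fun t =>
    (hg.comp_measurable (measurable_const.prodMk measurable_id)).aestronglyMeasurable
  have hnorm : ∀ f : ℝ → ℂ, Measurable f →
      Measurable fun t => eLpNorm (fun x => g t x - f x) 2 (muI R) := fun f hf => by
    simp only [eLpNorm_eq_lintegral_rpow_enorm_toReal (by norm_num : (2 : ENNReal) ≠ 0)
      (by norm_num : (2 : ENNReal) ≠ ⊤)]
    refine Measurable.pow_const (Measurable.lintegral_prod_right' (f := fun p : ℝ × ℝ =>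
      ‖g p.1 p.2 - f p.2‖ₑ ^ (2 : ENNReal).toReal) ?_) _
    exact ((hg.measurable.sub (hf.comp measurable_snd)).enorm).pow_const _
  have hfin : MeasurableSet {t | MemLp (g t) 2 (muI R)} := by
    have : {t | MemLp (g t) 2 (muI R)}
        = (fun t => eLpNorm (fun x => g t x - (0 : ℝ → ℂ) x) 2 (muI R)) ⁻¹' Iio ⊤ := by
      ext t
      simp only [mem_ofPred_eq, mem_preimage, mem_Iio, Pi.zero_apply, sub_zero]
      exact ⟨fun h => h.2, fun h => ⟨hslice t, h⟩⟩
    rw [this]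
    exact hnorm 0 measurable_const measurableSet_Iio
  refine measurable_of_measurable_edist fun c => ?_
  obtain ⟨f, hf, hcf⟩ := (Lp.aestronglyMeasurable c)
  classical
  have hm : Measurable fun t => if MemLp (g t) 2 (muI R) then
      eLpNorm (fun x => g t x - f x) 2 (muI R) else edist 0 c :=
    Measurable.ite hfin (hnorm f hf.measurable) measurable_const
  convert hm using 2 with t
  by_cases h : MemLp (g t) 2 (muI R)
  · rw [if_pos h, sliceCurve_eq h, Lp.edist_def]
    refine eLpNorm_congr_ae ?_
    filter_upwards [h.coeFn_toLp, hcf] with x h1 h2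
    rw [Pi.sub_apply, h1, h2]
  · rw [if_neg h, sliceCurve, dif_neg h]

theorem aestronglyMeasurable_sliceCurve {T R : ℝ} {g : ℝ → ℝ → ℂ}
    (hg : AEStronglyMeasurable (fun p : ℝ × ℝ => g p.1 p.2) (muQ T R)) :
    AEStronglyMeasurable (sliceCurve R g) (muI T) := by
  borelize ↥(Lp ℂ 2 (muI R))
  obtain ⟨g', hg', hgg'⟩ := hg
  rw [muQ_eq_prod] at hgg'
  have h1 : Measurable (sliceCurve R fun t x => g' (t, x)) := measurable_sliceCurve hg'
  refine ⟨_, h1.stronglyMeasurable, ?_⟩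
  filter_upwards [Measure.ae_ae_of_ae_prod hgg'] with t ht
  exact sliceCurve_congr ht

/-- Square integrable functions on the rectangle have square integrable slices. -/
theorem MemLp.ae_memLp_slice {T R : ℝ} {g : ℝ → ℝ → ℂ}
    (hg : MemLp (fun p : ℝ × ℝ => g p.1 p.2) 2 (muQ T R)) :
    ∀ᵐ t ∂(muI T), MemLp (g t) 2 (muI R) := by
  have h2 : Integrable (fun p : ℝ × ℝ => ‖g p.1 p.2‖ ^ 2) ((muI T).prod (muI R)) := by
    rw [← muQ_eq_prod]; exact hg.integrable_norm_pow (by norm_num)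
  have hm := hg.1
  rw [muQ_eq_prod] at hm
  filter_upwards [h2.prod_right_ae, hm.prodMk_left] with t h1 h3
  exact (memLp_two_iff_integrable_sq_norm h3).2 h1

theorem integrable_sq_norm_sliceCurve {T R : ℝ} {g : ℝ → ℝ → ℂ}
    (hg : MemLp (fun p : ℝ × ℝ => g p.1 p.2) 2 (muQ T R)) :
    Integrable (fun t => ‖sliceCurve R g t‖ ^ 2) (muI T) := by
  have h2 : Integrable (fun p : ℝ × ℝ => ‖g p.1 p.2‖ ^ 2) ((muI T).prod (muI R)) := by
    rw [← muQ_eq_prod]; exact hg.integrable_norm_pow (by norm_num)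
  refine h2.integral_prod_left.congr ?_
  filter_upwards [MemLp.ae_memLp_slice hg] with t ht
  rw [norm_sq_eq_integral]
  refine integral_congr_ae ?_
  filter_upwards [sliceCurve_ae ht] with x hx
  rw [hx]

/-! ### Separated test functions and the weak ordinary differential equation -/

theorem integrable_mul_continuous_muQ {T R : ℝ} {g φ : ℝ × ℝ → ℂ} (hg : Integrable g (muQ T R))
    (hφ : Continuous φ) : Integrable (fun p => g p * φ p) (muQ T R) := by
  obtain ⟨C, hC⟩ := (isCompact_Icc (a := (0 : ℝ)) (b := T)).prod (isCompact_Icc (a := (0 : ℝ))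
    (b := R)) |>.exists_bound_of_continuousOn hφ.continuousOn
  refine hg.mul_bdd (c := C) hφ.aestronglyMeasurable ?_
  rw [muQ]
  filter_upwards [ae_restrict_mem (measurableSet_Ioo.prod measurableSet_Ioo)] with p hp
  exact hC p ⟨Ioo_subset_Icc_self hp.1, Ioo_subset_Icc_self hp.2⟩

theorem tendsto_eLpNorm_mul_zero {R : ℝ} {ψ : ℝ → ℂ} (hψ : Continuous ψ) {l : Filter ℝ}
    {c : ℝ → ℂ} (hc : Tendsto c l (𝓝 0)) :
    Tendsto (fun t => eLpNorm (fun x => c t * ψ x) 2 (muI R)) l (𝓝 0) := by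
  have e : ∀ t, eLpNorm (fun x => c t * ψ x) 2 (muI R) = ‖c t‖ₑ * eLpNorm ψ 2 (muI R) := fun t =>
    eLpNorm_const_smul (c t) ψ 2 (muI R)
  simp only [e]
  have h1 : Tendsto (fun t => ‖c t‖ₑ) l (𝓝 0) := by simpa using hc.enorm
  have h2 := ENNReal.Tendsto.mul_const h1
    (Or.inr (memLp_of_continuousOn (R := R) hψ.continuousOn).2.ne)
  simpa using h2

theorem isContCurve_mul {T R : ℝ} {η ψ : ℝ → ℂ} (hη : Continuous η) (hψ : Continuous ψ) :
    IsContCurve T R fun t x => η t * ψ x where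
  aestronglyMeasurable := (by fun_prop :
    Continuous fun p : ℝ × ℝ => η p.1 * ψ p.2).aestronglyMeasurable
  memLp t _ := memLp_of_continuousOn (continuous_const.mul hψ).continuousOn
  tendsto s _ := by
    simp only [← sub_mul]
    refine tendsto_eLpNorm_mul_zero hψ ?_
    have : Tendsto (fun t => η t - η s) (𝓝 s) (𝓝 (η s - η s)) := (hη.tendsto s).sub_const _
    rw [sub_self] at this
    exact this.mono_left nhdsWithin_le_nhds

theorem isH1_const_mul {R : ℝ} (hR : 0 < R) (c : ℂ) {F : ℝ → ℂ} (hF : ContDiff ℝ ∞ F) :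
    IsH1 R (fun x => c * F x) (fun x => c * deriv F x) := by
  have hd : Continuous (deriv F) := hF.continuous_deriv (by simp)
  refine ⟨memLp_of_continuousOn (continuous_const.mul hF.continuous).continuousOn,
    memLp_of_continuousOn (continuous_const.mul hd).continuousOn, fun ψ hψ _ hψs => ?_⟩
  have e0 : ψ 0 = 0 := image_eq_zero_of_notMem_tsupport fun hx => (hψs hx).1.false
  have eR : ψ R = 0 := image_eq_zero_of_notMem_tsupport fun hx => (hψs hx).2.false
  have := integral_muI_mul_contDiff hR.le
    (IsPrimitive.of_contDiff (R := R) (hF.of_le (by simp) : ContDiff ℝ 1 F)) (hψ.of_le (by simp))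
  rw [e0, eR] at this
  simp only [mul_assoc]
  rw [integral_const_mul, integral_const_mul, this]
  ring

theorem hasTrace_mul {R : ℝ} (c : ℂ) {F : ℝ → ℂ} (hF : Continuous F) (x : ℝ) :
    HasTrace R (fun x => c * F x) x (c * F x) :=
  ⟨_, (continuous_const.mul hF).continuousOn, ae_eq_rfl, rfl⟩

/-- Test functions with separated variables. -/
noncomputable def TestFunction.ofProfile {T R : ℝ} (hR : 0 < R) {η : ℝ → ℂ} (hη : ContDiff ℝ 1 η)
    (hηT : η T = 0) {ψ : ℝ → ℂ} (hψ : IsProfile R ψ) : TestFunction T R :=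
  have h0 : ContDiff ℝ ∞ ψ := hψ.1
  have h1 : ContDiff ℝ ∞ (deriv ψ) := (contDiff_infty_iff_deriv.1 h0).2
  have h2 : ContDiff ℝ ∞ (deriv (deriv ψ)) := (contDiff_infty_iff_deriv.1 h1).2
  have h3 : ContDiff ℝ ∞ (deriv (deriv (deriv ψ))) := (contDiff_infty_iff_deriv.1 h2).2
  { φ := fun t x => η t * ψ x
    φt := fun t x => deriv η t * ψ x
    φx := fun t x => η t * deriv ψ x
    φxx := fun t x => η t * deriv (deriv ψ) x
    φxxx := fun t x => η t * deriv (deriv (deriv ψ)) x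
    φxR := fun t => η t * deriv ψ R
    cont := isContCurve_mul hη.continuous h0.continuous
    cont_t := isContCurve_mul (hη.continuous_deriv le_rfl) h0.continuous
    cont_x := isContCurve_mul hη.continuous h1.continuous
    cont_xx := isContCurve_mul hη.continuous h2.continuous
    cont_xxx := isContCurve_mul hη.continuous h3.continuous
    hasDeriv_t := fun s _ => by
      have hd := (hη.differentiable (by norm_num) s).hasDerivAt
      rw [hasDerivAt_iff_tendsto_slope] at hd
      have e : ∀ t x, (((t - s)⁻¹ : ℝ) : ℂ) * (η t * ψ x - η s * ψ x) - deriv η s * ψ x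
          = (slope η s t - deriv η s) * ψ x := fun t x => by
        rw [slope_def_module, Complex.real_smul]; ring
      simp only [e]
      refine tendsto_eLpNorm_mul_zero h0.continuous ?_
      have := hd.sub_const (deriv η s)
      rw [sub_self] at this
      exact this.mono_left (nhdsWithin_mono _ fun x hx => hx.2)
    isH1 := fun t _ => isH1_const_mul hR _ h0
    isH1_x := fun t _ => isH1_const_mul hR _ h1
    isH1_xx := fun t _ => isH1_const_mul hR _ h2
    trace_left := fun t _ => by
      simpa [hψ.2.1] using hasTrace_mul (R := R) (η t) h0.continuous 0
    trace_right := fun t _ => by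
      simpa [hψ.2.2.1] using hasTrace_mul (R := R) (η t) h0.continuous R
    trace_x_left := fun t _ => by
      simpa [hψ.2.2.2] using hasTrace_mul (R := R) (η t) h1.continuous 0
    trace_x_right := fun t _ => hasTrace_mul (η t) h1.continuous R
    final := by rw [hηT]; exact ae_of_all _ fun x => by simp }

/-- The weak form of `m' = k`, `m(0) = 0` implies `m(t) = ∫₀ᵗ k`. -/
theorem eq_integral_of_weak_ode {T : ℝ} (hT : 0 < T) {m k : ℝ → ℂ} (hm : ContinuousOn m (Icc 0 T))
    (hk : Integrable k (muI T))
    (h : ∀ η : ℝ → ℂ, ContDiff ℝ 1 η → η T = 0 →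
      ∫ t, (deriv η t * m t + η t * k t) ∂(muI T) = 0) :
    ∀ t ∈ Icc 0 T, m t = ∫ s in (0 : ℝ)..t, k s := by
  have hK := IsPrimitive.of_intervalIntegrable ((integrable_muI_iff hT.le).1 hk)
  set K : ℝ → ℂ := fun t => ∫ s in (0 : ℝ)..t, k s with hKdef
  have hKc := hK.continuousOn hT.le
  -- The defect `m - K` is continued by its endpoint values, so that its primitive is a `C¹`
  -- function on the whole line.
  set n : ℝ → ℂ := IccExtend hT.le ((Icc 0 T).domRestrict fun t => m t - K t) with hn
  have hnc : Continuous n := (continuousOn_iff_continuous_domRestrict.1 (hm.sub hKc)).Icc_extend'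
  have hnI : ∀ t ∈ Icc 0 T, n t = m t - K t := fun t ht => IccExtend_of_mem _ _ ht
  -- Starting the integral at `T` ensures `η(T) = 0`. As `η'` is the conjugate of the defect,
  -- testing yields `∫ |m - K|² = 0`. Nothing is required of `η(0)`, which is how `m(0) = 0` is
  -- encoded.
  set η : ℝ → ℂ := fun t => ∫ s in T..t, starRingEnd ℂ (n s) with hη
  have hcc : Continuous fun s => starRingEnd ℂ (n s) := Complex.continuous_conj.comp hnc
  have hd : ∀ t, HasDerivAt η (starRingEnd ℂ (n t)) t := fun t =>
    intervalIntegral.integral_hasDerivAt_right (hcc.intervalIntegrable _ _)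
      hcc.aestronglyMeasurable.stronglyMeasurableAtFilter hcc.continuousAt
  have hde : deriv η = fun t => starRingEnd ℂ (n t) := funext fun t => (hd t).deriv
  have hηC : ContDiff ℝ 1 η := contDiff_one_iff_deriv.2
    ⟨fun t => (hd t).differentiableAt, by rw [hde]; exact hcc⟩
  have hηT : η T = 0 := by simp [hη]
  have h1 := h η hηC hηT
  have h2 := integral_muI_mul_contDiff hT.le hK hηC
  have hK0 : K 0 = 0 := by simp [hKdef]
  rw [hηT, hK0] at h2
  have cont_int : ∀ {f : ℝ → ℂ}, ContinuousOn f (Icc 0 T) → Integrable f (muI T) := fun {f} hf => by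
    refine (integrable_muI_iff hT.le).2 (ContinuousOn.intervalIntegrable ?_)
    rwa [uIcc_of_le hT.le]
  have cη' : ContinuousOn (deriv η) (Icc 0 T) := (hηC.continuous_deriv le_rfl).continuousOn
  have i1 : Integrable (fun t => deriv η t * m t) (muI T) := cont_int (cη'.mul hm)
  have i2 : Integrable (fun t => K t * deriv η t) (muI T) := cont_int (hKc.mul cη')
  have i3 : Integrable (fun t => k t * η t) (muI T) :=
    integrable_mul_continuous hT.le hk hηC.continuous.continuousOn
  have i3' : Integrable (fun t => η t * k t) (muI T) := by simpa only [mul_comm] using i3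
  have h3 : ∫ t, starRingEnd ℂ (n t) * n t ∂(muI T) = 0 := by
    have e : ∫ t, starRingEnd ℂ (n t) * n t ∂(muI T)
        = (∫ t, deriv η t * m t ∂(muI T)) - ∫ t, K t * deriv η t ∂(muI T) := by
      rw [← integral_sub i1 i2]
      refine integral_congr_ae ?_
      filter_upwards [ae_muI_mem T] with t ht
      rw [hde]
      simp only
      rw [hnI t (Ioo_subset_Icc_self ht)]
      ring
    rw [integral_add i1 i3'] at h1
    have e3 : ∫ t, η t * k t ∂(muI T) = ∫ t, k t * η t ∂(muI T) := by simp only [mul_comm]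
    rw [e]
    linear_combination h1 - e3 - h2
  have h4 : ∫ t, ‖n t‖ ^ 2 ∂(muI T) = 0 := by
    have e : (fun t => starRingEnd ℂ (n t) * n t) = fun t => ((‖n t‖ ^ 2 : ℝ) : ℂ) := by
      ext t; rw [mul_comm, Complex.mul_conj, Complex.normSq_eq_norm_sq]
    rw [e, integral_complex_ofReal] at h3
    exact_mod_cast h3
  have hni : Integrable (fun t => ‖n t‖ ^ 2) (muI T) :=
    (integrable_muI_iff hT.le).2 ((hnc.norm.pow 2).intervalIntegrable _ _)
  have h5 := (integral_eq_zero_iff_of_nonneg (fun t => by positivity) hni).1 h4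
  have h6 : n =ᵐ[muI T] fun _ => 0 := by
    filter_upwards [h5] with t ht
    simpa using ht
  intro t ht
  have h7 := eqOn_of_ae_eq hT hnc.continuousOn continuousOn_const h6 ht
  rw [hnI t ht] at h7
  exact sub_eq_zero.1 h7

/-! ### The equation for the difference of two solutions -/

theorem IsContCurve.continuousOn {T R : ℝ} {v : ℝ → ℝ → ℂ} (hv : IsContCurve T R v) :
    ContinuousOn (sliceCurve R v) (Icc 0 T) := by
  intro s hs
  rw [ContinuousWithinAt, tendsto_iff_edist_tendsto_0]
  refine (hv.tendsto s hs).congr' ?_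
  filter_upwards [self_mem_nhdsWithin] with t ht
  rw [Lp.edist_def]
  refine eLpNorm_congr_ae ?_
  filter_upwards [sliceCurve_ae (hv.memLp t ht), sliceCurve_ae (hv.memLp s hs)] with x h1 h2
  rw [Pi.sub_apply, h1, h2]

theorem IsContCurve.memLp_two {T R : ℝ} {v : ℝ → ℝ → ℂ} (hv : IsContCurve T R v) :
    MemLp (fun p : ℝ × ℝ => v p.1 p.2) 2 (muQ T R) := by
  refine (memLp_two_iff_integrable_sq_norm hv.aestronglyMeasurable).2 ?_
  have hm := hv.aestronglyMeasurable.norm.pow 2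
  rw [muQ_eq_prod] at hm ⊢
  have hI : ∀ᵐ t ∂(muI T), MemLp (v t) 2 (muI R) := by
    filter_upwards [ae_muI_mem T] with t ht using hv.memLp t (Ioo_subset_Icc_self ht)
  refine (integrable_prod_iff hm).2 ⟨?_, ?_⟩
  · filter_upwards [hI] with t ht using ht.integrable_norm_pow (by norm_num)
  · have hc : IntegrableOn (fun t => ‖sliceCurve R v t‖ ^ 2) (Icc 0 T) :=
      (hv.continuousOn.norm.pow 2).integrableOn_compact isCompact_Icc
    have hc' : Integrable (fun t => ‖sliceCurve R v t‖ ^ 2) (muI T) :=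
      hc.mono_set Ioo_subset_Icc_self
    refine hc'.congr ?_
    filter_upwards [hI] with t ht
    rw [norm_sq_eq_integral]
    refine integral_congr_ae ?_
    filter_upwards [sliceCurve_ae ht] with x hx
    rw [hx]; simp

theorem IsContCurve.sub {T R : ℝ} {u v : ℝ → ℝ → ℂ} (hu : IsContCurve T R u)
    (hv : IsContCurve T R v) : IsContCurve T R fun t x => u t x - v t x where
  aestronglyMeasurable := hu.aestronglyMeasurable.sub hv.aestronglyMeasurable
  memLp t ht := (hu.memLp t ht).sub (hv.memLp t ht)
  tendsto s hs := by
    have h := (hu.tendsto s hs).add (hv.tendsto s hs)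
    rw [add_zero] at h
    refine tendsto_of_tendsto_of_tendsto_of_le_of_le' tendsto_const_nhds h
      (Eventually.of_forall fun _ => zero_le) ?_
    filter_upwards [self_mem_nhdsWithin] with t ht
    have e : (fun x => u t x - v t x - (u s x - v s x))
        = (fun x => u t x - u s x) - fun x => v t x - v s x := by
      ext x; simp only [Pi.sub_apply]; ring
    rw [e]
    exact eLpNorm_sub_le ((hu.memLp t ht).sub (hu.memLp s hs)).1
      ((hv.memLp t ht).sub (hv.memLp s hs)).1 (by norm_num)

instance isFiniteMeasure_muQ (T R : ℝ) : IsFiniteMeasure (muQ T R) := by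
  rw [muQ_eq_prod]; infer_instance

/-- The difference of the nonlinear fluxes, paired with `φ_x`. -/
noncomputable def fluxDiff (c : Coeffs) (u v : ℝ → ℝ → ℂ) (t x : ℝ) : ℂ :=
  Complex.I * (c.β + c.γ) * (absPow c.p₁ (u t x) * u t x - absPow c.p₁ (v t x) * v t x)

/-- The difference of the nonlinear sources, paired with `φ`. -/
noncomputable def sourceDiff (c : Coeffs) (u ux v vx : ℝ → ℝ → ℂ) (t x : ℝ) : ℂ :=
  -c.lam * (absPow c.p₀ (u t x) * u t x - absPow c.p₀ (v t x) * v t x)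
    + Complex.I * c.γ * (absPow c.p₁ (u t x) * ux t x - absPow c.p₁ (v t x) * vx t x)

/-- Needed to subtract the two integral identities under one integral sign. Every factor coming from
a separated test function is continuous, hence bounded on the rectangle, so integrability of each
coefficient is enough. -/
theorem integrable_integrand {c : Coeffs} {T R : ℝ} (hR : 0 < R) {f u ux : ℝ → ℝ → ℂ}
    (hf : Integrable (fun p : ℝ × ℝ => f p.1 p.2) (muQ T R)) (hu : IsX T R u ux)
    (h0 : Integrable (fun p : ℝ × ℝ => absPow c.p₀ (u p.1 p.2) * u p.1 p.2) (muQ T R))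
    (h1 : Integrable (fun p : ℝ × ℝ => absPow c.p₁ (u p.1 p.2) * u p.1 p.2) (muQ T R))
    (h2 : Integrable (fun p : ℝ × ℝ => absPow c.p₁ (u p.1 p.2) * ux p.1 p.2) (muQ T R))
    {η : ℝ → ℂ} (hη : ContDiff ℝ 1 η) (hηT : η T = 0) {ψ : ℝ → ℂ} (hψ : IsProfile R ψ) :
    Integrable (fun p : ℝ × ℝ => integrand c f u ux (TestFunction.ofProfile hR hη hηT hψ) p.1 p.2)
      (muQ T R) := by
  have g0 : ContDiff ℝ ∞ ψ := hψ.1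
  have g1 : ContDiff ℝ ∞ (deriv ψ) := (contDiff_infty_iff_deriv.1 g0).2
  have g2 : ContDiff ℝ ∞ (deriv (deriv ψ)) := (contDiff_infty_iff_deriv.1 g1).2
  have c0 := g0.continuous
  have c1 := g1.continuous
  have c2 := g2.continuous
  have cη := hη.continuous
  have cη' := hη.continuous_deriv le_rfl
  have hui := hu.contCurve.memLp_two.integrable (by norm_num : (1 : ENNReal) ≤ 2)
  have huxi := hu.memLp.integrable (by norm_num : (1 : ENNReal) ≤ 2)
  have k0 : Continuous fun p : ℝ × ℝ => η p.1 * ψ p.2 := by fun_prop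
  have kt : Continuous fun p : ℝ × ℝ => deriv η p.1 * ψ p.2 := by fun_prop
  have k1 : Continuous fun p : ℝ × ℝ => η p.1 * deriv ψ p.2 := by fun_prop
  have k2 : Continuous fun p : ℝ × ℝ => η p.1 * deriv (deriv ψ) p.2 := by fun_prop
  have i := ((((((((integrable_mul_continuous_muQ hui kt).const_mul Complex.I).add
    ((integrable_mul_continuous_muQ huxi k1).const_mul (c.a : ℂ))).add
    ((integrable_mul_continuous_muQ hui k1).const_mul (Complex.I * c.b))).sub
    ((integrable_mul_continuous_muQ huxi k2).const_mul Complex.I)).sub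
    ((integrable_mul_continuous_muQ h0 k0).const_mul (c.lam : ℂ))).add
    ((integrable_mul_continuous_muQ h1 k1).const_mul (Complex.I * c.β))).add
    (((integrable_mul_continuous_muQ h2 k0).add (integrable_mul_continuous_muQ h1 k1)).const_mul
      (Complex.I * c.γ))).add (integrable_mul_continuous_muQ hf k0)
  refine i.congr (ae_of_all _ fun p => ?_)
  simp only [integrand, TestFunction.ofProfile, Pi.add_apply, Pi.sub_apply]
  ring

/-- The identity satisfied by the difference of two weak solutions, integrated in time. -/
theorem weak_identity_sub {c : Coeffs} {T R : ℝ} (hT : 0 < T) (hR : 0 < R) {u₀ h : ℝ → ℂ}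
    {f u ux v vx : ℝ → ℝ → ℂ}
    (hf : Integrable (fun p : ℝ × ℝ => f p.1 p.2) (muQ T R))
    (hu : IsX T R u ux) (hv : IsX T R v vx)
    (hu0 : Integrable (fun p : ℝ × ℝ => absPow c.p₀ (u p.1 p.2) * u p.1 p.2) (muQ T R))
    (hu1 : Integrable (fun p : ℝ × ℝ => absPow c.p₁ (u p.1 p.2) * u p.1 p.2) (muQ T R))
    (hu2 : Integrable (fun p : ℝ × ℝ => absPow c.p₁ (u p.1 p.2) * ux p.1 p.2) (muQ T R))
    (hv0 : Integrable (fun p : ℝ × ℝ => absPow c.p₀ (v p.1 p.2) * v p.1 p.2) (muQ T R))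
    (hv1 : Integrable (fun p : ℝ × ℝ => absPow c.p₁ (v p.1 p.2) * v p.1 p.2) (muQ T R))
    (hv2 : Integrable (fun p : ℝ × ℝ => absPow c.p₁ (v p.1 p.2) * vx p.1 p.2) (muQ T R))
    (hui : ∀ Φ : TestFunction T R,
      (∫ p, integrand c f u ux Φ p.1 p.2 ∂(muQ T R))
        + Complex.I * (∫ x, u₀ x * Φ.φ 0 x ∂(muI R))
        + Complex.I * (∫ t, h t * Φ.φxR t ∂(muI T)) = 0)
    (hvi : ∀ Φ : TestFunction T R,
      (∫ p, integrand c f v vx Φ p.1 p.2 ∂(muQ T R))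
        + Complex.I * (∫ x, u₀ x * Φ.φ 0 x ∂(muI R))
        + Complex.I * (∫ t, h t * Φ.φxR t ∂(muI T)) = 0)
    {ψ : ℝ → ℂ} (hψ : IsProfile R ψ) {t : ℝ} (ht : t ∈ Icc 0 T) :
    Complex.I * ∫ x, (u t x - v t x) * ψ x ∂(muI R)
      = ∫ s in (0 : ℝ)..t, ∫ x, ((c.a * (ux s x - vx s x) + Complex.I * c.b * (u s x - v s x)
          + fluxDiff c u v s x) * deriv ψ x - Complex.I * ((ux s x - vx s x) * deriv (deriv ψ) x)
          + sourceDiff c u ux v vx s x * ψ x) ∂(muI R) := by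
  have g0 : ContDiff ℝ ∞ ψ := hψ.1
  have g1 : ContDiff ℝ ∞ (deriv ψ) := (contDiff_infty_iff_deriv.1 g0).2
  have g2 : ContDiff ℝ ∞ (deriv (deriv ψ)) := (contDiff_infty_iff_deriv.1 g1).2
  have c0 := g0.continuous
  have c1 := g1.continuous
  have c2 := g2.continuous
  have hw := hu.contCurve.sub hv.contCurve
  have hwi : Integrable (fun p : ℝ × ℝ => u p.1 p.2 - v p.1 p.2) (muQ T R) :=
    hw.memLp_two.integrable (by norm_num)
  have hwxi : Integrable (fun p : ℝ × ℝ => ux p.1 p.2 - vx p.1 p.2) (muQ T R) :=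
    (hu.memLp.sub hv.memLp).integrable (by norm_num)
  have hF1 : Integrable (fun p : ℝ × ℝ => fluxDiff c u v p.1 p.2) (muQ T R) :=
    (hu1.sub hv1).const_mul _
  have hF0 : Integrable (fun p : ℝ × ℝ => sourceDiff c u ux v vx p.1 p.2) (muQ T R) :=
    ((hu0.sub hv0).const_mul _).add ((hu2.sub hv2).const_mul _)
  set k : ℝ → ℝ → ℂ := fun s x => (c.a * (ux s x - vx s x) + Complex.I * c.b * (u s x - v s x)
          + fluxDiff c u v s x) * deriv ψ x - Complex.I * ((ux s x - vx s x) * deriv (deriv ψ) x)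
          + sourceDiff c u ux v vx s x * ψ x with hk
  have hki : Integrable (fun p : ℝ × ℝ => k p.1 p.2) (muQ T R) :=
    ((integrable_mul_continuous_muQ (((hwxi.const_mul _).add (hwi.const_mul _)).add hF1)
      (by fun_prop : Continuous fun p : ℝ × ℝ => deriv ψ p.2)).sub
      ((integrable_mul_continuous_muQ hwxi
        (by fun_prop : Continuous fun p : ℝ × ℝ => deriv (deriv ψ) p.2)).const_mul _)).add
      (integrable_mul_continuous_muQ hF0 (by fun_prop : Continuous fun p : ℝ × ℝ => ψ p.2))
  have hwψ : Integrable (fun p : ℝ × ℝ => Complex.I * ((u p.1 p.2 - v p.1 p.2) * ψ p.2))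
      (muQ T R) := (integrable_mul_continuous_muQ hwi
        (by fun_prop : Continuous fun p : ℝ × ℝ => ψ p.2)).const_mul _
  have hkint : Integrable (fun s => ∫ x, k s x ∂(muI R)) (muI T) := by
    have := hki
    rw [muQ_eq_prod] at this
    exact this.integral_prod_left
  have hm : ContinuousOn (fun s => Complex.I * ∫ x, (u s x - v s x) * ψ x ∂(muI R)) (Icc 0 T) := by
    refine continuousOn_const.mul (((pairing R ψ c0).continuous.comp_continuousOn
      hw.continuousOn).congr fun s hs => ?_)
    rw [Function.comp_apply, pairing_apply]
    refine integral_congr_ae ?_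
    filter_upwards [sliceCurve_ae (g := fun t x => u t x - v t x) (hw.memLp s hs)] with x hx
    rw [hx]
  refine eq_integral_of_weak_ode hT hm hkint (fun η hη hηT => ?_) t ht
  have cη := hη.continuous
  have cη' := hη.continuous_deriv le_rfl
  set Φ : TestFunction T R := TestFunction.ofProfile hR hη hηT hψ with hΦ
  have iu := integrable_integrand hR hf hu hu0 hu1 hu2 hη hηT hψ
  have iv := integrable_integrand hR hf hv hv0 hv1 hv2 hη hηT hψ
  -- The contributions of `u₀` and `h` coincide for both solutions and cancel here; those of `f`
  -- cancel pointwise in the integrand.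
  have e1 : ∫ p, (integrand c f u ux Φ p.1 p.2 - integrand c f v vx Φ p.1 p.2) ∂(muQ T R) = 0 := by
    rw [integral_sub iu iv]
    linear_combination hui Φ - hvi Φ
  have iA : Integrable (fun p : ℝ × ℝ =>
      deriv η p.1 * (Complex.I * ((u p.1 p.2 - v p.1 p.2) * ψ p.2))) (muQ T R) := by
    simpa only [mul_comm] using integrable_mul_continuous_muQ hwψ
      (by fun_prop : Continuous fun p : ℝ × ℝ => deriv η p.1)
  have iB : Integrable (fun p : ℝ × ℝ => η p.1 * k p.1 p.2) (muQ T R) := by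
    simpa only [mul_comm] using integrable_mul_continuous_muQ hki
      (by fun_prop : Continuous fun p : ℝ × ℝ => η p.1)
  -- Expanding `(u φ)_x` moves `γ |u|^p₁ u` into the flux, next to the `β` term, and leaves `γ
  -- |u|^p₁ u_x` in the source. The result has the shape `η' m + η k`.
  have e2 : ∀ p : ℝ × ℝ, integrand c f u ux Φ p.1 p.2 - integrand c f v vx Φ p.1 p.2
      = deriv η p.1 * (Complex.I * ((u p.1 p.2 - v p.1 p.2) * ψ p.2)) + η p.1 * k p.1 p.2 := by
    intro p
    simp only [integrand, hΦ, TestFunction.ofProfile, hk, fluxDiff, sourceDiff]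
    ring
  simp only [e2] at e1
  rw [integral_add iA iB] at e1
  rw [muQ_eq_prod] at iA iB e1
  rw [integral_prod _ iA, integral_prod _ iB] at e1
  rw [← integral_add iA.integral_prod_left iB.integral_prod_left] at e1
  simpa only [integral_const_mul] using e1

/-! ### Pointwise estimates for the nonlinear terms and sup bounds -/

/-- Mean value inequality; `p ≥ 1` makes the derivative `p x^(p-1)` bounded up to `x = 0` and
increasing in `x`. This is where the lower bounds on the exponents enter. -/
theorem abs_rpow_sub_rpow_le {p B s r : ℝ} (hp : 1 ≤ p) (hs : s ∈ Icc 0 B)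
    (hr : r ∈ Icc 0 B) : |s ^ p - r ^ p| ≤ p * B ^ (p - 1) * |s - r| := by
  have h := (convex_Icc (0 : ℝ) B).norm_image_sub_le_of_norm_hasDerivWithin_le
    (f := fun x : ℝ => x ^ p) (f' := fun x => p * x ^ (p - 1)) (C := p * B ^ (p - 1))
    (fun x _ => (Real.hasDerivAt_rpow_const (Or.inr hp)).hasDerivWithinAt)
    (fun x hx => by
      rw [Real.norm_eq_abs, abs_of_nonneg (mul_nonneg (by linarith) (Real.rpow_nonneg hx.1 _))]
      gcongr
      · exact hx.1
      · exact hx.2) hr hs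
  simpa only [Real.norm_eq_abs] using h

theorem norm_absPow (p : ℝ) (z : ℂ) : ‖absPow p z‖ = ‖z‖ ^ p := by
  rw [absPow, Complex.norm_real, Real.norm_eq_abs, abs_of_nonneg (Real.rpow_nonneg (norm_nonneg _) _)]

theorem norm_absPow_sub_le {p B : ℝ} (hp : 1 ≤ p) {z y : ℂ} (hz : ‖z‖ ≤ B) (hy : ‖y‖ ≤ B) :
    ‖absPow p z - absPow p y‖ ≤ p * B ^ (p - 1) * ‖z - y‖ := by
  have hB : 0 ≤ B := (norm_nonneg _).trans hz
  rw [absPow, absPow, ← Complex.ofReal_sub, Complex.norm_real, Real.norm_eq_abs]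
  refine (abs_rpow_sub_rpow_le hp ⟨norm_nonneg _, hz⟩ ⟨norm_nonneg _, hy⟩).trans ?_
  have := Real.rpow_nonneg hB (p - 1)
  gcongr
  exact abs_norm_sub_norm_le z y

theorem norm_absPow_mul_sub_le {p B : ℝ} (hp : 1 ≤ p) {z y : ℂ} (hz : ‖z‖ ≤ B) (hy : ‖y‖ ≤ B) :
    ‖absPow p z * z - absPow p y * y‖ ≤ (1 + p) * B ^ p * ‖z - y‖ := by
  have hB : 0 ≤ B := (norm_nonneg _).trans hz
  have e : absPow p z * z - absPow p y * y
      = absPow p z * (z - y) + (absPow p z - absPow p y) * y := by ring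
  have hBp : B ^ (p - 1) * B = B ^ p := by
    rcases hB.eq_or_lt with h | h
    · rw [← h, Real.zero_rpow (by linarith : p ≠ 0), mul_zero]
    · rw [← Real.rpow_add_one h.ne', sub_add_cancel]
  rw [e]
  calc ‖absPow p z * (z - y) + (absPow p z - absPow p y) * y‖
      ≤ ‖z‖ ^ p * ‖z - y‖ + ‖absPow p z - absPow p y‖ * ‖y‖ := by
        refine (norm_add_le _ _).trans ?_
        rw [norm_mul, norm_mul, norm_absPow]
    _ ≤ B ^ p * ‖z - y‖ + (p * B ^ (p - 1) * ‖z - y‖) * B := by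
        have h1 := norm_absPow_sub_le hp hz hy
        have h2 : 0 ≤ p * B ^ (p - 1) * ‖z - y‖ := (norm_nonneg _).trans h1
        gcongr
    _ = (1 + p) * B ^ p * ‖z - y‖ := by rw [← hBp]; ring

/-- For the terms `|u|^p u_x`: the difference of powers is paired with one derivative `Z`, and the
remaining power with the difference of derivatives. -/
theorem norm_absPow_mul_deriv_sub_le {p B : ℝ} {z y Z Y : ℂ} (hp : 1 ≤ p) (hz : ‖z‖ ≤ B)
    (hy : ‖y‖ ≤ B) : ‖absPow p z * Z - absPow p y * Y‖
      ≤ p * B ^ (p - 1) * ‖z - y‖ * ‖Z‖ + B ^ p * ‖Z - Y‖ := by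
  have e : absPow p z * Z - absPow p y * Y
      = (absPow p z - absPow p y) * Z + absPow p y * (Z - Y) := by ring
  rw [e]
  refine (norm_add_le _ _).trans ?_
  rw [norm_mul, norm_mul, norm_absPow]
  gcongr
  exact norm_absPow_sub_le hp hz hy

theorem rpow_le_pow_of_one_le {B p : ℝ} (hB : 1 ≤ B) {n : ℕ} (hp : p ≤ n) : B ^ p ≤ B ^ n := by
  rw [← Real.rpow_natCast]
  exact Real.rpow_le_rpow_of_exponent_le hB hp

theorem integral_norm_mul_norm_le {R : ℝ} (f g : Lp ℂ 2 (muI R)) :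
    ∫ x, ‖f x‖ * ‖g x‖ ∂(muI R) ≤ ‖f‖ * ‖g‖ := by
  have h2 : ENNReal.ofReal 2 = 2 := by norm_num
  have h := integral_mul_norm_le_Lp_mul_Lq (μ := muI R) (f := f) (g := g) (p := 2) (q := 2)
    Real.HolderConjugate.two_two (by rw [h2]; exact Lp.memLp f) (by rw [h2]; exact Lp.memLp g)
  have e : ∀ k : Lp ℂ 2 (muI R), (∫ x, ‖k x‖ ^ (2 : ℝ) ∂(muI R)) ^ (1 / (2 : ℝ)) = ‖k‖ := fun k => by
    simp only [Real.rpow_two]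
    rw [← norm_sq_eq_integral, ← Real.sqrt_eq_rpow, Real.sqrt_sq (norm_nonneg _)]
  rwa [e, e] at h

/-- The `L₂` norm is monotone and subadditive with respect to pointwise bounds. -/
theorem norm_le_of_ae_le_add {R a₁ a₂ a₃ : ℝ} (h₁ : 0 ≤ a₁) (h₂ : 0 ≤ a₂) (h₃ : 0 ≤ a₃)
    {f g₁ g₂ g₃ : Lp ℂ 2 (muI R)}
    (h : ∀ᵐ x ∂(muI R), ‖f x‖ ≤ a₁ * ‖g₁ x‖ + a₂ * ‖g₂ x‖ + a₃ * ‖g₃ x‖) :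
    ‖f‖ ≤ a₁ * ‖g₁‖ + a₂ * ‖g₂‖ + a₃ * ‖g₃‖ := by
  have hn : ∀ g : Lp ℂ 2 (muI R), ∃ g' : Lp ℝ 2 (muI R), (∀ᵐ x ∂(muI R), g' x = ‖g x‖) ∧
      ‖g'‖ = ‖g‖ := fun g => by
    refine ⟨(Lp.memLp g).norm.toLp _, (Lp.memLp g).norm.coeFn_toLp, ?_⟩
    rw [Lp.norm_toLp, eLpNorm_norm, Lp.norm_def]
  obtain ⟨k₁, e₁, n₁⟩ := hn g₁
  obtain ⟨k₂, e₂, n₂⟩ := hn g₂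
  obtain ⟨k₃, e₃, n₃⟩ := hn g₃
  have hle : ‖f‖ ≤ ‖a₁ • k₁ + a₂ • k₂ + a₃ • k₃‖ := by
    refine Lp.norm_le_norm_of_ae_le ?_
    filter_upwards [h, e₁, e₂, e₃, Lp.coeFn_add (a₁ • k₁ + a₂ • k₂) (a₃ • k₃),
      Lp.coeFn_add (a₁ • k₁) (a₂ • k₂), Lp.coeFn_smul a₁ k₁, Lp.coeFn_smul a₂ k₂,
      Lp.coeFn_smul a₃ k₃] with x hx h1 h2 h3 h4 h5 h6 h7 h8
    rw [h4, Pi.add_apply, h5, Pi.add_apply, h6, h7, h8, Pi.smul_apply, Pi.smul_apply,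
      Pi.smul_apply, h1, h2, h3]
    exact hx.trans (le_abs_self _)
  refine hle.trans ((norm_add₃_le).trans (le_of_eq ?_))
  rw [norm_smul, norm_smul, norm_smul, n₁, n₂, n₃, Real.norm_of_nonneg h₁, Real.norm_of_nonneg h₂,
    Real.norm_of_nonneg h₃]

/-- Sobolev bound on the interval. -/
theorem IsPrimitive.ae_sq_norm_le {R : ℝ} (hR : 0 < R) {Y z : ℝ → ℂ} (h : IsPrimitive R Y z)
    {f g : Lp ℂ 2 (muI R)} (hf : f =ᵐ[muI R] Y) (hg : g =ᵐ[muI R] z) :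
    ∀ᵐ x ∂(muI R), ‖f x‖ ^ 2 ≤ ‖f‖ ^ 2 / R + 2 * (‖f‖ * ‖g‖) := by
  have hJ : ∫ y, ‖Y y‖ * ‖z y‖ ∂(muI R) ≤ ‖f‖ * ‖g‖ := by
    refine le_trans (le_of_eq (integral_congr_ae ?_)) (integral_norm_mul_norm_le f g)
    filter_upwards [hf, hg] with x h1 h2
    rw [h1, h2]
  filter_upwards [hf, ae_muI_mem R] with x hx hm
  rw [hx]
  -- Averaging over the free base point `y` produces the term `‖f‖² / R`.
  have h1 : ∀ᵐ y ∂(muI R), ‖Y x‖ ^ 2 - 2 * (‖f‖ * ‖g‖) ≤ ‖f y‖ ^ 2 := by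
    filter_upwards [hf, ae_muI_mem R] with y hy hym
    rw [hy]
    linarith [h.sq_norm_le hR.le (Ioo_subset_Icc_self hm) (Ioo_subset_Icc_self hym)]
  have h2 := integral_mono_ae (integrable_const _)
    ((Lp.memLp f).integrable_norm_pow (by norm_num : (2 : ℕ) ≠ 0)) h1
  rw [← norm_sq_eq_integral, integral_muI hR.le, intervalIntegral.integral_const, sub_zero,
    smul_eq_mul] at h2
  have : ‖Y x‖ ^ 2 - 2 * (‖f‖ * ‖g‖) ≤ ‖f‖ ^ 2 / R := by
    rw [le_div_iff₀ hR]; linarith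
  linarith

/-- Taking the base point at the zero of `Y` removes the `‖f‖² / R` term and leaves a pure product.
-/
theorem IsPrimitive.ae_sq_norm_le_of_zero {R : ℝ} (hR : 0 < R) {Y z : ℝ → ℂ}
    (h : IsPrimitive R Y z) (h0 : Y 0 = 0)
    {f g : Lp ℂ 2 (muI R)} (hf : f =ᵐ[muI R] Y) (hg : g =ᵐ[muI R] z) :
    ∀ᵐ x ∂(muI R), ‖f x‖ ^ 2 ≤ 2 * (‖f‖ * ‖g‖) := by
  have hJ : ∫ y, ‖Y y‖ * ‖z y‖ ∂(muI R) ≤ ‖f‖ * ‖g‖ := by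
    refine le_trans (le_of_eq (integral_congr_ae ?_)) (integral_norm_mul_norm_le f g)
    filter_upwards [hf, hg] with x h1 h2
    rw [h1, h2]
  filter_upwards [hf, ae_muI_mem R] with x hx hm
  rw [hx]
  have := h.sq_norm_le hR.le (Ioo_subset_Icc_self hm) (x' := 0) ⟨le_rfl, hR.le⟩
  rw [h0, norm_zero] at this
  linarith

/-- The difference of two functions in `H¹` with the same boundary values has zero boundary
values. -/
theorem exists_isPrimitive_sub {R : ℝ} (hR : 0 < R) {u ux v vx : ℝ → ℂ} (hu : IsH1 R u ux)
    (hv : IsH1 R v vx) {m n : ℂ} (hu0 : HasTrace R u 0 m) (hv0 : HasTrace R v 0 m)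
    (huR : HasTrace R u R n) (hvR : HasTrace R v R n) :
    ∃ Y : ℝ → ℂ, IsPrimitive R Y (fun x => ux x - vx x) ∧
      (fun x => u x - v x) =ᵐ[muI R] Y ∧ Y 0 = 0 ∧ Y R = 0 := by
  obtain ⟨Yu, hYu, eu⟩ := hu.exists_isPrimitive hR
  obtain ⟨Yv, hYv, ev⟩ := hv.exists_isPrimitive hR
  have cu := hYu.continuousOn hR.le
  have cv := hYv.continuousOn hR.le
  have m0 : (0 : ℝ) ∈ Icc 0 R := ⟨le_rfl, hR.le⟩
  have mR : R ∈ Icc 0 R := ⟨hR.le, le_rfl⟩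
  refine ⟨_, hYu.sub hYv, ?_, ?_, ?_⟩
  · filter_upwards [eu, ev] with x h1 h2
    rw [h1, h2]
  · rw [hu0.eq hR cu eu m0, hv0.eq hR cv ev m0, sub_self]
  · rw [huR.eq hR cu eu mR, hvR.eq hR cv ev mR, sub_self]

/-- Pointwise bound for the difference of the fluxes. -/
theorem norm_fluxDiff_le {c : Coeffs} (hp₁ : c.p₁ ∈ Icc (1 : ℝ) 2) {u v : ℝ → ℝ → ℂ} {t x s : ℝ}
    (hs : 1 ≤ s) (hu : ‖u t x‖ ^ 2 ≤ s) (hv : ‖v t x‖ ^ 2 ≤ s) :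
    ‖fluxDiff c u v t x‖ ≤ 3 * |c.β + c.γ| * s * ‖u t x - v t x‖ := by
  have hB : 1 ≤ √s := Real.one_le_sqrt.2 hs
  have h1 := norm_absPow_mul_sub_le hp₁.1 (Real.le_sqrt_of_sq_le hu) (Real.le_sqrt_of_sq_le hv)
  have h2 : √s ^ c.p₁ ≤ s := by
    refine (rpow_le_pow_of_one_le hB (n := 2) (by exact_mod_cast hp₁.2)).trans (le_of_eq ?_)
    exact Real.sq_sqrt (by linarith)
  rw [fluxDiff, norm_mul, norm_mul, Complex.norm_I, one_mul, ← Complex.ofReal_add,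
    Complex.norm_real, Real.norm_eq_abs]
  calc |c.β + c.γ| * ‖absPow c.p₁ (u t x) * u t x - absPow c.p₁ (v t x) * v t x‖
      ≤ |c.β + c.γ| * ((1 + 2) * s * ‖u t x - v t x‖) := by
        refine mul_le_mul_of_nonneg_left (h1.trans ?_) (abs_nonneg _)
        gcongr
        exact hp₁.2
    _ = _ := by ring

/-- Pointwise bound for the difference of the sources. -/
theorem norm_sourceDiff_le {c : Coeffs} (hp₀ : c.p₀ ∈ Icc (1 : ℝ) 4) (hp₁ : c.p₁ ∈ Icc (1 : ℝ) 2)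
    {u ux v vx : ℝ → ℝ → ℂ} {t x s m : ℝ} (hs : 1 ≤ s) (hu : ‖u t x‖ ^ 2 ≤ s)
    (hv : ‖v t x‖ ^ 2 ≤ s) (hm : ‖u t x - v t x‖ ≤ m) :
    ‖sourceDiff c u ux v vx t x‖ ≤ 5 * |c.lam| * s ^ 2 * ‖u t x - v t x‖
      + 2 * |c.γ| * √s * m * ‖ux t x‖ + |c.γ| * s * ‖ux t x - vx t x‖ := by
  have hB : 1 ≤ √s := Real.one_le_sqrt.2 hs
  have hB2 : √s ^ 2 = s := Real.sq_sqrt (by linarith)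
  have bu := Real.le_sqrt_of_sq_le hu
  have bv := Real.le_sqrt_of_sq_le hv
  have h1 := norm_absPow_mul_sub_le hp₀.1 bu bv
  have h2 := norm_absPow_mul_deriv_sub_le (Z := ux t x) (Y := vx t x) hp₁.1 bu bv
  -- With the sup bound `√s ≥ 1`, the restriction `p₀ ≤ 4` gives exactly the power `s²` that is
  -- integrable in time; `p₁ ≤ 2` plays the same role in the next two bounds.
  have k0 : √s ^ c.p₀ ≤ s ^ 2 := by
    refine (rpow_le_pow_of_one_le hB (n := 4) (by exact_mod_cast hp₀.2)).trans (le_of_eq ?_)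
    rw [show √s ^ 4 = (√s ^ 2) ^ 2 by ring, hB2]
  have k1 : √s ^ c.p₁ ≤ s :=
    (rpow_le_pow_of_one_le hB (n := 2) (by exact_mod_cast hp₁.2)).trans hB2.le
  have k2 : √s ^ (c.p₁ - 1) ≤ √s := by
    refine (rpow_le_pow_of_one_le hB (n := 1) (by push_cast; linarith [hp₁.2])).trans ?_
    rw [pow_one]
  have hm0 : 0 ≤ m := (norm_nonneg _).trans hm
  have p0 : (0 : ℝ) ≤ c.p₁ := by linarith [hp₁.1]
  rw [sourceDiff]
  refine (norm_add_le _ _).trans ?_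
  rw [norm_mul, norm_neg, Complex.norm_real, Real.norm_eq_abs, norm_mul, norm_mul, Complex.norm_I,
    one_mul, Complex.norm_real, Real.norm_eq_abs]
  calc |c.lam| * ‖absPow c.p₀ (u t x) * u t x - absPow c.p₀ (v t x) * v t x‖
        + |c.γ| * ‖absPow c.p₁ (u t x) * ux t x - absPow c.p₁ (v t x) * vx t x‖
      ≤ |c.lam| * ((1 + 4) * s ^ 2 * ‖u t x - v t x‖)
        + |c.γ| * (2 * √s * m * ‖ux t x‖ + s * ‖ux t x - vx t x‖) := by
        refine add_le_add (mul_le_mul_of_nonneg_left (h1.trans ?_) (abs_nonneg _))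
          (mul_le_mul_of_nonneg_left (h2.trans ?_) (abs_nonneg _))
        · gcongr
          exact hp₀.2
        · gcongr
          exact hp₁.2
    _ = _ := by ring

/-! ### Gronwall's lemma -/

/-- Gronwall's lemma with an integrable coefficient and zero initial data. -/
theorem eq_zero_of_le_integral_mul {T : ℝ} {φ κ : ℝ → ℝ} (hφ : Continuous φ)
    (hφ0 : ∀ t, 0 ≤ φ t) (hκ : Integrable κ) (hκ0 : ∀ t, 0 ≤ κ t)
    (h : ∀ t ∈ Ico 0 T, φ t ≤ ∫ s in (0 : ℝ)..t, κ s * φ s) : ∀ t ∈ Ico 0 T, φ t = 0 := by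
  intro t₁ ht₁
  set Γ : ℝ → ℝ := fun x => ∫ r in (0 : ℝ)..x, κ r with hΓ
  have hΓc : Continuous Γ :=
    intervalIntegral.continuous_primitive (fun _ _ => hκ.intervalIntegrable) (0 : ℝ)
  -- On intervals shorter than `δ` the coefficient `κ` has mass at most `1/2`; vanishing is
  -- propagated in steps of length `δ / 2`.
  obtain ⟨δ, hδ, huc⟩ := Metric.uniformContinuousOn_iff.1
    (isCompact_Icc.uniformContinuousOn_of_continuous (s := Icc (0 : ℝ) t₁) hΓc.continuousOn)
    (1 / 2) (by norm_num)
  have hκφ : ∀ x y, IntervalIntegrable (fun s => κ s * φ s) volume x y := fun x y =>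
    hκ.intervalIntegrable.mul_continuousOn hφ.continuousOn
  have key : ∀ j : ℕ, ∀ t ∈ Icc 0 t₁, t ≤ j * (δ / 2) → φ t = 0 := by
    intro j
    induction j with
    | zero =>
      intro t ht htj
      have ht0 : t = 0 := le_antisymm (by simpa using htj) ht.1
      have := h t ⟨ht.1, ht.2.trans_lt ht₁.2⟩
      rw [ht0] at this ⊢
      rw [intervalIntegral.integral_same] at this
      exact le_antisymm this (hφ0 0)
    | succ j ih =>
      intro t ht htj
      set b := min t₁ (((j + 1 : ℕ) : ℝ) * (δ / 2)) with hb
      -- At a maximum point `x` past the interval already treated, the hypothesis gives `φ(x) ≤ φ(x)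
      -- / 2`, so the maximum is zero.
      obtain ⟨x, hx, hmax⟩ := (isCompact_Icc (a := (0 : ℝ)) (b := b)).exists_isMaxOn
        ⟨t, ht.1, le_min ht.2 htj⟩ hφ.continuousOn
      have hxt : x ∈ Icc 0 t₁ := ⟨hx.1, hx.2.trans (min_le_left _ _)⟩
      have hφx : φ x = 0 := by
        rcases le_or_gt x (j * (δ / 2)) with hxj | hxj
        · exact ih x hxt hxj
        · have hj0 : 0 ≤ (j : ℝ) * (δ / 2) := by positivity
          have h1 := h x ⟨hxt.1, hxt.2.trans_lt ht₁.2⟩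
          rw [← intervalIntegral.integral_add_adjacent_intervals (hκφ 0 (j * (δ / 2)))
            (hκφ (j * (δ / 2)) x)] at h1
          have h2 : ∫ s in (0 : ℝ)..(j * (δ / 2)), κ s * φ s = 0 := by
            rw [intervalIntegral.integral_congr (g := fun _ => (0 : ℝ)) fun s hs => ?_]
            · simp
            · rw [uIcc_of_le hj0] at hs
              simp only
              rw [ih s ⟨hs.1, hs.2.trans (hxj.le.trans hxt.2)⟩ hs.2, mul_zero]
          have h3 : ∫ s in (j * (δ / 2))..x, κ s * φ s ≤ ∫ s in (j * (δ / 2))..x, κ s * φ x := by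
            refine intervalIntegral.integral_mono_on hxj.le (hκφ _ _)
              (hκ.intervalIntegrable.mul_const _) fun s hs => ?_
            exact mul_le_mul_of_nonneg_left (hmax ⟨hj0.trans hs.1, hs.2.trans hx.2⟩) (hκ0 s)
          have h4 : ∫ s in (j * (δ / 2))..x, κ s ≤ 1 / 2 := by
            have e : ∫ s in (j * (δ / 2))..x, κ s = Γ x - Γ (j * (δ / 2)) :=
              (intervalIntegral.integral_interval_sub_left hκ.intervalIntegrable
                hκ.intervalIntegrable).symm
            rw [e]
            have hxb := hx.2.trans (min_le_right _ _)
            push_cast at hxb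
            have := huc x hxt (j * (δ / 2)) ⟨hj0, hxj.le.trans hxt.2⟩ (by
              rw [Real.dist_eq, abs_of_pos (by linarith)]; linarith)
            rw [Real.dist_eq] at this
            exact (le_abs_self _).trans this.le
          rw [intervalIntegral.integral_mul_const] at h3
          nlinarith [hφ0 x]
      refine le_antisymm ?_ (hφ0 t)
      rw [← hφx]
      exact hmax ⟨ht.1, le_min ht.2 htj⟩
  obtain ⟨j, hj⟩ := exists_nat_gt (t₁ / (δ / 2))
  exact key j t₁ ⟨ht₁.1, le_rfl⟩ ((div_lt_iff₀ (by positivity)).1 hj).le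

/-! ### Bounds of the nonlinear differences on almost every time slice -/

theorem ae_mem_uIoc_of_ae_muI {T a b : ℝ} (ha : 0 ≤ a) (hab : a ≤ b) (hb : b ≤ T) {P : ℝ → Prop}
    (h : ∀ᵐ r ∂(muI T), P r) : ∀ᵐ r, r ∈ uIoc a b → P r := by
  have hT : ∀ᵐ r : ℝ, r ≠ T := by simp [ae_iff, measure_singleton]
  filter_upwards [(ae_restrict_iff' measurableSet_Ioo).1 h, hT] with r hr hrT hm
  rw [uIoc_of_le hab] at hm
  exact hr ⟨ha.trans_lt hm.1, lt_of_le_of_ne (hm.2.trans hb) hrT⟩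

/-- Arithmetic behind the integrability of the source in time: with `d ≤ σ`, everything is at most a
multiple of `σ² (1 + n)`. Here `n`, `d` stand for `‖w‖`, `‖w_x‖` and `q` for `√σ` times the sup
bound of `w`; `b` only makes the constant common to all estimates. -/
theorem source_bound_linear {b l g σ n d q : ℝ} (hb : 0 ≤ b) (hl : 0 ≤ l) (hg : 0 ≤ g)
    (hσ : 0 ≤ σ) (hn : 0 ≤ n) (hdσ : d ≤ σ) (hq : q ^ 2 = 2 * (σ * (n * d))) :
    5 * l * σ ^ 2 * n + g * (2 * q * σ + σ * d) ≤ (b + (5 * l + 3 * g)) * σ ^ 2 * (1 + n) := by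
  have a1 : 2 * q * σ ≤ 2 * (σ * (n * d)) + σ ^ 2 := by linarith [sq_nonneg (q - σ)]
  have a2 : σ * (n * d) ≤ σ * (n * σ) := by gcongr
  have a3 : σ * d ≤ σ * σ := by gcongr
  have a8 : 0 ≤ σ ^ 2 * n := by positivity
  have a9 : 0 ≤ σ ^ 2 := by positivity
  have a4 : 2 * q * σ + σ * d ≤ 3 * (σ ^ 2 * (1 + n)) := by linarith
  have a5 : g * (2 * q * σ + σ * d) ≤ g * (3 * (σ ^ 2 * (1 + n))) := by gcongr
  have a6 : 0 ≤ l * σ ^ 2 := by positivity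
  have a7 : 0 ≤ b * (σ ^ 2 * (1 + n)) := by positivity
  linarith

/-- The form used for Gronwall: after multiplication by `n`, applying `2 q (σ n) ≤ q² + (σ n)²`
keeps one factor `d` free for absorption. -/
theorem source_bound_quadratic {b l g σ n d q : ℝ} (hb : 0 ≤ b) (hl : 0 ≤ l) (hg : 0 ≤ g)
    (hσ : 0 ≤ σ) (hn : 0 ≤ n) (hd : 0 ≤ d) (hq : q ^ 2 = 2 * (σ * (n * d))) :
    (5 * l * σ ^ 2 * n + g * (2 * q * σ + σ * d)) * n
      ≤ (b + (5 * l + 3 * g)) * (σ ^ 2 * n ^ 2 + σ * n * d) := by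
  have a1 : 2 * q * (σ * n) ≤ 2 * (σ * (n * d)) + (σ * n) ^ 2 := by
    linarith [sq_nonneg (q - σ * n)]
  have a2 : 0 ≤ σ ^ 2 * n ^ 2 := by positivity
  have a3 : 0 ≤ σ * n * d := by positivity
  have a4 : (2 * q * σ + σ * d) * n ≤ 3 * (σ ^ 2 * n ^ 2 + σ * n * d) := by linarith
  have a5 : g * ((2 * q * σ + σ * d) * n) ≤ g * (3 * (σ ^ 2 * n ^ 2 + σ * n * d)) := by gcongr
  have a6 : 0 ≤ l * (σ * n * d) := by positivity
  have a7 : 0 ≤ b * (σ ^ 2 * n ^ 2 + σ * n * d) := by positivity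
  linarith

/-- A square integrable weight controlling the nonlinear differences of two functions in `X` with
the same traces. -/
theorem exists_slice_bounds {c : Coeffs} (hp₀ : c.p₀ ∈ Icc (1 : ℝ) 4) (hp₁ : c.p₁ ∈ Icc (1 : ℝ) 2)
    {T R : ℝ} (hR : 0 < R) {u ux v vx : ℝ → ℝ → ℂ} {m n : ℝ → ℂ}
    (hu : IsX T R u ux) (hv : IsX T R v vx)
    (hu0 : ∀ᵐ t ∂(muI T), HasTrace R (u t) 0 (m t)) (huR : ∀ᵐ t ∂(muI T), HasTrace R (u t) R (n t))
    (hv0 : ∀ᵐ t ∂(muI T), HasTrace R (v t) 0 (m t)) (hvR : ∀ᵐ t ∂(muI T), HasTrace R (v t) R (n t))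
    (hF₁ : AEStronglyMeasurable (fun p : ℝ × ℝ => fluxDiff c u v p.1 p.2) (muQ T R))
    (hF₀ : AEStronglyMeasurable (fun p : ℝ × ℝ => sourceDiff c u ux v vx p.1 p.2) (muQ T R)) :
    ∃ s : ℝ → ℝ, ∃ C : ℝ, 0 ≤ C ∧ Integrable (fun t => s t ^ 2) (muI T) ∧ ∀ᵐ t ∂(muI T),
      1 ≤ s t ∧ MemLp (fluxDiff c u v t) 2 (muI R) ∧ MemLp (sourceDiff c u ux v vx t) 2 (muI R) ∧
      ‖sliceCurve R (fluxDiff c u v) t‖ ≤ C * s t * ‖sliceCurve R (fun t x => u t x - v t x) t‖ ∧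
      ‖sliceCurve R (sourceDiff c u ux v vx) t‖
        ≤ C * s t ^ 2 * (1 + ‖sliceCurve R (fun t x => u t x - v t x) t‖) ∧
      ‖sliceCurve R (sourceDiff c u ux v vx) t‖ * ‖sliceCurve R (fun t x => u t x - v t x) t‖
        ≤ C * (s t ^ 2 * ‖sliceCurve R (fun t x => u t x - v t x) t‖ ^ 2
          + s t * ‖sliceCurve R (fun t x => u t x - v t x) t‖
            * ‖sliceCurve R (fun t x => ux t x - vx t x) t‖) := by
  obtain ⟨Mu, hMu⟩ := isCompact_Icc.exists_bound_of_continuousOn hu.contCurve.continuousOn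
  obtain ⟨Mv, hMv⟩ := isCompact_Icc.exists_bound_of_continuousOn hv.contCurve.continuousOn
  set M := max (max Mu Mv) 0 with hM
  have hM0 : 0 ≤ M := le_max_right _ _
  -- `M` bounds `‖u‖` and `‖v‖` on `[0, T]`, and `A` is chosen so that the Sobolev expression `‖u‖²
  -- / R + 2 ‖u‖ ‖u_x‖`, and likewise for `v`, is at most `s`.
  set A := 1 + M ^ 2 / R + 2 * M with hA
  have hA1 : 1 ≤ A := by
    have : 0 ≤ M ^ 2 / R := by positivity
    linarith
  set s : ℝ → ℝ := fun t => A * (1 + ‖sliceCurve R ux t‖ + ‖sliceCurve R vx t‖) with hs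
  -- The factors `3` and `5` on `β + γ` and `lam` are `1 + p₁` and `1 + p₀` at the largest
  -- exponents.
  set C := 3 * |c.β + c.γ| + (5 * |c.lam| + 3 * |c.γ|) with hC
  refine ⟨s, C, by positivity, ?_, ?_⟩
  · have iu : MemLp (fun t => ‖sliceCurve R ux t‖) 2 (muI T) :=
      (memLp_two_iff_integrable_sq
        (aestronglyMeasurable_sliceCurve hu.memLp.1).norm).2 (integrable_sq_norm_sliceCurve hu.memLp)
    have iv : MemLp (fun t => ‖sliceCurve R vx t‖) 2 (muI T) :=
      (memLp_two_iff_integrable_sq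
        (aestronglyMeasurable_sliceCurve hv.memLp.1).norm).2 (integrable_sq_norm_sliceCurve hv.memLp)
    exact ((((memLp_const (1 : ℝ)).add iu).add iv).const_mul A).integrable_sq
  · rw [muQ_eq_prod] at hF₁ hF₀
    filter_upwards [ae_muI_mem T, hu0, huR, hv0, hvR, hu.isH1, hv.isH1, hF₁.prodMk_left,
      hF₀.prodMk_left] with t htT tu0 tuR tv0 tvR Hu Hv mF₁ mF₀
    have htI : t ∈ Icc 0 T := Ioo_subset_Icc_self htT
    have su : ‖sliceCurve R u t‖ ≤ M :=
      (hMu t htI).trans ((le_max_left _ _).trans (le_max_left _ _))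
    have sv : ‖sliceCurve R v t‖ ≤ M :=
      (hMv t htI).trans ((le_max_right _ _).trans (le_max_left _ _))
    obtain ⟨Yu, hYu, eu⟩ := Hu.exists_isPrimitive hR
    obtain ⟨Yv, hYv, ev⟩ := Hv.exists_isPrimitive hR
    obtain ⟨Y, hY, ew, hY0, hYR⟩ := exists_isPrimitive_sub hR Hu Hv tu0 tv0 tuR tvR
    have wL : MemLp ((fun t x => u t x - v t x) t) 2 (muI R) := Hu.1.sub Hv.1
    have wxL : MemLp ((fun t x => ux t x - vx t x) t) 2 (muI R) := Hu.2.1.sub Hv.2.1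
    have bu := hYu.ae_sq_norm_le hR ((sliceCurve_ae Hu.1).trans eu) (sliceCurve_ae Hu.2.1)
    have bv := hYv.ae_sq_norm_le hR ((sliceCurve_ae Hv.1).trans ev) (sliceCurve_ae Hv.2.1)
    have bw := hY.ae_sq_norm_le_of_zero hR hY0
      ((sliceCurve_ae (g := fun t x => u t x - v t x) wL).trans ew)
      (sliceCurve_ae (g := fun t x => ux t x - vx t x) wxL)
    have ewL := sliceCurve_ae (g := fun t x => u t x - v t x) wL
    have ewx := sliceCurve_ae (g := fun t x => ux t x - vx t x) wxL
    have hd : ‖sliceCurve R (fun t x => ux t x - vx t x) t‖ ≤ s t := by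
      have e : sliceCurve R (fun t x => ux t x - vx t x) t
          = sliceCurve R ux t - sliceCurve R vx t := by
        rw [sliceCurve_eq wxL, sliceCurve_eq Hu.2.1, sliceCurve_eq Hv.2.1]
        exact MemLp.toLp_sub Hu.2.1 Hv.2.1
      rw [e]
      refine (norm_sub_le _ _).trans ?_
      have h0 : 0 ≤ ‖sliceCurve R ux t‖ + ‖sliceCurve R vx t‖ := by positivity
      simp only [hs]
      nlinarith
    set W := sliceCurve R (fun t x => u t x - v t x) t with hW
    set Wx := sliceCurve R (fun t x => ux t x - vx t x) t with hWx
    have hs1 : 1 ≤ s t := by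
      have h0 : 0 ≤ ‖sliceCurve R ux t‖ + ‖sliceCurve R vx t‖ := by positivity
      simp only [hs]
      nlinarith
    have hMR : ∀ a b : ℝ, 0 ≤ a → a ≤ M → 0 ≤ b →
        b ≤ ‖sliceCurve R ux t‖ + ‖sliceCurve R vx t‖ → a ^ 2 / R + 2 * (a * b) ≤ s t := by
      intro a b ha haM hb hbs
      have h1 : a ^ 2 / R ≤ M ^ 2 / R := by gcongr
      have h2 : a * b ≤ M * b := by gcongr
      have h3 : M * b ≤ M * (‖sliceCurve R ux t‖ + ‖sliceCurve R vx t‖) := by gcongr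
      have h4 : 0 ≤ M ^ 2 / R := by positivity
      have h5 : 0 ≤ (1 + M ^ 2 / R) * (‖sliceCurve R ux t‖ + ‖sliceCurve R vx t‖) := by positivity
      simp only [hs, hA]
      nlinarith
    have pu : ∀ᵐ x ∂(muI R), ‖u t x‖ ^ 2 ≤ s t := by
      filter_upwards [bu, sliceCurve_ae Hu.1] with x h1 h2
      rw [h2] at h1
      exact h1.trans (hMR _ _ (norm_nonneg _) su (norm_nonneg _)
        (le_add_of_nonneg_right (norm_nonneg _)))
    have pv : ∀ᵐ x ∂(muI R), ‖v t x‖ ^ 2 ≤ s t := by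
      filter_upwards [bv, sliceCurve_ae Hv.1] with x h1 h2
      rw [h2] at h1
      exact h1.trans (hMR _ _ (norm_nonneg _) sv (norm_nonneg _)
        (le_add_of_nonneg_left (norm_nonneg _)))
    -- The sup bound of `w`, which exploits its zero boundary value; `√s · k` is the `q` of the
    -- arithmetic estimates.
    set k := √(2 * (‖W‖ * ‖Wx‖)) with hk
    have pw : ∀ᵐ x ∂(muI R), ‖u t x - v t x‖ ≤ k := by
      filter_upwards [bw, ewL] with x h1 h2
      rw [h2] at h1
      exact Real.le_sqrt_of_sq_le h1
    have pF₁ : ∀ᵐ x ∂(muI R), ‖fluxDiff c u v t x‖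
        ≤ 3 * |c.β + c.γ| * s t * ‖u t x - v t x‖ := by
      filter_upwards [pu, pv] with x h1 h2 using norm_fluxDiff_le hp₁ hs1 h1 h2
    have pF₀ : ∀ᵐ x ∂(muI R), ‖sourceDiff c u ux v vx t x‖
        ≤ 5 * |c.lam| * s t ^ 2 * ‖u t x - v t x‖
        + 2 * |c.γ| * √(s t) * k * ‖ux t x‖ + |c.γ| * s t * ‖ux t x - vx t x‖ := by
      filter_upwards [pu, pv, pw] with x h1 h2 h3 using norm_sourceDiff_le hp₀ hp₁ hs1 h1 h2 h3
    have LF₁ : MemLp (fluxDiff c u v t) 2 (muI R) := wL.of_le_mul mF₁ pF₁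
    have LF₀ : MemLp (sourceDiff c u ux v vx t) 2 (muI R) :=
      (((wL.norm.const_mul (5 * |c.lam| * s t ^ 2)).add
        (Hu.2.1.norm.const_mul (2 * |c.γ| * √(s t) * k))).add
        (wxL.norm.const_mul (|c.γ| * s t))).mono' mF₀ pF₀
    have NF₁ : ‖sliceCurve R (fluxDiff c u v) t‖ ≤ 3 * |c.β + c.γ| * s t * ‖W‖ := by
      refine Lp.norm_le_mul_norm_of_ae_le_mul ?_
      filter_upwards [pF₁, sliceCurve_ae LF₁, ewL] with x h1 h2 h3
      rw [h2, h3]; exact h1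
    have hs0 : 0 ≤ s t := by linarith
    have NF₀ : ‖sliceCurve R (sourceDiff c u ux v vx) t‖ ≤ 5 * |c.lam| * s t ^ 2 * ‖W‖
        + 2 * |c.γ| * √(s t) * k * ‖sliceCurve R ux t‖ + |c.γ| * s t * ‖Wx‖ := by
      refine norm_le_of_ae_le_add (by positivity) (by positivity) (by positivity) ?_
      filter_upwards [pF₀, sliceCurve_ae LF₀, ewL, sliceCurve_ae Hu.2.1, ewx] with x h1 h2 h3 h4 h5
      rw [h2, h3, h4, h5]; exact h1
    have hux : ‖sliceCurve R ux t‖ ≤ s t := by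
      have h0 : 0 ≤ ‖sliceCurve R ux t‖ := norm_nonneg _
      have h1 : 0 ≤ ‖sliceCurve R vx t‖ := norm_nonneg _
      simp only [hs]
      nlinarith
    have hq : (√(s t) * k) ^ 2 = 2 * (s t * (‖W‖ * ‖Wx‖)) := by
      rw [mul_pow, Real.sq_sqrt hs0, hk, Real.sq_sqrt (by positivity)]; ring
    have hq0 : 0 ≤ √(s t) * k := by positivity
    have NF₀' : ‖sliceCurve R (sourceDiff c u ux v vx) t‖ ≤ 5 * |c.lam| * s t ^ 2 * ‖W‖
        + |c.γ| * (2 * (√(s t) * k) * s t + s t * ‖Wx‖) := by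
      refine NF₀.trans ?_
      have : 2 * |c.γ| * √(s t) * k * ‖sliceCurve R ux t‖ ≤ 2 * |c.γ| * √(s t) * k * s t := by
        gcongr
      linarith
    refine ⟨hs1, LF₁, LF₀, NF₁.trans ?_, NF₀'.trans ?_, ?_⟩
    · gcongr
      have : 0 ≤ 5 * |c.lam| + 3 * |c.γ| := by positivity
      linarith
    · exact source_bound_linear (by positivity) (abs_nonneg _) (abs_nonneg _) hs0 (norm_nonneg _)
        hd hq
    · have h1 : ‖sliceCurve R (sourceDiff c u ux v vx) t‖ * ‖W‖
          ≤ (5 * |c.lam| * s t ^ 2 * ‖W‖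
            + |c.γ| * (2 * (√(s t) * k) * s t + s t * ‖Wx‖)) * ‖W‖ := by gcongr
      exact h1.trans (source_bound_quadratic (by positivity) (abs_nonneg _) (abs_nonneg _) hs0
        (norm_nonneg _) (norm_nonneg _) hq)

/-! ### Assembling the uniqueness proof -/

theorem map_steklov {R : ℝ} (L : Lp ℂ 2 (muI R) →L[ℂ] ℂ) {h s : ℝ} {f : ℝ → Lp ℂ 2 (muI R)}
    (hf : IntervalIntegrable f volume s (s + h)) :
    L (steklov h f s) = steklov h (fun r => L (f r)) s := by
  rw [steklov, steklov, L.intervalIntegral_comp_comm hf]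
  exact (L.restrictScalars ℝ).map_smul _ _

theorem intervalIntegral_congr_ae_muI {T a b : ℝ} (ha : 0 ≤ a) (hab : a ≤ b) (hb : b ≤ T)
    {E : Type*} [NormedAddCommGroup E] [NormedSpace ℝ E] {f g : ℝ → E}
    (h : ∀ᵐ r ∂(muI T), f r = g r) : ∫ r in a..b, f r = ∫ r in a..b, g r :=
  intervalIntegral.integral_congr_ae (ae_mem_uIoc_of_ae_muI ha hab hb h)

theorem isProfile_of_tsupport_subset {R : ℝ} {θ : ℝ → ℂ} (hθ : ContDiff ℝ ∞ θ)
    (hs : tsupport θ ⊆ Ioo 0 R) : IsProfile R θ := by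
  refine ⟨hθ, image_eq_zero_of_notMem_tsupport fun hx => (hs hx).1.false,
    image_eq_zero_of_notMem_tsupport fun hx => (hs hx).2.false, ?_⟩
  have : (0 : ℝ) ∉ tsupport (deriv θ) := fun hx => (hs (tsupport_deriv_subset hx)).1.false
  exact image_eq_zero_of_notMem_tsupport this

theorem eq_zero_of_forall_profile {R : ℝ} {y : ℝ → ℂ} (hy : Integrable y (muI R))
    (h : ∀ ψ, IsProfile R ψ → ∫ x, y x * ψ x ∂(muI R) = 0) : y =ᵐ[muI R] 0 := by
  refine ae_eq_zero_of_integral_smul hy fun θ hθ _ hs => h _ ?_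
  refine isProfile_of_tsupport_subset (Complex.ofRealCLM.contDiff.comp hθ) ?_
  refine (closure_mono fun x hx => ?_).trans hs
  intro h0
  exact hx (by simp [h0])

/-- Two weak solutions with the same data coincide. -/
theorem weak_solution_unique {c : Coeffs} (hp₀ : c.p₀ ∈ Icc (1 : ℝ) 4)
    (hp₁ : c.p₁ ∈ Icc (1 : ℝ) 2) {T R : ℝ} (hT : 0 < T) (hR : 0 < R) {u₀ μ ν h : ℝ → ℂ}
    {f u v : ℝ → ℝ → ℂ} (hf : Integrable (fun p : ℝ × ℝ => f p.1 p.2) (muQ T R))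
    (hu : IsWeakSolution c T R u₀ μ ν h f u) (hv : IsWeakSolution c T R u₀ μ ν h f v) :
    ∀ t ∈ Icc 0 T, u t =ᵐ[muI R] v t := by
  obtain ⟨ux, hXu, uμ, uν, hu0, hu1, hu2, hui⟩ := hu
  obtain ⟨vx, hXv, vμ, vν, hv0, hv1, hv2, hvi⟩ := hv
  set w : ℝ → ℝ → ℂ := fun t x => u t x - v t x with hw
  set wx : ℝ → ℝ → ℂ := fun t x => ux t x - vx t x with hwx
  have hwC : IsContCurve T R w := hXu.contCurve.sub hXv.contCurve
  have hwxL : MemLp (fun p : ℝ × ℝ => wx p.1 p.2) 2 (muQ T R) := hXu.memLp.sub hXv.memLp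
  have mF₁ : AEStronglyMeasurable (fun p : ℝ × ℝ => fluxDiff c u v p.1 p.2) (muQ T R) :=
    ((hu1.sub hv1).const_mul _).1
  have mF₀ : AEStronglyMeasurable (fun p : ℝ × ℝ => sourceDiff c u ux v vx p.1 p.2) (muQ T R) :=
    (((hu0.sub hv0).const_mul _).add ((hu2.sub hv2).const_mul _)).1
  have ident : ∀ {ψ : ℝ → ℂ}, IsProfile R ψ → ∀ {t : ℝ}, t ∈ Icc 0 T → _ :=
    fun hψ _ ht => weak_identity_sub hT hR hf hXu hXv hu0 hu1 hu2 hv0 hv1 hv2 hui hvi hψ ht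
  obtain ⟨s, C, hC, hs2, hbd⟩ :=
    exists_slice_bounds hp₀ hp₁ hR hXu hXv uμ uν vμ vν mF₁ mF₀
  -- the curves in `L₂(0, R)`
  set J : Set ℝ := Ioo 0 T with hJ
  set Wc : ℝ → Lp ℂ 2 (muI R) := IccExtend hT.le ((Icc 0 T).domRestrict (sliceCurve R w)) with hWc
  have hWcont : Continuous Wc :=
    (continuousOn_iff_continuous_domRestrict.1 hwC.continuousOn).Icc_extend'
  have hWI : ∀ t ∈ Icc 0 T, Wc t = sliceCurve R w t := fun t ht => IccExtend_of_mem _ _ ht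
  -- Cutting off by zero makes these curves integrable on the line. `Wc` is instead extended by its
  -- endpoint values to stay continuous; only averages over subintervals of `[0, T]` are used.
  set Pc : ℝ → Lp ℂ 2 (muI R) := J.indicator (sliceCurve R wx) with hPc
  set Fc₁ : ℝ → Lp ℂ 2 (muI R) := J.indicator (sliceCurve R (fluxDiff c u v)) with hFc₁
  set Fc₀ : ℝ → Lp ℂ 2 (muI R) := J.indicator (sliceCurve R (sourceDiff c u ux v vx)) with hFc₀
  obtain ⟨M, hM⟩ := isCompact_Icc.exists_bound_of_continuousOn hwC.continuousOn
  have hJm : MeasurableSet J := measurableSet_Ioo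
  have ind : ∀ {g : ℝ → Lp ℂ 2 (muI R)}, Integrable g (muI T) → Integrable (J.indicator g) :=
    fun hg => (integrable_indicator_iff hJm).2 hg
  have ind2 : ∀ {g : ℝ → Lp ℂ 2 (muI R)}, Integrable (fun t => ‖g t‖ ^ 2) (muI T) →
      Integrable fun t => ‖J.indicator g t‖ ^ 2 := fun {g} hg => by
    have e : (fun t => ‖J.indicator g t‖ ^ 2) = J.indicator fun t => ‖g t‖ ^ 2 := by
      ext t
      by_cases ht : t ∈ J <;> simp [ht]
    rw [e]
    exact (integrable_indicator_iff hJm).2 hg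
  have sq_int : ∀ {g : ℝ → Lp ℂ 2 (muI R)}, AEStronglyMeasurable g (muI T) →
      Integrable (fun t => ‖g t‖ ^ 2) (muI T) → Integrable g (muI T) := fun hm hg =>
    ((memLp_two_iff_integrable_sq_norm hm).2 hg).integrable (by norm_num)
  have iP2 := integrable_sq_norm_sliceCurve hwxL
  have iP := sq_int (aestronglyMeasurable_sliceCurve hwxL.1) iP2
  have aF₁ := aestronglyMeasurable_sliceCurve mF₁
  have aF₀ := aestronglyMeasurable_sliceCurve mF₀
  have iF₁2 : Integrable (fun t => ‖sliceCurve R (fluxDiff c u v) t‖ ^ 2) (muI T) := by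
    refine (hs2.const_mul (C ^ 2 * M ^ 2)).mono' (aF₁.norm.pow 2) ?_
    filter_upwards [hbd, ae_muI_mem T] with t ht htT
    obtain ⟨h1, -, -, h2, -, -⟩ := ht
    rw [Real.norm_of_nonneg (by positivity)]
    have h3 := hM t (Ioo_subset_Icc_self htT)
    calc ‖sliceCurve R (fluxDiff c u v) t‖ ^ 2 ≤ (C * s t * M) ^ 2 := by
          gcongr
          exact h2.trans (by gcongr)
      _ = C ^ 2 * M ^ 2 * s t ^ 2 := by ring
  have iF₁ := sq_int aF₁ iF₁2
  have iF₀ : Integrable (sliceCurve R (sourceDiff c u ux v vx)) (muI T) := by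
    refine (hs2.const_mul (C * (1 + M))).mono' aF₀ ?_
    filter_upwards [hbd, ae_muI_mem T] with t ht htT
    obtain ⟨h1, -, -, -, h2, -⟩ := ht
    have h3 := hM t (Ioo_subset_Icc_self htT)
    calc ‖sliceCurve R (sourceDiff c u ux v vx) t‖ ≤ C * s t ^ 2 * (1 + M) := by
          exact h2.trans (by gcongr)
      _ = C * (1 + M) * s t ^ 2 := by ring
  -- slicewise description of the pairings
  have wL : ∀ t ∈ Icc 0 T, MemLp (w t) 2 (muI R) := hwC.memLp
  have wxL := MemLp.ae_memLp_slice hwxL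
  have pair_slice : ∀ {g : ℝ → ℝ → ℂ} {t : ℝ} (_ : MemLp (g t) 2 (muI R)) {ψ : ℝ → ℂ}
      (hψ : Continuous ψ), pairing R ψ hψ (sliceCurve R g t) = ∫ x, g t x * ψ x ∂(muI R) := by
    intro g t hg ψ hψ
    rw [pairing_apply]
    refine integral_congr_ae ?_
    filter_upwards [sliceCurve_ae hg] with x hx
    rw [hx]
  -- At `t = 0` the time integral in the identity is empty, and profiles are numerous enough to
  -- separate `L₂` functions.
  have hW0 : Wc 0 = 0 := by
    have h00 : (0 : ℝ) ∈ Icc 0 T := ⟨le_rfl, hT.le⟩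
    have hz : w 0 =ᵐ[muI R] 0 := by
      refine eq_zero_of_forall_profile ((wL 0 h00).integrable (by norm_num)) fun ψ hψ => ?_
      have := ident hψ h00
      rw [intervalIntegral.integral_same, mul_eq_zero] at this
      exact this.resolve_left Complex.I_ne_zero
    rw [hWI 0 h00]
    refine Lp.ext ((sliceCurve_ae (wL 0 h00)).trans (hz.trans (Lp.coeFn_zero _ _ _).symm))
  obtain ⟨K, hK, hdis⟩ := exists_dissipation_bound hR c.a c.b
  have ii : ∀ {g : ℝ → Lp ℂ 2 (muI R)}, Integrable g → ∀ a b, IntervalIntegrable g volume a b :=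
    fun hg _ _ => hg.intervalIntegrable
  have iiW : ∀ a b, IntervalIntegrable Wc volume a b := fun a b => hWcont.intervalIntegrable a b
  have iiL : ∀ {g : ℝ → Lp ℂ 2 (muI R)} (L : Lp ℂ 2 (muI R) →L[ℂ] ℂ) {a b : ℝ},
      IntervalIntegrable g volume a b → IntervalIntegrable (fun r => L (g r)) volume a b :=
    fun L _ _ hg => ⟨L.integrable_comp hg.1, L.integrable_comp hg.2⟩
  have hdiss : ∀ t h, 0 ≤ t → 0 < h → t + h ≤ T →
      (inner ℂ (weightMul R (steklov h Wc t)) (h⁻¹ • (Wc (t + h) - Wc t))).re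
        ≤ -(1 / 2 * ‖steklov h Pc t‖ ^ 2) + K * (‖steklov h Wc t‖ ^ 2 + ‖steklov h Fc₁ t‖ ^ 2
          + ‖steklov h Fc₀ t‖ * ‖steklov h Wc t‖) := by
    intro t h ht hh hth
    refine hdis _ _ _ _ _ (fun θ hθ => ?_) (fun ψ hψ => ?_)
    -- Zero boundary values are expressed as integration by parts against all smooth `θ`. In this
    -- form they are linear conditions given by continuous functionals, so they pass to Steklov
    -- averages.
    · have cθ := hθ.continuous
      have cθ' : Continuous (deriv θ) := hθ.continuous_deriv (by simp)
      rw [← pairing_apply cθ', ← pairing_apply cθ, map_steklov _ (iiW _ _),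
        map_steklov _ (ii (ind iP) _ _), steklov, steklov, ← smul_neg, ← intervalIntegral.integral_neg]
      congr 1
      refine intervalIntegral_congr_ae_muI ht (by linarith) hth ?_
      filter_upwards [ae_muI_mem T, uμ, uν, vμ, vν, hXu.isH1, hXv.isH1, wxL]
        with r hr h1 h2 h3 h4 h5 h6 h7
      obtain ⟨Y, hY, eY, hY0, hYR⟩ := exists_isPrimitive_sub hR h5 h6 h1 h3 h2 h4
      have hrJ : r ∈ J := hr
      rw [hWI r (Ioo_subset_Icc_self hr), indicator_of_mem hrJ,
        pair_slice (wL r (Ioo_subset_Icc_self hr)), pair_slice h7,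
        ← integral_mul_deriv_of_trace_zero hR hY hY0 hYR hθ]
      refine integral_congr_ae ?_
      filter_upwards [eY] with x hx
      rw [← hx]
    · have g0 : ContDiff ℝ ∞ ψ := hψ.1
      have g1 : ContDiff ℝ ∞ (deriv ψ) := (contDiff_infty_iff_deriv.1 g0).2
      have g2 : ContDiff ℝ ∞ (deriv (deriv ψ)) := (contDiff_infty_iff_deriv.1 g1).2
      have c0 := g0.continuous
      have c1 := g1.continuous
      have c2 := g2.continuous
      have ht1 : t ∈ Icc 0 T := ⟨ht, by linarith⟩
      have ht2 : t + h ∈ Icc 0 T := ⟨by linarith, hth⟩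
      set k : ℝ → ℂ := fun r => (c.a : ℂ) * pairing R _ c1 (Pc r)
        + (Complex.I * c.b) * pairing R _ c1 (Wc r) + pairing R _ c1 (Fc₁ r)
        - Complex.I * pairing R _ c2 (Pc r) + pairing R _ c0 (Fc₀ r) with hk
      have i1 : ∀ a b, IntervalIntegrable (fun r => (c.a : ℂ) * pairing R _ c1 (Pc r)) volume a b :=
        fun a b => (iiL _ (ii (ind iP) a b)).const_mul _
      have i2 : ∀ a b, IntervalIntegrable
          (fun r => (Complex.I * c.b) * pairing R _ c1 (Wc r)) volume a b :=
        fun a b => (iiL _ (iiW a b)).const_mul _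
      have i3 : ∀ a b, IntervalIntegrable (fun r => pairing R _ c1 (Fc₁ r)) volume a b :=
        fun a b => iiL _ (ii (ind iF₁) a b)
      have i4 : ∀ a b, IntervalIntegrable
          (fun r => Complex.I * pairing R _ c2 (Pc r)) volume a b :=
        fun a b => (iiL _ (ii (ind iP) a b)).const_mul _
      have i5 : ∀ a b, IntervalIntegrable (fun r => pairing R _ c0 (Fc₀ r)) volume a b :=
        fun a b => iiL _ (ii (ind iF₀) a b)
      have ik : ∀ a b, IntervalIntegrable k volume a b := fun a b =>
        ((((i1 a b).add (i2 a b)).add (i3 a b)).sub (i4 a b)).add (i5 a b)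
      -- The pairing of `w` with a profile is a primitive of `k`, so its difference quotient is
      -- exactly the Steklov average of `k`: the stationary equation for the averages.
      have hpt : ∀ r ∈ Icc 0 T, Complex.I * pairing R _ c0 (Wc r) = ∫ q in (0 : ℝ)..r, k q := by
        intro r hr
        rw [hWI r hr, pair_slice (wL r hr), ident hψ hr]
        refine intervalIntegral_congr_ae_muI le_rfl hr.1 hr.2 ?_
        filter_upwards [ae_muI_mem T, wxL, hbd] with q hq h1 h2
        obtain ⟨-, h3, h4, -⟩ := h2
        have hqI := Ioo_subset_Icc_self hq
        have h5 := wL q hqI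
        have li : ∀ {g φ : ℝ → ℂ}, MemLp g 2 (muI R) → Continuous φ →
            Integrable (fun x => g x * φ x) (muI R) := fun hg hφ =>
          integrable_mul_continuous hR.le (hg.integrable (by norm_num)) hφ.continuousOn
        have hqJ : q ∈ J := hq
        simp only [hk, hPc, hFc₁, hFc₀, indicator_of_mem hqJ]
        rw [hWI q hqI, pair_slice h1, pair_slice h5, pair_slice h3, pair_slice h1,
          pair_slice h4]
        have j1 := (li h1 c1).const_mul (c.a : ℂ)
        have j2 := (li h5 c1).const_mul (Complex.I * c.b)
        have j3 := li h3 c1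
        have j4 := (li h1 c2).const_mul Complex.I
        have j5 := li h4 c0
        rw [← integral_const_mul, ← integral_const_mul, ← integral_const_mul,
          ← integral_add' j1 j2, ← integral_add' (j1.add j2) j3,
          ← integral_sub' ((j1.add j2).add j3) j4,
          ← integral_add' (((j1.add j2).add j3).sub j4) j5]
        refine integral_congr_ae (ae_of_all _ fun x => ?_)
        simp only [Pi.add_apply, Pi.sub_apply, hw, hwx]
        ring
      have e1 : pairing R ψ c0 (h⁻¹ • (Wc (t + h) - Wc t))
          = (h⁻¹ : ℝ) • (pairing R ψ c0 (Wc (t + h)) - pairing R ψ c0 (Wc t)) := by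
        rw [← map_sub]
        exact ((pairing R ψ c0).restrictScalars ℝ).map_smul _ _
      have e2 : Complex.I * pairing R ψ c0 (h⁻¹ • (Wc (t + h) - Wc t)) = steklov h k t := by
        rw [e1, steklov, mul_smul_comm, mul_sub, hpt _ ht1, hpt _ ht2,
          intervalIntegral.integral_interval_sub_left (ik _ _) (ik _ _)]
      rw [← pairing_apply c0, ← pairing_apply c1, ← pairing_apply c2, ← pairing_apply c0, e2]
      simp only [map_add, map_smul]
      rw [map_steklov _ (iiW _ _), map_steklov _ (ii (ind iP) _ _),
        map_steklov _ (ii (ind iF₁) _ _), map_steklov _ (ii (ind iF₀) _ _),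
        map_steklov _ (ii (ind iP) _ _)]
      simp only [steklov, smul_eq_mul, hk]
      rw [intervalIntegral.integral_add ((((i1 _ _).add (i2 _ _)).add (i3 _ _)).sub (i4 _ _)) (i5 _ _),
        intervalIntegral.integral_sub (((i1 _ _).add (i2 _ _)).add (i3 _ _)) (i4 _ _),
        intervalIntegral.integral_add ((i1 _ _).add (i2 _ _)) (i3 _ _),
        intervalIntegral.integral_add (i1 _ _) (i2 _ _), intervalIntegral.integral_const_mul,
        intervalIntegral.integral_const_mul, intervalIntegral.integral_const_mul]
      simp only [Complex.real_smul]
      ring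
  have energy := fun {t : ℝ} (ht : t ∈ Ico 0 T) => energy_inequality
    (L := weightMul R) inner_weightMul_comm hWcont hW0 (ind iP) (ind2 iP2) (ind iF₁) (ind2 iF₁2)
    (ind iF₀) hK hdiss ht
  -- Gronwall's lemma
  set D := 2 * K * (1 + C ^ 2 + C) + (2 * K * C) ^ 2 with hD
  have hD0 : 0 ≤ D := by positivity
  set κ : ℝ → ℝ := J.indicator fun t => D * s t ^ 2 with hκ
  have hκi : Integrable κ := (integrable_indicator_iff hJm).2 (hs2.const_mul D)
  have hκ0 : ∀ t, 0 ≤ κ t := fun t => indicator_nonneg (fun _ _ => by positivity) t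
  have gron := eq_zero_of_le_integral_mul (T := T) (φ := fun t => ‖Wc t‖ ^ 2) (hWcont.norm.pow 2)
    (fun t => by positivity) hκi hκ0 (fun t ht => by
      have h1 := energy ht
      have h2 := norm_sq_le_re_inner_weightMul (Wc t)
      have iP2' : IntervalIntegrable (fun r => ‖Pc r‖ ^ 2) volume 0 t :=
        (ind2 iP2).intervalIntegrable
      have iκ : IntervalIntegrable (fun r => κ r * ‖Wc r‖ ^ 2) volume 0 t :=
        hκi.intervalIntegrable.mul_continuousOn (hWcont.norm.pow 2).continuousOn
      have iG : IntervalIntegrable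
          (fun r => ‖Wc r‖ ^ 2 + ‖Fc₁ r‖ ^ 2 + ‖Fc₀ r‖ * ‖Wc r‖) volume 0 t :=
        (((hWcont.norm.pow 2).intervalIntegrable _ _).add (ind2 iF₁2).intervalIntegrable).add
          ((ind iF₀).norm.intervalIntegrable.mul_continuousOn hWcont.norm.continuousOn)
      -- The full dissipation `∫ ‖w_x‖²` from the energy inequality is spent here; it cancels
      -- against the left side and leaves a pure Gronwall inequality.
      have h3 : 2 * K * ∫ r in (0 : ℝ)..t, (‖Wc r‖ ^ 2 + ‖Fc₁ r‖ ^ 2 + ‖Fc₀ r‖ * ‖Wc r‖)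
          ≤ (∫ r in (0 : ℝ)..t, κ r * ‖Wc r‖ ^ 2) + ∫ r in (0 : ℝ)..t, ‖Pc r‖ ^ 2 := by
        rw [← intervalIntegral.integral_const_mul, ← intervalIntegral.integral_add iκ iP2']
        refine intervalIntegral.integral_mono_ae_restrict ht.1 (iG.const_mul _) (iκ.add iP2') ?_
        have hae := ae_mem_uIoc_of_ae_muI le_rfl ht.1 ht.2.le
          (hbd.and (ae_muI_mem T))
        rw [uIoc_of_le ht.1] at hae
        rw [← restrict_Ioc_eq_restrict_Icc, EventuallyLE, ae_restrict_iff' measurableSet_Ioc]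
        filter_upwards [hae] with r hr hrm
        obtain ⟨⟨b1, -, -, b2, -, b3⟩, b4⟩ := hr hrm
        have hrJ : r ∈ J := b4
        simp only [hκ, hPc, hFc₁, hFc₀, indicator_of_mem hrJ,
          hWI r (Ioo_subset_Icc_self b4)]
        have n0 := norm_nonneg (sliceCurve R w r)
        have d0 := norm_nonneg (sliceCurve R wx r)
        have f0 := norm_nonneg (sliceCurve R (fluxDiff c u v) r)
        generalize ‖sliceCurve R (sourceDiff c u ux v vx) r‖ = f₀ at *
        generalize ‖sliceCurve R (fluxDiff c u v) r‖ = f₁ at *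
        generalize ‖sliceCurve R w r‖ = n at *
        generalize ‖sliceCurve R wx r‖ = d at *
        generalize s r = σ at *
        have q1 : f₁ ^ 2 ≤ (C * σ * n) ^ 2 := by gcongr
        have q2 : n ^ 2 ≤ σ ^ 2 * n ^ 2 := by
          have : 1 ≤ σ ^ 2 := one_le_pow₀ b1
          nlinarith [sq_nonneg n]
        -- The cross term `s ‖w‖ ‖w_x‖` splits with coefficient exactly `1` on `d²`, the amount
        -- available; the square `(2 K C)²` is the last summand of `D`.
        have q3 : 2 * K * C * (σ * n * d) ≤ (2 * K * C) ^ 2 * (σ ^ 2 * n ^ 2) + d ^ 2 := by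
          have e := sq_nonneg (2 * K * C * (σ * n) - d)
          have e' : 0 ≤ (2 * K * C * (σ * n)) ^ 2 := sq_nonneg _
          nlinarith [sq_nonneg d]
        have q4 : 2 * K * (n ^ 2 + f₁ ^ 2 + f₀ * n)
            ≤ 2 * K * (σ ^ 2 * n ^ 2 + (C * σ * n) ^ 2 + C * (σ ^ 2 * n ^ 2 + σ * n * d)) := by
          gcongr
        rw [hD]
        linarith
      linarith)
  -- Forward averages only reach times `t < T`; the endpoint follows by continuity.
  have hzero : ∀ t ∈ Icc 0 T, Wc t = 0 := by
    have hcl : IsClosed {t | Wc t = 0} := isClosed_eq hWcont continuous_const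
    have hsub : Ico 0 T ⊆ {t | Wc t = 0} := fun t ht => by
      have := gron t ht
      exact norm_eq_zero.1 (pow_eq_zero_iff (two_ne_zero) |>.1 this)
    have := closure_minimal hsub hcl
    rw [closure_Ico hT.ne] at this
    exact fun t ht => this ht
  intro t ht
  have h1 := hzero t ht
  rw [hWI t ht] at h1
  have h2 := sliceCurve_ae (wL t ht)
  rw [h1] at h2
  filter_upwards [h2, Lp.coeFn_zero ℂ 2 (muI R)] with x h3 h4
  rw [h4] at h3
  exact (sub_eq_zero.1 h3.symm)

end HNLS

theorem theorem3 (c : HNLS.Coeffs) (hp₀ : c.p₀ ∈ Set.Icc (1 : ℝ) 4) (hp₁ : c.p₁ ∈ Set.Icc (1 : ℝ) 2)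
    (T R : ℝ) (hT : 0 < T) (hR : 0 < R)
    (u₀ : ℝ → ℂ) (hu₀ : MeasureTheory.MemLp u₀ 2 (HNLS.muI R))
    (μ ν h : ℝ → ℂ) (hμ : MeasureTheory.MemLp μ 2 (HNLS.muI T))
    (hν : MeasureTheory.MemLp ν 2 (HNLS.muI T)) (hh : MeasureTheory.MemLp h 2 (HNLS.muI T))
    (f : ℝ → ℝ → ℂ)
    (hf : MeasureTheory.Integrable (fun p : ℝ × ℝ => f p.1 p.2) (HNLS.muQ T R))
    (u v : ℝ → ℝ → ℂ)
    (hu : HNLS.IsWeakSolution c T R u₀ μ ν h f u)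
    (hv : HNLS.IsWeakSolution c T R u₀ μ ν h f v) :
    ∀ t ∈ Set.Icc 0 T, u t =ᵐ[HNLS.muI R] v t :=
  HNLS.weak_solution_unique hp₀ hp₁ hT hR hf hu hv
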